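/- **Theorem.** Let $\mathscr G$ be a strict topological 2-group, i.e. a category object in the category of (small) topological groups: topological groups $\mathscr G_0$ (objects) and $\mathscr G_1$ (arrows) with source, target, identity and composition maps that are continuous homomorphisms and satisfy the category axioms. Write $\otimes$ for the group laws (often omitted), $I$ for the unit of $\mathscr G_0$ and $1_A$ for identity arrows. *Actions.* A continuous right action of $\mathscr G$ on a small category $\mathscr X$ (a discrete 2-space) is a functor $\mathscr X\times\mathscr G\to\mathscr X$ that satisfies the unit and associativity laws strictly and is continuous on objects and on arrows, $\mathscr X_0$ and $\mathscr X_1$ being discrete. $\mathfrak B\mathscr G$ is the 2-category of such actions, strictly equivariant functors, and natural transformations $\theta$ with $\theta_{x\cdot A}=\theta_x\cdot 1_A$ for all objects $x$ and all $A\in\mathscr G_0$. *The orbit 2-category.* An open sub-2-group $\mathscr U\subseteq\mathscr G$ consists of open subgroups $\mathscr U_0\subseteq\mathscr G_0$, $\mathscr U_1\subseteq\mathscr G_1$ closed under source, target, identities and composition. $\mathscr G/\mathscr U$ is the category with objects the cosets $\mathscr U_0A$, arrows the cosets $\mathscr U_1g$, structure induced from $\mathscr G$, and $\mathscr G$ acting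 by right multiplication. The 2-category $\mathfrak S(\mathscr G)$ has as objects the $\mathscr G/\mathscr U$ for $\mathscr U$ an open sub-2-group. Its morphisms $\mathscr G/\mathscr U\to\mathscr G/\mathscr V$ are the functors $\mathscr U_0X\mapsto\mathscr V_0(A\otimes X)$, $\mathscr U_1g\mapsto\mathscr V_1(1_A\otimes g)$ induced by those $A\in\mathscr G_0$ with $\mathscr U_0\subseteq A^{-1}\mathscr V_0A$ and $\mathscr U_1\subseteq 1_A^{-1}\mathscr V_11_A$. Its 2-cells, between the functors induced by $A$ and $B$, are the transformations with components $\mathscr V_1(g\otimes 1_X)$ at $\mathscr U_0X$ induced by arrows $g\colon A\to B$ of $\mathscr G$ such that $g\otimes1_X\otimes g^{-1}\in\mathscr V_1$ for all $X\in\mathscr U_0$. Compositions are those of functors and transformations. *2-sheaves.* A sieve on an object $C$ of a 2-category $\mathfrak C$ is a 2-natural transformation $S\to\mathfrak C(-,C)$ into the representable 2-functor $\mathfrak C^{op}\to\mathfrak{Cat}$ that is pointwise injective on objects and faithful. It is generated by $f\colon D\to C$ if its objects are the arrows that factor through $f$ and its morphisms are the vertical composites of 2-cells $f*\beta$, for 2-cells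 $\beta$ between arrows into $D$. The covering sieves of the atomic topology $J_{at}$ are those generated by a single arrow. A 2-sheaf is a 2-functor $F\colon\mathfrak C^{op}\to\mathfrak{Cat}$ such that, for every covering sieve $S\to\mathfrak C(-,C)$, restriction $[\mathfrak C^{op},\mathfrak{Cat}](\mathfrak C(-,C),F)\to[\mathfrak C^{op},\mathfrak{Cat}](S,F)$ is an isomorphism of categories. $\mathfrak{Sh}(\mathfrak C,J_{at})$ is the 2-category of 2-sheaves, 2-natural transformations and modifications. *The 2-functors.* $\Phi\colon\mathfrak B\mathscr G\to[\mathfrak S(\mathscr G)^{op},\mathfrak{Cat}]$ is $\Phi(\mathscr X)=\mathfrak B\mathscr G(-,\mathscr X)$, acting on morphisms and 2-cells by postcomposition. For a 2-functor $F\colon\mathfrak S(\mathscr G)^{op}\to\mathfrak{Cat}$, $\Psi(F)=\operatorname{colim}_{\mathscr U}F(\mathscr G/\mathscr U)$ is the filtered colimit of categories over the open sub-2-groups ordered by reverse inclusion, with transition functors the restrictions along the functors $\mathscr G/\mathscr V\to\mathscr G/\mathscr U$ induced by $I$ for $\mathscr V\subseteq\mathscr U$. Thus every object and every arrow is a class $[\mathscr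 U,X]$, $[\mathscr U,m]$ of an object $X$ or arrow $m$ of $F(\mathscr G/\mathscr U)$, and two classes coincide iff their representatives have equal restrictions to some common smaller $\mathscr W$. The action of $\mathscr G$ on $\Psi(F)$ is $[\mathscr U,X]\cdot A=[\mathscr O,F(A)(X)]$ for every morphism $\mathscr G/\mathscr O\to\mathscr G/\mathscr U$ induced by $A$, and $[\mathscr U,m]\cdot g=[\mathscr O,F(g)_Y\circ F(A)(m)]$ for $m\colon X\to Y$ and every 2-cell between morphisms $\mathscr G/\mathscr O\to\mathscr G/\mathscr U$ induced by $g\colon A\to B$. On 2-natural transformations $\theta$ and modifications $\mu$, $\Psi(\theta)[\mathscr U,X]=[\mathscr U,\theta_{\mathscr G/\mathscr U}(X)]$, $\Psi(\theta)[\mathscr U,m]=[\mathscr U,\theta_{\mathscr G/\mathscr U}(m)]$ and $\Psi(\mu)_{[\mathscr U,X]}=[\mathscr U,\mu_{\mathscr G/\mathscr U,X}]$. *Conclusion.* For every $\mathscr X$ in $\mathfrak B\mathscr G$, $\Phi(\mathscr X)$ is a 2-sheaf for $J_{at}$; there is a 2-functor $\Psi\colon[\mathfrak S(\mathscr G)^{op},\mathfrak{Cat}]\to\mathfrak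 B\mathscr G$ with the above description; and $\Phi$, together with the restriction of $\Psi$ to 2-sheaves, is a 2-equivalence $$\mathfrak B\mathscr G\simeq\mathfrak{Sh}(\mathfrak S(\mathscr G),J_{at}),$$ that is, there are 2-natural isomorphisms $1\cong\Psi\Phi$ and $\Phi\Psi\cong1$. -/

import Mathlib

open CategoryTheory Bicategory Opposite

universe w₁ v₁ u₁ w₂ v₂ u₂ u

namespace TwoElmendorf

section TwoCategories

variable {B : Type u₁} [Bicategory.{w₁, v₁} B] [Bicategory.Strict B]
  {C : Type u₂} [Bicategory.{w₂, v₂} C] [Bicategory.Strict C]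

/-- A 2-natural transformation between 2-functors. -/
@[ext]
structure TwoNatTrans (F G : StrictPseudofunctor B C) where
  app (a : B) : F.obj a ⟶ G.obj a
  naturality {a b : B} (f : a ⟶ b) : F.map f ≫ app b = app a ≫ G.map f
  naturality₂ {a b : B} {f g : a ⟶ b} (η : f ⟶ g) :
    F.map₂ η ▷ app b ≫ eqToHom (naturality g) =
      eqToHom (naturality f) ≫ app a ◁ G.map₂ η

namespace TwoNatTrans

variable {F G H : StrictPseudofunctor B C}

/-- The identity 2-natural transformation. -/
@[simps]
def id (F : StrictPseudofunctor B C) : TwoNatTrans F F where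
  app a := 𝟙 (F.obj a)
  naturality f := (Strict.comp_id _).trans (Strict.id_comp _).symm
  naturality₂ η := by
    simp [Strict.leftUnitor_eqToIso, Strict.rightUnitor_eqToIso]

/-- Composition of 2-natural transformations. -/
@[simps]
def comp (θ : TwoNatTrans F G) (κ : TwoNatTrans G H) : TwoNatTrans F H where
  app a := θ.app a ≫ κ.app a
  naturality {a b} f := by
    rw [← Strict.assoc, θ.naturality, Strict.assoc, κ.naturality, Strict.assoc]
  naturality₂ {a b f g} η := by
    have h₁ := congrArg (fun x => x ▷ κ.app b) (θ.naturality₂ η)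
    have h₂ := congrArg (fun x => θ.app a ◁ x) (κ.naturality₂ η)
    simp only [comp_whiskerRight, eqToHom_whiskerRight, whiskerLeft_comp, whiskerLeft_eqToHom]
      at h₁ h₂
    simp [Strict.associator_eqToIso] at h₁ h₂ ⊢
    rw [comp_eqToHom_iff] at h₁ h₂
    simp [h₁, h₂]

end TwoNatTrans

/-- A modification between 2-natural transformations. -/
@[ext]
structure Modification {F G : StrictPseudofunctor B C} (θ γ : TwoNatTrans F G) where
  app (a : B) : θ.app a ⟶ γ.app a
  naturality {a b : B} (f : a ⟶ b) :
    F.map f ◁ app b ≫ eqToHom (γ.naturality f) =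
      eqToHom (θ.naturality f) ≫ app a ▷ G.map f

namespace Modification

variable {F G H : StrictPseudofunctor B C}

/-- The identity modification. -/
@[simps]
def id (θ : TwoNatTrans F G) : Modification θ θ where
  app a := 𝟙 (θ.app a)
  naturality f := by simp

/-- Vertical composition of modifications. -/
@[simps]
def vcomp {θ γ δ : TwoNatTrans F G} (m : Modification θ γ) (n : Modification γ δ) :
    Modification θ δ where
  app a := m.app a ≫ n.app a
  naturality f := by
    rw [whiskerLeft_comp, Category.assoc, n.naturality, ← Category.assoc, m.naturality,
      Category.assoc, comp_whiskerRight]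

end Modification

instance : CategoryStruct (StrictPseudofunctor B C) where
  Hom F G := TwoNatTrans F G
  id F := TwoNatTrans.id F
  comp θ κ := θ.comp κ

instance homCategory (F G : StrictPseudofunctor B C) : Category (F ⟶ G) where
  Hom θ γ := Modification θ γ
  id θ := Modification.id θ
  comp m n := m.vcomp n
  id_comp m := by ext; simp
  comp_id m := by ext; simp
  assoc m n p := by ext; simp

section Simp

variable {F G H : StrictPseudofunctor B C}

@[simp] theorem id_app (a : B) : (𝟙 F : F ⟶ F).app a = 𝟙 (F.obj a) := rfl

@[simp] theorem comp_app (θ : F ⟶ G) (κ : G ⟶ H) (a : B) :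
    (θ ≫ κ).app a = θ.app a ≫ κ.app a := rfl

@[simp] theorem id_mod_app (θ : F ⟶ G) (a : B) :
    Modification.app (𝟙 θ) a = 𝟙 (θ.app a) := rfl

@[simp] theorem comp_mod_app {θ γ δ : F ⟶ G} (m : θ ⟶ γ) (n : γ ⟶ δ) (a : B) :
    Modification.app (m ≫ n) a = Modification.app m a ≫ Modification.app n a := rfl

theorem mod_ext {θ γ : F ⟶ G} {m n : θ ⟶ γ}
    (h : ∀ a, Modification.app m a = Modification.app n a) : m = n :=
  Modification.ext (funext h)

@[simp] theorem eqToHom_mod_app {θ γ : F ⟶ G} (h : θ = γ) (a : B) :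
    Modification.app (eqToHom h) a = eqToHom (by rw [h]) := by
  subst h; rfl

end Simp


section Whiskering

variable {F G H K : StrictPseudofunctor B C}

/-- Whiskering a modification on the left. -/
def modWhiskerLeft (κ : F ⟶ G) {θ γ : G ⟶ H} (m : θ ⟶ γ) : κ ≫ θ ⟶ κ ≫ γ :=
  Modification.mk (θ := κ ≫ θ) (γ := κ ≫ γ) (fun a => κ.app a ◁ Modification.app m a) <| by
    intro a b f
    have e₁ : F.map f ≫ κ.app b ≫ γ.app b = (κ.app a ≫ γ.app a) ≫ H.map f :=
      (κ ≫ γ).naturality f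
    have e₂ : F.map f ≫ κ.app b ≫ θ.app b = (κ.app a ≫ θ.app a) ≫ H.map f :=
      (κ ≫ θ).naturality f
    change F.map f ◁ (κ.app b ◁ Modification.app m b) ≫ eqToHom e₁ =
      eqToHom e₂ ≫ (κ.app a ◁ Modification.app m a) ▷ H.map f
    have h₁ := congrArg (fun x => κ.app a ◁ x) (Modification.naturality m f)
    have h₂ := whisker_exchange (eqToHom (κ.naturality f)) (Modification.app m b)
    simp only [whiskerLeft_comp, whiskerLeft_eqToHom, eqToHom_whiskerRight] at h₁ h₂
    simp [Strict.associator_eqToIso] at h₁ h₂ ⊢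
    rw [comp_eqToHom_iff] at h₁
    rw [eqToHom_comp_iff, comp_eqToHom_iff] at h₂
    simp [h₁, h₂]

/-- Whiskering a modification on the right. -/
def modWhiskerRight {θ γ : F ⟶ G} (m : θ ⟶ γ) (κ : G ⟶ H) : θ ≫ κ ⟶ γ ≫ κ :=
  Modification.mk (θ := θ ≫ κ) (γ := γ ≫ κ) (fun a => Modification.app m a ▷ κ.app a) <| by
    intro a b f
    have e₁ : F.map f ≫ γ.app b ≫ κ.app b = (γ.app a ≫ κ.app a) ≫ H.map f :=
      (γ ≫ κ).naturality f
    have e₂ : F.map f ≫ θ.app b ≫ κ.app b = (θ.app a ≫ κ.app a) ≫ H.map f :=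
      (θ ≫ κ).naturality f
    change F.map f ◁ (Modification.app m b ▷ κ.app b) ≫ eqToHom e₁ =
      eqToHom e₂ ≫ (Modification.app m a ▷ κ.app a) ▷ H.map f
    have h₁ := congrArg (fun x => x ▷ κ.app b) (Modification.naturality m f)
    have h₂ := whisker_exchange (Modification.app m a) (eqToHom (κ.naturality f))
    simp only [comp_whiskerRight, whiskerLeft_eqToHom, eqToHom_whiskerRight] at h₁ h₂
    simp [Strict.associator_eqToIso] at h₁ h₂ ⊢
    rw [eqToHom_comp_iff, comp_eqToHom_iff] at h₁
    rw [eqToHom_comp_iff, comp_eqToHom_iff] at h₂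
    simp [h₁, h₂]

@[simp] theorem modWhiskerLeft_app (κ : F ⟶ G) {θ γ : G ⟶ H} (m : θ ⟶ γ) (a : B) :
    Modification.app (modWhiskerLeft κ m) a = κ.app a ◁ Modification.app m a := rfl

@[simp] theorem modWhiskerRight_app {θ γ : F ⟶ G} (m : θ ⟶ γ) (κ : G ⟶ H) (a : B) :
    Modification.app (modWhiskerRight m κ) a = Modification.app m a ▷ κ.app a := rfl

/-- Associativity of composition of 2-natural transformations, as an isomorphism. -/
def assocIso (θ : F ⟶ G) (κ : G ⟶ H) (ι : H ⟶ K) : (θ ≫ κ) ≫ ι ≅ θ ≫ κ ≫ ι :=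
  eqToIso (TwoNatTrans.ext (funext fun _ => Strict.assoc _ _ _))

/-- The left unit law, as an isomorphism. -/
def leftUnitIso (θ : F ⟶ G) : 𝟙 F ≫ θ ≅ θ :=
  eqToIso (TwoNatTrans.ext (funext fun _ => Strict.id_comp _))

/-- The right unit law, as an isomorphism. -/
def rightUnitIso (θ : F ⟶ G) : θ ≫ 𝟙 G ≅ θ :=
  eqToIso (TwoNatTrans.ext (funext fun _ => Strict.comp_id _))

@[simp] theorem assocIso_hom_app (θ : F ⟶ G) (κ : G ⟶ H) (ι : H ⟶ K) (a : B) :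
    Modification.app (assocIso θ κ ι).hom a = (α_ (θ.app a) (κ.app a) (ι.app a)).hom := by
  simp [assocIso, Strict.associator_eqToIso]

@[simp] theorem assocIso_inv_app (θ : F ⟶ G) (κ : G ⟶ H) (ι : H ⟶ K) (a : B) :
    Modification.app (assocIso θ κ ι).inv a = (α_ (θ.app a) (κ.app a) (ι.app a)).inv := by
  simp [assocIso, Strict.associator_eqToIso]

@[simp] theorem leftUnitIso_hom_app (θ : F ⟶ G) (a : B) :
    Modification.app (leftUnitIso θ).hom a = (λ_ (θ.app a)).hom := by
  simp [leftUnitIso, Strict.leftUnitor_eqToIso]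

@[simp] theorem leftUnitIso_inv_app (θ : F ⟶ G) (a : B) :
    Modification.app (leftUnitIso θ).inv a = (λ_ (θ.app a)).inv := by
  simp [leftUnitIso, Strict.leftUnitor_eqToIso]

@[simp] theorem rightUnitIso_hom_app (θ : F ⟶ G) (a : B) :
    Modification.app (rightUnitIso θ).hom a = (ρ_ (θ.app a)).hom := by
  simp [rightUnitIso, Strict.rightUnitor_eqToIso]

@[simp] theorem rightUnitIso_inv_app (θ : F ⟶ G) (a : B) :
    Modification.app (rightUnitIso θ).inv a = (ρ_ (θ.app a)).inv := by
  simp [rightUnitIso, Strict.rightUnitor_eqToIso]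

end Whiskering

/-- The 2-category of 2-functors, 2-natural transformations and modifications. -/
instance : Bicategory (StrictPseudofunctor B C) where
  whiskerLeft κ _ _ m := modWhiskerLeft κ m
  whiskerRight m κ := modWhiskerRight m κ
  associator θ κ γ := assocIso θ κ γ
  leftUnitor θ := leftUnitIso θ
  rightUnitor θ := rightUnitIso θ
  whiskerLeft_id _ _ := by apply mod_ext; intro a; simp
  whiskerLeft_comp _ _ _ _ _ _ := by apply mod_ext; intro a; simp
  id_whiskerLeft _ := by apply mod_ext; intro a; simp
  comp_whiskerLeft _ _ _ _ _ := by apply mod_ext; intro a; simp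
  id_whiskerRight _ _ := by apply mod_ext; intro a; simp
  comp_whiskerRight _ _ _ := by apply mod_ext; intro a; simp
  whiskerRight_id _ := by apply mod_ext; intro a; simp
  whiskerRight_comp _ _ _ := by apply mod_ext; intro a; simp
  whisker_assoc _ _ _ _ _ := by apply mod_ext; intro a; simp
  whisker_exchange _ _ := by apply mod_ext; intro a; exact whisker_exchange _ _
  pentagon _ _ _ _ := by apply mod_ext; intro a; simp
  triangle _ _ := by apply mod_ext; intro a; simp

instance : Strict (StrictPseudofunctor B C) where
  id_comp _ := TwoNatTrans.ext (funext fun _ => Strict.id_comp _)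
  comp_id _ := TwoNatTrans.ext (funext fun _ => Strict.comp_id _)
  assoc _ _ _ := TwoNatTrans.ext (funext fun _ => Strict.assoc _ _ _)
  leftUnitor_eqToIso _ := rfl
  rightUnitor_eqToIso _ := rfl
  associator_eqToIso _ _ _ := rfl

variable (F G : StrictPseudofunctor B C)

/-- A 2-natural isomorphism: a 2-natural transformation whose components are isomorphisms. -/
structure TwoNatIso where
  hom : TwoNatTrans F G
  isIso_app (a : B) : IsIso (hom.app a)

variable (B C)

/-- A 2-equivalence of 2-categories: 2-functors in both directions with 2-natural isomorphisms
from the identity to one composite and from the other composite to the identity. -/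
structure TwoEquivalence where
  functor : StrictPseudofunctor B C
  inverse : StrictPseudofunctor C B
  unit : TwoNatIso (StrictPseudofunctor.id B) (functor.comp inverse)
  counit : TwoNatIso (inverse.comp functor) (StrictPseudofunctor.id C)

end TwoCategories

open Bicategory.Opposite in
@[simp] theorem unop2_eqToHom {B : Type u₁} [Bicategory.{w₁, v₁} B] {a b : Bᵒᵖ} {f g : a ⟶ b}
    (h : f = g) : (eqToHom h).unop2 = eqToHom (congrArg Quiver.Hom.unop h) := by
  subst h; rfl

open Bicategory.Opposite in
theorem hom2_ext {B : Type u₁} [Bicategory.{w₁, v₁} B] {a b : Bᵒᵖ} {f g : a ⟶ b}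
    {η θ : f ⟶ g} (h : η.unop2 = θ.unop2) : η = θ :=
  congrArg op2 h

instance opStrict {B : Type u₁} [Bicategory.{w₁, v₁} B] [Strict B] : Strict Bᵒᵖ where
  id_comp f := congrArg Quiver.Hom.op (Strict.comp_id f.unop)
  comp_id f := congrArg Quiver.Hom.op (Strict.id_comp f.unop)
  assoc f g h := congrArg Quiver.Hom.op (Strict.assoc h.unop g.unop f.unop).symm
  leftUnitor_eqToIso f := Iso.ext (hom2_ext (by simp [Strict.rightUnitor_eqToIso]))
  rightUnitor_eqToIso f := Iso.ext (hom2_ext (by simp [Strict.leftUnitor_eqToIso]))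
  associator_eqToIso f g h := Iso.ext (hom2_ext (by simp [Strict.associator_eqToIso]))

section Representable

variable {C : Type u₁} [Bicategory.{w₁, v₁} C] [Strict C]
  {D : Type u₂} [Bicategory.{w₂, v₂} D] [Strict D]

section HEqLemmas

theorem heq_iff_conj {a b : D} {f g f' g' : a ⟶ b} (hf : f = f') (hg : g = g')
    (η : f ⟶ g) (θ : f' ⟶ g') : HEq η θ ↔ η = eqToHom hf ≫ θ ≫ eqToHom hg.symm := by
  subst hf; subst hg; simp

theorem heq_id_whiskerLeft {a b : D} {f g : a ⟶ b} (η : f ⟶ g) : HEq (𝟙 a ◁ η) η :=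
  (heq_iff_conj (Strict.id_comp f) (Strict.id_comp g) _ _).2 (by
    simp [Strict.leftUnitor_eqToIso])

theorem heq_whiskerRight_id {a b : D} {f g : a ⟶ b} (η : f ⟶ g) : HEq (η ▷ 𝟙 b) η :=
  (heq_iff_conj (Strict.comp_id f) (Strict.comp_id g) _ _).2 (by
    simp [Strict.rightUnitor_eqToIso])

theorem heq_comp_whiskerLeft {a b c d : D} (f : a ⟶ b) (g : b ⟶ c) {h k : c ⟶ d} (η : h ⟶ k) :
    HEq ((f ≫ g) ◁ η) (f ◁ g ◁ η) :=
  (heq_iff_conj (Strict.assoc f g h) (Strict.assoc f g k) _ _).2 (by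
    simp [Strict.associator_eqToIso])

theorem heq_whiskerRight_comp {a b c d : D} {f g : a ⟶ b} (η : f ⟶ g) (h : b ⟶ c) (k : c ⟶ d) :
    HEq (η ▷ (h ≫ k)) (η ▷ h ▷ k) :=
  (heq_iff_conj (Strict.assoc f h k).symm (Strict.assoc g h k).symm _ _).2 (by
    simp [Strict.associator_eqToIso])

theorem heq_whisker_assoc {a b c d : D} (f : a ⟶ b) {g h : b ⟶ c} (η : g ⟶ h) (k : c ⟶ d) :
    HEq ((f ◁ η) ▷ k) (f ◁ (η ▷ k)) :=
  (heq_iff_conj (Strict.assoc f g k) (Strict.assoc f h k) _ _).2 (by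
    simp [Strict.associator_eqToIso])

theorem heq_whiskerRight {a b c : D} {f g f' g' : a ⟶ b} (hf : f = f') (hg : g = g')
    {η : f ⟶ g} {θ : f' ⟶ g'} (h : HEq η θ) (k : b ⟶ c) : HEq (η ▷ k) (θ ▷ k) := by
  subst hf; subst hg; rw [eq_of_heq h]

theorem heq_map₂_whiskerLeft (J : StrictPseudofunctor C D) {a b c : C} (f : a ⟶ b)
    {g h : b ⟶ c} (η : g ⟶ h) : HEq (J.map₂ (f ◁ η)) (J.map f ◁ J.map₂ η) :=
  (heq_iff_conj (J.map_comp f g) (J.map_comp f h) _ _).2 (by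
    simp [J.mapComp_eq_eqToIso])

theorem heq_map₂_whiskerRight (J : StrictPseudofunctor C D) {a b c : C} {f g : a ⟶ b}
    (η : f ⟶ g) (h : b ⟶ c) : HEq (J.map₂ (η ▷ h)) (J.map₂ η ▷ J.map h) :=
  (heq_iff_conj (J.map_comp f h) (J.map_comp g h) _ _).2 (by
    simp [J.mapComp_eq_eqToIso])

theorem cat_conj {A A' : Cat.{w₁, v₁}} {F G F' G' : A ⟶ A'} (hF : F = F') (hG : G = G')
    (α : F ⟶ G) (β : F' ⟶ G') (h : ∀ x, HEq (α.toNatTrans.app x) (β.toNatTrans.app x)) :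
    α = eqToHom hF ≫ β ≫ eqToHom hG.symm := by
  subst hF; subst hG
  simp only [eqToHom_refl, Category.id_comp, Category.comp_id]
  ext x
  exact eq_of_heq (h x)

theorem cat_square {A A' : Cat.{w₁, v₁}} {F G F' G' : A ⟶ A'} (hF : F = F') (hG : G = G')
    (α : F ⟶ G) (β : F' ⟶ G') (h : ∀ x, HEq (α.toNatTrans.app x) (β.toNatTrans.app x)) :
    α ≫ eqToHom hG = eqToHom hF ≫ β := by
  rw [cat_conj hF hG α β h]; simp

theorem mod_conj {B : Type u₂} [Bicategory.{w₂, v₂} B] [Strict B] 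
    {F G : StrictPseudofunctor B Cat.{w₁, v₁}} {θ γ θ' γ' : F ⟶ G}
    (hθ : θ = θ') (hγ : γ = γ') (m : θ ⟶ γ) (n : θ' ⟶ γ')
    (h : ∀ a x, HEq ((Modification.app m a).toNatTrans.app x)
      ((Modification.app n a).toNatTrans.app x)) :
    m = eqToHom hθ ≫ n ≫ eqToHom hγ.symm := by
  subst hθ; subst hγ
  simp only [eqToHom_refl, Category.id_comp, Category.comp_id]
  apply mod_ext; intro a; ext x
  exact eq_of_heq (h a x)

end HEqLemmas

theorem precomp_id (a b : D) : precomp b (𝟙 a) = 𝟭 (a ⟶ b) :=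
  CategoryTheory.Functor.hext Strict.id_comp fun _ _ η => heq_id_whiskerLeft η

theorem precomp_comp {a b c : D} (f : a ⟶ b) (g : b ⟶ c) (d : D) :
    precomp d (f ≫ g) = precomp d g ⋙ precomp d f :=
  CategoryTheory.Functor.hext (Strict.assoc f g) fun _ _ η => heq_comp_whiskerLeft f g η

theorem postcomp_id (a b : D) : postcomp a (𝟙 b) = 𝟭 (a ⟶ b) :=
  CategoryTheory.Functor.hext Strict.comp_id fun _ _ η => heq_whiskerRight_id η

theorem postcomp_comp {b c d : D} (a : D) (f : b ⟶ c) (g : c ⟶ d) :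
    postcomp a (f ≫ g) = postcomp a f ⋙ postcomp a g :=
  CategoryTheory.Functor.hext (fun h => (Strict.assoc h f g).symm) fun _ _ η =>
    heq_whiskerRight_comp η f g

theorem precomp_postcomp {a b c d : D} (f : a ⟶ b) (g : c ⟶ d) :
    precomp c f ⋙ postcomp a g = postcomp b g ⋙ precomp d f :=
  CategoryTheory.Functor.hext (fun h => Strict.assoc f h g) fun _ _ η =>
    heq_whisker_assoc f η g

theorem rep_map_comp (J : StrictPseudofunctor C D) (X : D) {a b c : Cᵒᵖ} (f : a ⟶ b)
    (g : b ⟶ c) :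
    (precomp X (J.map (f ≫ g).unop)).toCatHom =
      (precomp X (J.map f.unop)).toCatHom ≫ (precomp X (J.map g.unop)).toCatHom :=
  congrArg Functor.toCatHom <| by
    rw [unop_comp, J.map_comp]; exact precomp_comp _ _ _

/-- The 2-functor `D(J -, X)` on `Cᵒᵖ`, for a 2-functor `J : C → D` and an object `X` of `D`. -/
def rep (J : StrictPseudofunctor C D) (X : D) :
    StrictPseudofunctor Cᵒᵖ Cat.{w₂, v₂} :=
  StrictPseudofunctor.mk''
    { obj := fun a => Cat.of (J.obj a.unop ⟶ X)
      map := fun f => (precomp X (J.map f.unop)).toCatHom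
      map₂ := fun η => ((precomposing _ _ X).map (J.map₂ η.unop2)).toCatHom₂
      map₂_id := fun f => by simp; rfl
      map₂_comp := fun η θ => by simp; rfl
      map_id := fun a => congrArg Functor.toCatHom <| by
        rw [unop_id, J.map_id]; exact precomp_id _ _
      map_comp := fun f g => rep_map_comp J X f g
      map₂_whisker_left := fun f g h η =>
        cat_conj (rep_map_comp J X f g) (rep_map_comp J X f h) _ _ fun x =>
        (heq_whiskerRight (J.map_comp _ _) (J.map_comp _ _)
          (heq_map₂_whiskerRight J η.unop2 f.unop) x).trans
          (heq_whiskerRight_comp _ _ _).symm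
      map₂_whisker_right := fun η g =>
        cat_conj (rep_map_comp J X _ g) (rep_map_comp J X _ g) _ _ fun x =>
        (heq_whiskerRight (J.map_comp _ _) (J.map_comp _ _)
          (heq_map₂_whiskerLeft J g.unop η.unop2) x).trans
          (heq_whisker_assoc _ _ _) }

/-- Postcomposition with `h : X ⟶ Y`, as a 2-natural transformation `D(J -, X) ⟶ D(J -, Y)`. -/
def nerveMap (J : StrictPseudofunctor C D) {X Y : D} (h : X ⟶ Y) : rep J X ⟶ rep J Y :=
  TwoNatTrans.mk (fun a => (postcomp (J.obj a.unop) h).toCatHom)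
    (fun _ => congrArg Functor.toCatHom (precomp_postcomp _ _))
    (fun _ => cat_square _ _ _ _ fun _ => (heq_whiskerRight_comp _ _ _).symm)

theorem nerveMap_comp (J : StrictPseudofunctor C D) {X Y Z : D} (f : X ⟶ Y) (g : Y ⟶ Z) :
    nerveMap J (f ≫ g) = nerveMap J f ≫ nerveMap J g :=
  TwoNatTrans.ext <| funext fun _ => congrArg Functor.toCatHom (postcomp_comp _ _ _)

/-- Postcomposition with a 2-cell, as a modification. -/
def nerveMap₂ (J : StrictPseudofunctor C D) {X Y : D} {h k : X ⟶ Y} (η : h ⟶ k) :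
    nerveMap J h ⟶ nerveMap J k :=
  Modification.mk (θ := nerveMap J h) (γ := nerveMap J k)
    (fun a => ((postcomposing (J.obj a.unop) _ _).map η).toCatHom₂)
    (fun _ => cat_square _ _ _ _ fun _ => heq_comp_whiskerLeft _ _ _)

/-- The 2-functor sending an object `X` of `D` to the 2-presheaf `D(J -, X)`; it acts on 1-cells
and 2-cells of `D` by postcomposition. -/
def nerve (J : StrictPseudofunctor C D) :
    StrictPseudofunctor D (StrictPseudofunctor Cᵒᵖ Cat.{w₂, v₂}) :=
  StrictPseudofunctor.mk''
    { obj := fun X => rep J X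
      map := fun h => nerveMap J h
      map₂ := fun η => nerveMap₂ J η
      map₂_id := fun f => mod_ext fun a => Cat.Hom₂.ext <| NatTrans.ext <| funext fun x =>
        whiskerLeft_id x f
      map₂_comp := fun η θ => mod_ext fun a => Cat.Hom₂.ext <| NatTrans.ext <| funext fun x =>
        whiskerLeft_comp x η θ
      map_id := fun X => TwoNatTrans.ext <| funext fun a =>
        congrArg Functor.toCatHom (postcomp_id _ _)
      map_comp := fun f g => nerveMap_comp J f g
      map₂_whisker_left := fun f g h η =>
        mod_conj (nerveMap_comp J f g) (nerveMap_comp J f h) _ _ fun a x =>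
          (heq_comp_whiskerLeft _ _ _).symm
      map₂_whisker_right := fun η g =>
        mod_conj (nerveMap_comp J _ g) (nerveMap_comp J _ g) _ _ fun a x =>
          (heq_whisker_assoc _ _ _).symm }

end Representable

section Sheaves

variable {C : Type u} [Bicategory.{u, u} C] [Strict C]

/-- The representable 2-presheaf `C(-, c)`. -/
abbrev yo (c : C) : StrictPseudofunctor Cᵒᵖ Cat.{u, u} :=
  rep (StrictPseudofunctor.id C) c

/-- A sieve on an object `c` of a 2-category: a 2-natural transformation into the representable
2-presheaf of `c` whose components are injective on objects and faithful. -/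
structure TwoSieve (c : C) where
  dom : StrictPseudofunctor Cᵒᵖ Cat.{u, u}
  ι : dom ⟶ yo c
  injective_obj (b : Cᵒᵖ) : Function.Injective (ι.app b).toFunctor.obj
  faithful (b : Cᵒᵖ) : (ι.app b).toFunctor.Faithful

/-- The 2-cells generated, under vertical composition, by those of the form `β ▷ f`, that is by
those that factor through `f`. -/
inductive FactorsThrough {b d c : C} (f : d ⟶ c) : ∀ {g h : b ⟶ c}, (g ⟶ h) → Prop
  | whisker {k l : b ⟶ d} (β : k ⟶ l) : FactorsThrough f (β ▷ f)
  | comp {g h i : b ⟶ c} {α : g ⟶ h} {β : h ⟶ i} :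
      FactorsThrough f α → FactorsThrough f β → FactorsThrough f (α ≫ β)

/-- A sieve is generated by the single arrow `f : d ⟶ c` if its objects are the arrows that factor
through `f`, and its morphisms are the 2-cells between them that factor through `f`, together with
their vertical composites. -/
structure TwoSieve.IsGeneratedBy {c d : C} (S : TwoSieve c) (f : d ⟶ c) : Prop where
  obj_iff (b : C) (g : b ⟶ c) :
    (∃ s : S.dom.obj (op b), (S.ι.app (op b)).toFunctor.obj s = g) ↔ ∃ k : b ⟶ d, k ≫ f = g
  map_iff (b : C) (s t : S.dom.obj (op b))
    (α : (show b ⟶ c from (S.ι.app (op b)).toFunctor.obj s) ⟶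
      (show b ⟶ c from (S.ι.app (op b)).toFunctor.obj t)) :
    (∃ φ : s ⟶ t, (S.ι.app (op b)).toFunctor.map φ = α) ↔ FactorsThrough f α

variable (C) in
/-- The atomic topology: the covering sieves are those generated by a single arrow. -/
def atomicTopology : ∀ c : C, Set (TwoSieve c) :=
  fun c => {S | ∃ (d : C) (f : d ⟶ c), S.IsGeneratedBy f}

/-- A 2-presheaf `F` is a 2-sheaf for a family `J` of covering sieves if, for each covering sieve
`ι : S ⟶ C(-, c)`, the functor `[Cᵒᵖ, Cat](C(-, c), F) ⥤ [Cᵒᵖ, Cat](S, F)` given by composition with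
`ι` is an isomorphism of categories. -/
def IsTwoSheaf (J : ∀ c : C, Set (TwoSieve c)) (F : StrictPseudofunctor Cᵒᵖ Cat.{u, u}) : Prop :=
  ∀ (c : C), ∀ S ∈ J c, ∃ K : (S.dom ⟶ F) ⥤ (yo c ⟶ F),
    precomp F S.ι ⋙ K = 𝟭 (yo c ⟶ F) ∧ K ⋙ precomp F S.ι = 𝟭 (S.dom ⟶ F)

/-- The 2-category of 2-sheaves: the full sub-2-category of 2-presheaves on the 2-sheaves, with
all 2-natural transformations and modifications. -/
abbrev Sh (J : ∀ c : C, Set (TwoSieve c)) :=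
  InducedBicategory (StrictPseudofunctor Cᵒᵖ Cat.{u, u})
    (Subtype.val : {F : StrictPseudofunctor Cᵒᵖ Cat.{u, u} // IsTwoSheaf J F} → _)

/-- The inclusion of 2-sheaves into 2-presheaves. -/
abbrev Sh.incl (J : ∀ c : C, Set (TwoSieve c)) :
    StrictPseudofunctor (Sh J) (StrictPseudofunctor Cᵒᵖ Cat.{u, u}) :=
  InducedBicategory.forget

theorem induced_conj {D : Type u₂} [Bicategory.{w₂, v₂} D] {I : Type u₁} {F : I → D}
    {X Y : InducedBicategory D F} {f g f' g' : X ⟶ Y} (hf : f = f') (hg : g = g')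
    (η : f ⟶ g) (θ : f' ⟶ g') (h : HEq η.hom θ.hom) :
    η = eqToHom hf ≫ θ ≫ eqToHom hg.symm := by
  subst hf; subst hg
  simp only [eqToHom_refl, Category.id_comp, Category.comp_id]
  exact InducedBicategory.hom₂_ext (eq_of_heq h)

/-- A 2-functor into 2-presheaves that takes values in 2-sheaves, as a 2-functor into 2-sheaves. -/
def Sh.lift {D : Type u₂} [Bicategory.{w₂, v₂} D] [Strict D] (J : ∀ c : C, Set (TwoSieve c))
    (Φ : StrictPseudofunctor D (StrictPseudofunctor Cᵒᵖ Cat.{u, u}))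
    (h : ∀ X, IsTwoSheaf J (Φ.obj X)) : StrictPseudofunctor D (Sh J) :=
  StrictPseudofunctor.mk''
    { obj := fun X => ⟨Φ.obj X, h X⟩
      map := fun f => InducedBicategory.mkHom (Φ.map f)
      map₂ := fun η => InducedBicategory.mkHom₂ (Φ.map₂ η)
      map₂_id := fun f => InducedBicategory.hom₂_ext (Φ.map₂_id f)
      map₂_comp := fun η θ => InducedBicategory.hom₂_ext (Φ.map₂_comp η θ)
      map_id := fun X => InducedBicategory.hom_ext (Φ.map_id X)
      map_comp := fun f g => InducedBicategory.hom_ext (Φ.map_comp f g)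
      map₂_whisker_left := fun f g h η => by
        apply induced_conj
        · exact InducedBicategory.hom_ext (Φ.map_comp f h)
        · exact heq_map₂_whiskerLeft Φ f η
      map₂_whisker_right := fun {_ _ _ _ f'} η g => by
        apply induced_conj
        · exact InducedBicategory.hom_ext (Φ.map_comp f' g)
        · exact heq_map₂_whiskerRight Φ η g }

end Sheaves

/-! ### Topological 2-groups -/

/-- A (strict) topological 2-group: a category object in topological groups. It consists of
topological groups of objects and of arrows, with source, target, identity and composition maps
that are continuous homomorphisms and satisfy the category axioms. The composite `comp (g, h)` of
`g` followed by `h` is defined on the subgroup of composable pairs. -/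
structure TopTwoGroup where
  G₀ : Type u
  G₁ : Type u
  [group₀ : Group G₀]
  [topology₀ : TopologicalSpace G₀]
  [topGroup₀ : IsTopologicalGroup G₀]
  [group₁ : Group G₁]
  [topology₁ : TopologicalSpace G₁]
  [topGroup₁ : IsTopologicalGroup G₁]
  dom : G₁ →ₜ* G₀
  cod : G₁ →ₜ* G₀
  one : G₀ →ₜ* G₁
  comp : ((cod.toMonoidHom.comp (MonoidHom.fst G₁ G₁)).eqLocus
    (dom.toMonoidHom.comp (MonoidHom.snd G₁ G₁))) →ₜ* G₁
  dom_one (a : G₀) : dom (one a) = a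
  cod_one (a : G₀) : cod (one a) = a
  dom_comp (g h : G₁) (w : cod g = dom h) : dom (comp ⟨(g, h), w⟩) = dom g
  cod_comp (g h : G₁) (w : cod g = dom h) : cod (comp ⟨(g, h), w⟩) = cod h
  one_comp (g : G₁) : comp ⟨(one (dom g), g), cod_one _⟩ = g
  comp_one (g : G₁) : comp ⟨(g, one (cod g)), (dom_one _).symm⟩ = g
  comp_assoc (g h k : G₁) (w : cod g = dom h) (w' : cod h = dom k) :
    comp ⟨(comp ⟨(g, h), w⟩, k), (cod_comp g h w).trans w'⟩ =
      comp ⟨(g, comp ⟨(h, k), w'⟩), w.trans (dom_comp h k w').symm⟩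

namespace TopTwoGroup

attribute [instance] group₀ topology₀ topGroup₀ group₁ topology₁ topGroup₁

variable (G : TopTwoGroup.{u})

/-- The composite of composable arrows, `g` followed by `h`. -/
def comp' (g h : G.G₁) (w : G.cod g = G.dom h) : G.G₁ :=
  G.comp ⟨(g, h), w⟩

theorem comp'_mul (g h g' h' : G.G₁) (w : G.cod g = G.dom h) (w' : G.cod g' = G.dom h')
    (w'' : G.cod (g * g') = G.dom (h * h')) :
    G.comp' (g * g') (h * h') w'' = G.comp' g h w * G.comp' g' h' w' :=
  map_mul G.comp ⟨(g, h), w⟩ ⟨(g', h'), w'⟩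

theorem dom_comp' (g h : G.G₁) (w : G.cod g = G.dom h) : G.dom (G.comp' g h w) = G.dom g :=
  G.dom_comp g h w

theorem cod_comp' (g h : G.G₁) (w : G.cod g = G.dom h) : G.cod (G.comp' g h w) = G.cod h :=
  G.cod_comp g h w

theorem comp'_congr {g h g' h' : G.G₁} (w : G.cod g = G.dom h) (hg : g = g') (hh : h = h') :
    G.comp' g h w = G.comp' g' h' (by rw [← hg, ← hh, w]) := by
  subst hg; subst hh; rfl

theorem one_comp' (g : G.G₁) (a : G.G₀) (w : G.cod (G.one a) = G.dom g) :
    G.comp' (G.one a) g w = g := by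
  obtain rfl : a = G.dom g := by rw [← w, G.cod_one]
  exact G.one_comp g

theorem comp'_one (g : G.G₁) (a : G.G₀) (w : G.cod g = G.dom (G.one a)) :
    G.comp' g (G.one a) w = g := by
  obtain rfl : a = G.cod g := by rw [w, G.dom_one]
  exact G.comp_one g

/-- The underlying category of a 2-group. -/
instance category : Category G.G₀ where
  Hom a b := {g : G.G₁ // G.dom g = a ∧ G.cod g = b}
  id a := ⟨G.one a, G.dom_one a, G.cod_one a⟩
  comp g h := ⟨G.comp' g.1 h.1 (g.2.2.trans h.2.1.symm),
    (G.dom_comp' _ _ _).trans g.2.1, (G.cod_comp' _ _ _).trans h.2.2⟩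
  id_comp g := Subtype.ext (G.one_comp' _ _ _)
  comp_id g := Subtype.ext (G.comp'_one _ _ _)
  assoc g h k := Subtype.ext (G.comp_assoc g.1 h.1 k.1 _ _)

variable {G}

/-- An element of `G₁`, as an arrow of the underlying category. -/
def toHom (g : G.G₁) : G.dom g ⟶ G.cod g := ⟨g, rfl, rfl⟩

theorem hom_heq {a b a' b' : G.G₀} {f : a ⟶ b} {f' : a' ⟶ b'} (ha : a = a') (hb : b = b')
    (h : f.1 = f'.1) : HEq f f' := by
  subst ha; subst hb; exact heq_of_eq (Subtype.ext h)

variable (G)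

/-- The tensor functor, given by the group laws on objects and arrows. -/
@[simps]
def tensor : G.G₀ × G.G₀ ⥤ G.G₀ where
  obj p := p.1 * p.2
  map f := ⟨f.1.1 * f.2.1, by rw [map_mul, f.1.2.1, f.2.2.1], by rw [map_mul, f.1.2.2, f.2.2.2]⟩
  map_id p := Subtype.ext (map_mul G.one p.1 p.2).symm
  map_comp f g := Subtype.ext (G.comp'_mul _ _ _ _ _ _ _).symm

end TopTwoGroup

/-! ### Continuous actions -/

open scoped CategoryTheory.Prod

/-- A continuous right action of a topological 2-group on a discrete 2-space, that is, on a small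
category whose sets of objects and of arrows carry the discrete topology. -/
structure TwoAction (G : TopTwoGroup.{u}) where
  carrier : Type u
  [cat : SmallCategory carrier]
  act : carrier × G.G₀ ⥤ carrier
  act_one : CategoryTheory.Prod.sectL carrier (1 : G.G₀) ⋙ act = 𝟭 carrier
  act_mul : act.prod (𝟭 G.G₀) ⋙ act =
    prod.associator carrier G.G₀ G.G₀ ⋙ (𝟭 carrier).prod G.tensor ⋙ act
  continuous_obj :
    letI : TopologicalSpace carrier := ⊥
    Continuous fun p : carrier × G.G₀ => act.obj p
  continuous_map :
    letI : TopologicalSpace (Arrow carrier) := ⊥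
    Continuous fun p : Arrow carrier × G.G₁ =>
      Arrow.mk (act.map (p.1.hom ×ₘ TopTwoGroup.toHom p.2))

attribute [instance] TwoAction.cat

namespace TwoAction

variable {G : TopTwoGroup.{u}}

/-- An equivariant functor. -/
@[ext]
structure EquivFunctor (X Y : TwoAction G) where
  functor : X.carrier ⥤ Y.carrier
  equivariant : X.act ⋙ functor = functor.prod (𝟭 G.G₀) ⋙ Y.act

/-- A 2-cell between equivariant functors: a natural transformation `θ` that satisfies
`θ_{x · A} = θ_x · 1_A`. -/
@[ext]
structure EquivNatTrans {X Y : TwoAction G} (H K : EquivFunctor X Y) where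
  natTrans : H.functor ⟶ K.functor
  compat (x : X.carrier) (A : G.G₀) :
    HEq (natTrans.app (X.act.obj (x, A))) (Y.act.map (natTrans.app x ×ₘ 𝟙 A))

theorem EquivFunctor.obj_eq {X Y : TwoAction G} (H : EquivFunctor X Y) (x : X.carrier)
    (A : G.G₀) : H.functor.obj (X.act.obj (x, A)) = Y.act.obj (H.functor.obj x, A) :=
  Functor.congr_obj H.equivariant (x, A)

theorem EquivFunctor.map_heq {X Y : TwoAction G} (H : EquivFunctor X Y) {x y : X.carrier}
    {A B : G.G₀} (f : x ⟶ y) (g : A ⟶ B) :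
    HEq (H.functor.map (X.act.map (f ×ₘ g))) (Y.act.map (H.functor.map f ×ₘ g)) :=
  Functor.hcongr_hom H.equivariant (f ×ₘ g)

theorem heq_comp {D : Type u} [SmallCategory D] {a b c a' b' c' : D} {f : a ⟶ b} {g : b ⟶ c}
    {f' : a' ⟶ b'} {g' : b' ⟶ c'} (ha : a = a') (hb : b = b') (hc : c = c') (hf : HEq f f')
    (hg : HEq g g') : HEq (f ≫ g) (f' ≫ g') := by
  subst ha; subst hb; subst hc; rw [eq_of_heq hf, eq_of_heq hg]

theorem functor_map_heq {D E : Type u} [SmallCategory D] [SmallCategory E] (F : D ⥤ E)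
    {a b a' b' : D} {f : a ⟶ b} {f' : a' ⟶ b'} (ha : a = a') (hb : b = b') (hf : HEq f f') :
    HEq (F.map f) (F.map f') := by
  subst ha; subst hb; rw [eq_of_heq hf]

instance : CategoryStruct (TwoAction G) where
  Hom X Y := EquivFunctor X Y
  id X := ⟨𝟭 _, rfl⟩
  comp {X Y Z} H K := ⟨H.functor ⋙ K.functor, by
    rw [← Functor.assoc, H.equivariant, Functor.assoc, K.equivariant]; rfl⟩

instance homCat (X Y : TwoAction G) : Category (X ⟶ Y) where
  Hom H K := EquivNatTrans H K
  id H := ⟨𝟙 H.functor, fun x A => by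
    have h : (𝟙 (H.functor.obj x) ×ₘ 𝟙 A) = 𝟙 (H.functor.obj x, A) := rfl
    rw [NatTrans.id_app, NatTrans.id_app, h, Y.act.map_id, H.obj_eq]⟩
  comp {H K L} θ κ := ⟨θ.natTrans ≫ κ.natTrans, fun x A => by
    have h : ((θ.natTrans ≫ κ.natTrans).app x ×ₘ 𝟙 A) =
        (θ.natTrans.app x ×ₘ 𝟙 A) ≫ (κ.natTrans.app x ×ₘ 𝟙 A) :=
      CategoryTheory.Prod.hom_ext rfl (Category.id_comp _).symm
    rw [h, Y.act.map_comp, NatTrans.comp_app]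
    exact heq_comp (H.obj_eq x A) (K.obj_eq x A) (L.obj_eq x A) (θ.compat x A) (κ.compat x A)⟩
  id_comp θ := EquivNatTrans.ext (Category.id_comp _)
  comp_id θ := EquivNatTrans.ext (Category.comp_id _)
  assoc θ κ ι := EquivNatTrans.ext (Category.assoc _ _ _)

section

variable {X Y Z : TwoAction G}

/-- Whiskering on the left in the 2-category of actions. -/
def whiskerL (H : X ⟶ Y) {K L : Y ⟶ Z} (θ : K ⟶ L) : H ≫ K ⟶ H ≫ L :=
  EquivNatTrans.mk (H := H ≫ K) (K := H ≫ L) (Functor.whiskerLeft H.functor θ.natTrans)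
    fun x A => by
      have h : HEq (θ.natTrans.app (H.functor.obj (X.act.obj (x, A))))
          (θ.natTrans.app (Y.act.obj (H.functor.obj x, A))) := by rw [H.obj_eq]
      exact h.trans (θ.compat (H.functor.obj x) A)

/-- Whiskering on the right in the 2-category of actions. -/
def whiskerR {H K : X ⟶ Y} (θ : H ⟶ K) (L : Y ⟶ Z) : H ≫ L ⟶ K ≫ L :=
  EquivNatTrans.mk (H := H ≫ L) (K := K ≫ L) (Functor.whiskerRight θ.natTrans L.functor)
    fun x A =>
      (functor_map_heq L.functor (EquivFunctor.obj_eq H x A) (EquivFunctor.obj_eq K x A)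
        (θ.compat x A)).trans (EquivFunctor.map_heq L (θ.natTrans.app x) (𝟙 A))

theorem hom₂_ext {H K : X ⟶ Y} {θ κ : H ⟶ K}
    (h : ∀ x, θ.natTrans.app x = κ.natTrans.app x) : θ = κ :=
  EquivNatTrans.ext (NatTrans.ext (funext h))

end

theorem conj_id {D : Type u} [SmallCategory D] {a b : D} (f : a ⟶ b) : f = 𝟙 a ≫ f ≫ 𝟙 b := by
  simp

/-- The 2-category of continuous actions, equivariant functors and compatible 2-cells. -/
instance : Bicategory (TwoAction G) where
  homCategory X Y := inferInstance
  whiskerLeft H _ _ θ := whiskerL H θ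
  whiskerRight θ L := whiskerR θ L
  associator H K L := Iso.refl (H ≫ K ≫ L)
  leftUnitor H := Iso.refl H
  rightUnitor H := Iso.refl H
  whiskerLeft_id _ _ := rfl
  whiskerLeft_comp _ _ _ _ _ _ := rfl
  id_whiskerLeft _ := hom₂_ext fun _ => conj_id _
  comp_whiskerLeft _ _ _ _ _ := hom₂_ext fun _ => conj_id _
  id_whiskerRight _ K := hom₂_ext fun _ => K.functor.map_id _
  comp_whiskerRight _ _ K := hom₂_ext fun _ => K.functor.map_comp _ _
  whiskerRight_id _ := hom₂_ext fun _ => conj_id _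
  whiskerRight_comp _ _ _ := hom₂_ext fun _ => conj_id _
  whisker_assoc _ _ _ _ _ := hom₂_ext fun _ => conj_id _
  whisker_exchange _ θ := hom₂_ext fun _ => (θ.natTrans.naturality _).symm
  pentagon _ _ _ K := hom₂_ext fun _ => by
    exact (congrArg (fun t => t ≫ 𝟙 _ ≫ 𝟙 _) (K.functor.map_id _)).trans (conj_id _).symm |>.trans
      (Category.id_comp _).symm
  triangle _ K := hom₂_ext fun _ => by
    exact (Category.id_comp _).trans (K.functor.map_id _).symm

instance : Strict (TwoAction G) where
  id_comp _ := rfl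
  comp_id _ := rfl
  assoc _ _ _ := rfl
  leftUnitor_eqToIso _ := rfl
  rightUnitor_eqToIso _ := rfl
  associator_eqToIso _ _ _ := rfl

end TwoAction

/-! ### Open sub-2-groups and the orbit 2-category -/

/-- An open sub-2-group: open subgroups of objects and of arrows that form a subcategory. -/
structure OpenSub (G : TopTwoGroup.{u}) where
  U₀ : Subgroup G.G₀
  U₁ : Subgroup G.G₁
  isOpen₀ : IsOpen (U₀ : Set G.G₀)
  isOpen₁ : IsOpen (U₁ : Set G.G₁)
  dom_mem {g : G.G₁} : g ∈ U₁ → G.dom g ∈ U₀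
  cod_mem {g : G.G₁} : g ∈ U₁ → G.cod g ∈ U₀
  one_mem {a : G.G₀} : a ∈ U₀ → G.one a ∈ U₁
  comp_mem {g h : G.G₁} (w : G.cod g = G.dom h) : g ∈ U₁ → h ∈ U₁ → G.comp' g h w ∈ U₁

namespace OpenSub

variable {G : TopTwoGroup.{u}} (U V W : OpenSub G)

/-- The objects of the coset category `G/U`: the cosets `U₀ A`. -/
def Coset : Type u := Quotient (QuotientGroup.rightRel U.U₀)

/-- The arrows of the coset category `G/U`: the cosets `U₁ g`. -/
def CosetArr : Type u := Quotient (QuotientGroup.rightRel U.U₁)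

variable {U V W}

/-- The coset `U₀ A`. -/
def Coset.mk (U : OpenSub G) (A : G.G₀) : U.Coset := Quotient.mk _ A

/-- The coset `U₁ g`. -/
def CosetArr.mk (U : OpenSub G) (g : G.G₁) : U.CosetArr := Quotient.mk _ g

theorem Coset.mk_eq {A B : G.G₀} : Coset.mk U A = Coset.mk U B ↔ B * A⁻¹ ∈ U.U₀ :=
  Quotient.eq.trans QuotientGroup.rightRel_apply

theorem CosetArr.mk_eq {g h : G.G₁} : CosetArr.mk U g = CosetArr.mk U h ↔ h * g⁻¹ ∈ U.U₁ :=
  Quotient.eq.trans QuotientGroup.rightRel_apply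

theorem Coset.exists_rep (a : U.Coset) : ∃ A, Coset.mk U A = a := Quotient.exists_rep a

theorem CosetArr.exists_rep (p : U.CosetArr) : ∃ g, CosetArr.mk U g = p := Quotient.exists_rep p

/-- The source of a coset of arrows. -/
def CosetArr.dom : U.CosetArr → U.Coset :=
  Quotient.lift (fun g => Coset.mk U (G.dom g)) fun g h w => Coset.mk_eq.2 <| by
    rw [← map_inv, ← map_mul]
    exact U.dom_mem (QuotientGroup.rightRel_apply.1 w)

/-- The target of a coset of arrows. -/
def CosetArr.cod : U.CosetArr → U.Coset :=
  Quotient.lift (fun g => Coset.mk U (G.cod g)) fun g h w => Coset.mk_eq.2 <| by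
    rw [← map_inv, ← map_mul]
    exact U.cod_mem (QuotientGroup.rightRel_apply.1 w)

/-- The coset of an identity arrow. -/
def Coset.one : U.Coset → U.CosetArr :=
  Quotient.lift (fun A => CosetArr.mk U (G.one A)) fun A B w => CosetArr.mk_eq.2 <| by
    rw [← map_inv, ← map_mul]
    exact U.one_mem (QuotientGroup.rightRel_apply.1 w)

theorem CosetArr.exists_comp_right (g : G.G₁) (q : U.CosetArr)
    (w : (CosetArr.mk U g).cod = q.dom) :
    ∃ h : G.G₁, G.cod g = G.dom h ∧ CosetArr.mk U h = q := by
  obtain ⟨h, rfl⟩ := q.exists_rep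
  have w' : G.dom h * (G.cod g)⁻¹ ∈ U.U₀ := Coset.mk_eq.1 w
  refine ⟨G.one (G.cod g * (G.dom h)⁻¹) * h, ?_, CosetArr.mk_eq.2 ?_⟩
  · rw [map_mul, G.dom_one]; group
  · have := U.one_mem (U.U₀.inv_mem w')
    rw [mul_inv_rev, ← mul_assoc, mul_inv_cancel, one_mul]
    apply U.U₁.inv_mem
    simpa using this

theorem CosetArr.exists_comp (p q : U.CosetArr) (w : p.cod = q.dom) :
    ∃ (g h : G.G₁) (_ : G.cod g = G.dom h), CosetArr.mk U g = p ∧ CosetArr.mk U h = q := by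
  obtain ⟨g, rfl⟩ := p.exists_rep
  obtain ⟨h, w', rfl⟩ := CosetArr.exists_comp_right g q w
  exact ⟨g, h, w', rfl, rfl⟩

theorem CosetArr.mk_comp'_eq {g h g' h' : G.G₁} (w : G.cod g = G.dom h)
    (w' : G.cod g' = G.dom h') (hg : CosetArr.mk U g' = CosetArr.mk U g)
    (hh : CosetArr.mk U h' = CosetArr.mk U h) :
    CosetArr.mk U (G.comp' g' h' w') = CosetArr.mk U (G.comp' g h w) := by
  rw [CosetArr.mk_eq] at hg hh ⊢
  have w₂ : G.cod (g * g'⁻¹) = G.dom (h * h'⁻¹) := by simp [w, w']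
  have : G.comp' g h w = G.comp' (g * g'⁻¹) (h * h'⁻¹) w₂ * G.comp' g' h' w' := by
    rw [← G.comp'_mul _ _ _ _ _ _ (by simpa using w)]
    exact G.comp'_congr _ (by simp) (by simp)
  rw [this, mul_inv_cancel_right]
  exact U.comp_mem _ hg hh

/-- The composite of two cosets of arrows: the coset of the composite of arbitrary composable
representatives. -/
noncomputable def CosetArr.comp (p q : U.CosetArr) (w : p.cod = q.dom) : U.CosetArr :=
  CosetArr.mk U (G.comp' _ _ (CosetArr.exists_comp p q w).choose_spec.choose_spec.choose)

theorem CosetArr.cod_eq_dom {p q : U.CosetArr} {g h : G.G₁}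
    (w : G.cod g = G.dom h) (hg : CosetArr.mk U g = p) (hh : CosetArr.mk U h = q) :
    p.cod = q.dom := by
  subst hg; subst hh; exact congrArg (Coset.mk U) w

theorem CosetArr.comp_eq {p q r : U.CosetArr} {g h : G.G₁}
    (w : G.cod g = G.dom h) (hg : CosetArr.mk U g = p) (hh : CosetArr.mk U h = q)
    (hr : CosetArr.mk U (G.comp' g h w) = r) :
    CosetArr.comp p q (cod_eq_dom w hg hh) = r :=
  have key := (CosetArr.exists_comp p q (cod_eq_dom w hg hh)).choose_spec.choose_spec.choose_spec
  (CosetArr.mk_comp'_eq _ _ (key.1.trans hg.symm) (key.2.trans hh.symm)).trans hr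

/-- The coset category `G/U`. -/
noncomputable instance (U : OpenSub G) : SmallCategory U.Coset where
  Hom a b := {p : U.CosetArr // p.dom = a ∧ p.cod = b}
  id a := ⟨a.one, by
    obtain ⟨A, rfl⟩ := a.exists_rep
    exact ⟨congrArg (Coset.mk U) (G.dom_one A), congrArg (Coset.mk U) (G.cod_one A)⟩⟩
  comp {a b c} p q := ⟨CosetArr.comp p.1 q.1 (p.2.2.trans q.2.1.symm), by
    obtain ⟨p, rfl, hp⟩ := p
    obtain ⟨q, hq, rfl⟩ := q
    obtain ⟨g, h, w, rfl, rfl⟩ := CosetArr.exists_comp p q (hp.trans hq.symm)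
    rw [CosetArr.comp_eq w rfl rfl rfl]
    exact ⟨congrArg (Coset.mk U) (G.dom_comp' g h w), congrArg (Coset.mk U) (G.cod_comp' g h w)⟩⟩
  id_comp {a b} p := by
    obtain ⟨p, rfl, hp⟩ := p
    obtain ⟨g, rfl⟩ := p.exists_rep
    refine Subtype.ext ?_
    refine CosetArr.comp_eq (G.cod_one (G.dom g)) rfl rfl ?_
    exact congrArg _ (G.one_comp' _ _ _)
  comp_id {a b} p := by
    obtain ⟨p, hp, rfl⟩ := p
    obtain ⟨g, rfl⟩ := p.exists_rep
    refine Subtype.ext ?_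
    refine CosetArr.comp_eq (G.dom_one (G.cod g)).symm rfl rfl ?_
    exact congrArg _ (G.comp'_one _ _ _)
  assoc {a b c d} p q r := by
    obtain ⟨p, rfl, hp⟩ := p
    obtain ⟨q, hq, hq'⟩ := q
    obtain ⟨r, hr, rfl⟩ := r
    obtain ⟨g, h, w, rfl, rfl⟩ := CosetArr.exists_comp p q (hp.trans hq.symm)
    obtain ⟨k, w', rfl⟩ := CosetArr.exists_comp_right h r (hq'.trans hr.symm)
    refine Subtype.ext ?_
    refine CosetArr.comp_eq ((G.cod_comp' g h w).trans w')
      (CosetArr.comp_eq w rfl rfl rfl).symm rfl ?_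
    refine Eq.symm <| CosetArr.comp_eq (w.trans (G.dom_comp' h k w').symm) rfl
      (CosetArr.comp_eq w' rfl rfl rfl).symm ?_
    exact congrArg _ (G.comp_assoc g h k w w').symm

theorem hom_heq {a b a' b' : U.Coset} {f : a ⟶ b} {f' : a' ⟶ b'} (ha : a = a') (hb : b = b')
    (h : f.1 = f'.1) : HEq f f' := by
  subst ha; subst hb; exact heq_of_eq (Subtype.ext h)

/-- Right multiplication of cosets of objects. -/
def Coset.mul (a : U.Coset) (A : G.G₀) : U.Coset :=
  Quotient.map (· * A) (fun B C w => by
    rw [← Quotient.eq_iff_equiv, Quotient.eq, QuotientGroup.rightRel_apply] at *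
    simpa using w) a

/-- Right multiplication of cosets of arrows. -/
def CosetArr.mul (p : U.CosetArr) (g : G.G₁) : U.CosetArr :=
  Quotient.map (· * g) (fun B C w => by
    rw [← Quotient.eq_iff_equiv, Quotient.eq, QuotientGroup.rightRel_apply] at *
    simpa using w) p

theorem CosetArr.dom_mul (p : U.CosetArr) (g : G.G₁) : (p.mul g).dom = p.dom.mul (G.dom g) := by
  obtain ⟨h, rfl⟩ := p.exists_rep
  exact congrArg (Coset.mk U) (map_mul G.dom h g)

theorem CosetArr.cod_mul (p : U.CosetArr) (g : G.G₁) : (p.mul g).cod = p.cod.mul (G.cod g) := by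
  obtain ⟨h, rfl⟩ := p.exists_rep
  exact congrArg (Coset.mk U) (map_mul G.cod h g)

variable (U) in
/-- The action of `G` on `G/U` by right multiplication on representatives. -/
noncomputable def act : U.Coset × G.G₀ ⥤ U.Coset where
  obj p := p.1.mul p.2
  map {p q} f := ⟨f.1.1.mul f.2.1,
    by rw [CosetArr.dom_mul, f.1.2.1, f.2.2.1], by rw [CosetArr.cod_mul, f.1.2.2, f.2.2.2]⟩
  map_id p := by
    obtain ⟨a, B⟩ := p
    obtain ⟨A, rfl⟩ := a.exists_rep
    exact Subtype.ext (congrArg (CosetArr.mk U) (map_mul G.one A B).symm)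
  map_comp {a b c} f f' := by
    obtain ⟨⟨p, hp, hp'⟩, g⟩ := f
    obtain ⟨⟨q, hq, hq'⟩, g'⟩ := f'
    obtain ⟨h, k, w, rfl, rfl⟩ := CosetArr.exists_comp p q (hp'.trans hq.symm)
    refine Subtype.ext ?_
    refine Eq.symm <| CosetArr.comp_eq (g := h * g.1) (h := k * g'.1)
      (by rw [map_mul, map_mul, w, g.2.2, g'.2.1]) rfl rfl ?_
    refine Eq.trans ?_ (congrArg (fun x => CosetArr.mul x _) (CosetArr.comp_eq w rfl rfl rfl).symm)
    exact congrArg (CosetArr.mk U) (G.comp'_mul _ _ _ _ _ _ _)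

theorem act_map_val {a b : U.Coset × G.G₀} (f : a ⟶ b) : (U.act.map f).1 = f.1.1.mul f.2.1 := rfl

theorem continuous_mk {Γ : Type u} [Group Γ] [TopologicalSpace Γ] [IsTopologicalGroup Γ]
    (s : Subgroup Γ) (hs : IsOpen (s : Set Γ)) {Y : Type u} (f : Γ → Y)
    (h : ∀ x, ∀ u ∈ s, f (u * x) = f x) :
    @Continuous Γ Y _ ⊥ f := by
  let _ : TopologicalSpace Y := ⊥
  have : DiscreteTopology Y := ⟨rfl⟩
  refine continuous_def.2 fun t _ => isOpen_iff_mem_nhds.2 fun x hx => ?_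
  have h₁ : (fun y => y * x) '' (s : Set Γ) ∈ nhds x :=
    ((Homeomorph.mulRight x).isOpenMap _ hs).mem_nhds ⟨1, s.one_mem, one_mul x⟩
  refine Filter.mem_of_superset h₁ ?_
  rintro _ ⟨u, hu, rfl⟩
  change f (u * x) ∈ t
  rw [h x u hu]; exact hx

theorem mk_heq {a b a' b' : U.Coset} {f : a ⟶ b} {f' : a' ⟶ b'} (ha : a = a') (hb : b = b')
    (h : f.1 = f'.1) : Arrow.mk f = Arrow.mk f' := by
  subst ha; subst hb; exact congrArg Arrow.mk (Subtype.ext h)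

variable (U) in
/-- The coset category `G/U` with its action by right multiplication. -/
noncomputable def coset : TwoAction G where
  carrier := U.Coset
  act := U.act
  act_one := by
    have h₀ (a : U.Coset) : a.mul 1 = a := by
      obtain ⟨A, rfl⟩ := a.exists_rep
      exact congrArg (Coset.mk U) (mul_one A)
    refine CategoryTheory.Functor.hext h₀ fun a b p => hom_heq (h₀ a) (h₀ b) ?_
    obtain ⟨p, _⟩ := p
    obtain ⟨g, rfl⟩ := p.exists_rep
    refine congrArg (CosetArr.mk U) ?_
    exact (congrArg (g * ·) (map_one G.one)).trans (mul_one g)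
  act_mul := by
    have h₀ (q : (U.Coset × G.G₀) × G.G₀) : (q.1.1.mul q.1.2).mul q.2 = q.1.1.mul (q.1.2 * q.2) := by
      obtain ⟨⟨a, B⟩, C⟩ := q
      obtain ⟨A, rfl⟩ := a.exists_rep
      exact congrArg (Coset.mk U) (mul_assoc A B C)
    refine CategoryTheory.Functor.hext h₀ fun a b p => hom_heq (h₀ a) (h₀ b) ?_
    obtain ⟨⟨⟨p, _⟩, g⟩, h⟩ := p
    obtain ⟨k, rfl⟩ := p.exists_rep
    exact congrArg (CosetArr.mk U) (mul_assoc k g.1 h.1)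
  continuous_obj := by
    let _ : TopologicalSpace U.Coset := ⊥
    have : DiscreteTopology U.Coset := ⟨rfl⟩
    refine continuous_prod_of_discrete_left.2 fun a => ?_
    obtain ⟨X, rfl⟩ := a.exists_rep
    refine (continuous_mk U.U₀ U.isOpen₀ (Coset.mk U) fun x u hu => ?_).comp
      (continuous_const_mul X)
    rw [Coset.mk_eq]
    simpa using hu
  continuous_map := by
    let _ : TopologicalSpace (Arrow U.Coset) := ⊥
    have : DiscreteTopology (Arrow U.Coset) := ⟨rfl⟩
    refine continuous_prod_of_discrete_left.2 fun a => ?_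
    obtain ⟨a, b, p'⟩ := a
    change a ⟶ b at p'
    obtain ⟨p, rfl, rfl⟩ := p'
    obtain ⟨k, rfl⟩ := p.exists_rep
    let m : G.G₁ → Arrow U.Coset := fun g =>
      Arrow.mk (X := (CosetArr.mk U g).dom) (Y := (CosetArr.mk U g).cod) ⟨CosetArr.mk U g, rfl, rfl⟩
    have hm : @Continuous _ _ _ ⊥ m := continuous_mk U.U₁ U.isOpen₁ m fun x u hu => by
      have h : CosetArr.mk U (u * x) = CosetArr.mk U x := by
        rw [CosetArr.mk_eq]; simpa using hu
      exact mk_heq (congrArg CosetArr.dom h) (congrArg CosetArr.cod h) h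
    refine (hm.comp (continuous_const_mul k)).congr fun g => ?_
    exact mk_heq (CosetArr.dom_mul (CosetArr.mk U k) g) (CosetArr.cod_mul (CosetArr.mk U k) g) rfl

end OpenSub

/-! ### The orbit 2-category -/

open OpenSub

section Induces

variable {G : TopTwoGroup.{u}} {U V W : OpenSub G}

/-- The coset of arrows underlying an arrow of `G/V`. -/
def arr {a b : (coset V).carrier} (p : a ⟶ b) : V.CosetArr :=
  Subtype.val (p := fun q : V.CosetArr => q.dom = a ∧ q.cod = b) p

theorem arr_id {a : (coset V).carrier} {A : G.G₀} (h : a = Coset.mk V A) :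
    arr (𝟙 a) = CosetArr.mk V (G.one A) := by
  subst h; rfl

theorem arr_comp {a b c : (coset V).carrier} {p : a ⟶ b} {q : b ⟶ c} {g h : G.G₁}
    (w : G.cod g = G.dom h) (hg : arr p = CosetArr.mk V g) (hh : arr q = CosetArr.mk V h) :
    arr (p ≫ q) = CosetArr.mk V (G.comp' g h w) :=
  CosetArr.comp_eq w hg.symm hh.symm rfl

theorem arr_congr {a b a' b' : (coset V).carrier} {p : a ⟶ b} {p' : a' ⟶ b'} (ha : a = a')
    (hb : b = b') (h : HEq p p') : arr p = arr p' := by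
  subst ha; subst hb; rw [eq_of_heq h]

/-- The equivariant functor `G/U ⥤ G/V` is the one induced by the object `A`: this requires
`U ⊆ A⁻¹ V A`, and the functor is `U₀ X ↦ V₀ (A X)` on objects and `U₁ g ↦ V₁ (1_A g)` on
arrows. -/
structure Induces (A : G.G₀) (F : coset U ⟶ coset V) : Prop where
  mem₀ : ∀ X ∈ U.U₀, A * X * A⁻¹ ∈ V.U₀
  mem₁ : ∀ g ∈ U.U₁, G.one A * g * (G.one A)⁻¹ ∈ V.U₁
  obj (X : G.G₀) : F.functor.obj (Coset.mk U X) = Coset.mk V (A * X)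
  map {a b : (coset U).carrier} (p : a ⟶ b) (g : G.G₁) (hg : arr p = CosetArr.mk U g) :
    arr (F.functor.map p) = CosetArr.mk V (G.one A * g)

/-- The transformation `θ` between functors `G/U ⥤ G/V` is the one induced by the arrow
`g : A ⟶ B`: the functors are induced by `A` and `B`, the condition `g 1_X g⁻¹ ∈ V₁` holds for
`X ∈ U₀`, and the component of `θ` at `U₀ X` is `V₁ (g 1_X)`. -/
structure Induces₂ (g : G.G₁) {F H : coset U ⟶ coset V} (θ : F ⟶ H) : Prop where
  dom : Induces (G.dom g) F
  cod : Induces (G.cod g) H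
  mem : ∀ X ∈ U.U₀, g * G.one X * g⁻¹ ∈ V.U₁
  app (X : G.G₀) : arr (θ.natTrans.app (Coset.mk U X)) = CosetArr.mk V (g * G.one X)

theorem Induces.id (U : OpenSub G) : Induces 1 (𝟙 (coset U)) where
  mem₀ X h := by simpa using h
  mem₁ g h := by simpa using h
  obj X := congrArg (Coset.mk U) (one_mul X).symm
  map p g hg := hg.trans (congrArg (CosetArr.mk U) (by simp))

theorem Induces.comp {A B : G.G₀} {F : coset U ⟶ coset V} {H : coset V ⟶ coset W}
    (hF : Induces A F) (hH : Induces B H) : Induces (B * A) (F ≫ H) where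
  mem₀ X h := by simpa [mul_assoc] using hH.mem₀ _ (hF.mem₀ X h)
  mem₁ g h := by simpa [mul_assoc] using hH.mem₁ _ (hF.mem₁ g h)
  obj X := ((congrArg H.functor.obj (hF.obj X)).trans (hH.obj _)).trans
    (congrArg (Coset.mk W) (mul_assoc B A X).symm)
  map p g hg := (hH.map _ _ (hF.map p g hg)).trans
    (congrArg (CosetArr.mk W) (by simp [mul_assoc]))

theorem mk_mul_left {u : G.G₀} (hu : u ∈ V.U₀) (X : G.G₀) :
    Coset.mk V (u * X) = Coset.mk V X :=
  Coset.mk_eq.2 (by simpa using hu)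

theorem mk_mul_left₁ {u : G.G₁} (hu : u ∈ V.U₁) (X : G.G₁) :
    CosetArr.mk V (u * X) = CosetArr.mk V X :=
  CosetArr.mk_eq.2 (by simpa using hu)

theorem Induces.mul_left {A u : G.G₀} (hu : u ∈ V.U₀) {F : coset U ⟶ coset V}
    (hF : Induces A F) : Induces (u * A) F where
  mem₀ X h := by
    have := V.U₀.mul_mem (V.U₀.mul_mem hu (hF.mem₀ X h)) (V.U₀.inv_mem hu)
    simpa [mul_assoc] using this
  mem₁ g h := by
    have := V.U₁.mul_mem (V.U₁.mul_mem (V.one_mem hu) (hF.mem₁ g h))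
      (V.U₁.inv_mem (V.one_mem hu))
    simpa [mul_assoc] using this
  obj X := (hF.obj X).trans (by rw [mul_assoc, mk_mul_left hu])
  map p g hg := (hF.map p g hg).trans (by rw [map_mul, mul_assoc, mk_mul_left₁ (V.one_mem hu)])

theorem Induces₂.mk_of_app {g : G.G₁} {F H : coset U ⟶ coset V} {θ : F ⟶ H}
    (dom : Induces (G.dom g) F) (cod : Induces (G.cod g) H)
    (app : ∀ X, arr (θ.natTrans.app (Coset.mk U X)) = CosetArr.mk V (g * G.one X)) :
    Induces₂ g θ where
  dom := dom
  cod := cod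
  app := app
  mem X hX := by
    have h := mk_mul_left hX (1 : G.G₀)
    have h' : arr (θ.natTrans.app (Coset.mk U (X * 1))) =
      arr (θ.natTrans.app (Coset.mk U 1)) := by rw [h]
    rw [app, app, CosetArr.mk_eq] at h'
    have := V.U₁.inv_mem h'
    simpa [mul_assoc] using this

theorem Induces₂.id {A : G.G₀} {F : coset U ⟶ coset V} (hF : Induces A F) :
    Induces₂ (G.one A) (𝟙 F) :=
  .mk_of_app (by rwa [G.dom_one]) (by rwa [G.cod_one]) fun X =>
    (arr_id (hF.obj X)).trans (by rw [map_mul])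

theorem Induces₂.comp {g h : G.G₁} {F H K : coset U ⟶ coset V} {θ : F ⟶ H} {κ : H ⟶ K}
    (hθ : Induces₂ g θ) (hκ : Induces₂ h κ) : ∃ k, Induces₂ k (θ ≫ κ) := by
  have hu : G.cod g * (G.dom h)⁻¹ ∈ V.U₀ := by
    have := (hκ.dom.obj 1).symm.trans (hθ.cod.obj 1)
    have := Coset.mk_eq.1 this
    simpa using this
  have hu₁ := V.one_mem hu
  have w : G.cod g = G.dom (G.one (G.cod g * (G.dom h)⁻¹) * h) := by
    rw [map_mul, G.dom_one]; group
  refine ⟨G.comp' g _ w, .mk_of_app ?_ ?_ fun X => ?_⟩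
  · rw [G.dom_comp']; exact hθ.dom
  · rw [G.cod_comp', map_mul, G.cod_one]; exact hκ.cod.mul_left hu
  · have w' : G.cod (g * G.one X) = G.dom (G.one (G.cod g * (G.dom h)⁻¹) * h * G.one X) := by
      rw [map_mul, map_mul, ← w, G.cod_one, G.dom_one]
    refine (arr_comp w' (hθ.app X) ((hκ.app X).trans ?_)).trans ?_
    · rw [mul_assoc, mk_mul_left₁ hu₁]
    · rw [G.comp'_mul g _ (G.one X) (G.one X) w (by rw [G.cod_one, G.dom_one]), G.comp'_one]

theorem Induces₂.whiskerLeft {A : G.G₀} {g : G.G₁} {F : coset U ⟶ coset V}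
    {H K : coset V ⟶ coset W} {θ : H ⟶ K} (hF : Induces A F) (hθ : Induces₂ g θ) :
    Induces₂ (g * G.one A) (F ◁ θ) := by
  refine .mk_of_app ?_ ?_ fun X => ?_
  · rw [map_mul, G.dom_one]; exact hF.comp hθ.dom
  · rw [map_mul, G.cod_one]; exact hF.comp hθ.cod
  · have h : arr (θ.natTrans.app (F.functor.obj (Coset.mk U X))) =
        arr (θ.natTrans.app (Coset.mk V (A * X))) := by rw [hF.obj]
    exact (h.trans (hθ.app _)).trans (by rw [map_mul, mul_assoc])

theorem Induces₂.whiskerRight {A : G.G₀} {g : G.G₁} {F H : coset U ⟶ coset V} {θ : F ⟶ H}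
    {K : coset V ⟶ coset W} (hθ : Induces₂ g θ) (hK : Induces A K) :
    Induces₂ (G.one A * g) (θ ▷ K) := by
  refine .mk_of_app ?_ ?_ fun X => ?_
  · rw [map_mul, G.dom_one]; exact hθ.dom.comp hK
  · rw [map_mul, G.cod_one]; exact hθ.cod.comp hK
  · exact (hK.map _ _ (hθ.app X)).trans (by rw [mul_assoc])

end Induces

/-- The orbit 2-category of `G`. Its objects are the coset categories `G/U` over the open
sub-2-groups `U` of `G`. -/
structure Orbit (G : TopTwoGroup.{u}) where
  sub : OpenSub G

namespace Orbit

variable {G : TopTwoGroup.{u}}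

/-- The morphisms `G/U ⟶ G/V`: the functors induced by objects of `G`. -/
@[ext]
structure Hom (U V : Orbit G) where
  functor : coset U.sub ⟶ coset V.sub
  induced : ∃ A, Induces A functor

/-- The 2-cells: the transformations induced by arrows of `G`. -/
@[ext]
structure Hom₂ {U V : Orbit G} (F H : Hom U V) where
  trans : F.functor ⟶ H.functor
  induced : ∃ g, Induces₂ g trans

noncomputable instance : CategoryStruct (Orbit G) where
  Hom U V := Hom U V
  id U := ⟨𝟙 _, 1, .id _⟩
  comp F H := ⟨F.functor ≫ H.functor, by
    obtain ⟨A, hA⟩ := F.induced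
    obtain ⟨B, hB⟩ := H.induced
    exact ⟨_, hA.comp hB⟩⟩

noncomputable instance homCat (U V : Orbit G) : Category (U ⟶ V) where
  Hom F H := Hom₂ F H
  id F := ⟨𝟙 F.functor, by
    obtain ⟨A, hA⟩ := F.induced
    exact ⟨_, .id hA⟩⟩
  comp θ κ := ⟨θ.trans ≫ κ.trans, by
    obtain ⟨g, hg⟩ := θ.induced
    obtain ⟨h, hh⟩ := κ.induced
    exact hg.comp hh⟩
  id_comp _ := Hom₂.ext (Category.id_comp _)
  comp_id _ := Hom₂.ext (Category.comp_id _)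
  assoc _ _ _ := Hom₂.ext (Category.assoc _ _ _)

section

variable {U V W : Orbit G}

/-- Whiskering on the left in the orbit 2-category. -/
noncomputable def whiskerL (F : U ⟶ V) {H K : V ⟶ W} (θ : H ⟶ K) : F ≫ H ⟶ F ≫ K :=
  Hom₂.mk (F := F ≫ H) (H := F ≫ K) (F.functor ◁ θ.trans) (by
    obtain ⟨A, hA⟩ := F.induced
    obtain ⟨g, hg⟩ := θ.induced
    exact ⟨_, .whiskerLeft hA hg⟩)

/-- Whiskering on the right in the orbit 2-category. -/
noncomputable def whiskerR {F H : U ⟶ V} (θ : F ⟶ H) (K : V ⟶ W) : F ≫ K ⟶ H ≫ K :=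
  Hom₂.mk (F := F ≫ K) (H := H ≫ K) (θ.trans ▷ K.functor) (by
    obtain ⟨A, hA⟩ := K.induced
    obtain ⟨g, hg⟩ := θ.induced
    exact ⟨_, .whiskerRight hg hA⟩)

end

noncomputable instance : Bicategory (Orbit G) where
  homCategory U V := inferInstance
  whiskerLeft F _ _ θ := whiskerL F θ
  whiskerRight θ K := whiskerR θ K
  associator F H K := Iso.refl (F ≫ H ≫ K)
  leftUnitor F := Iso.refl F
  rightUnitor F := Iso.refl F
  whiskerLeft_id _ _ := rfl
  whiskerLeft_comp _ _ _ _ _ _ := rfl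
  id_whiskerLeft θ := Hom₂.ext (id_whiskerLeft θ.trans)
  comp_whiskerLeft F H _ _ θ := Hom₂.ext (comp_whiskerLeft F.functor H.functor θ.trans)
  id_whiskerRight F H := Hom₂.ext (id_whiskerRight F.functor H.functor)
  comp_whiskerRight θ κ F := Hom₂.ext (comp_whiskerRight θ.trans κ.trans F.functor)
  whiskerRight_id θ := Hom₂.ext (whiskerRight_id θ.trans)
  whiskerRight_comp θ F H := Hom₂.ext (whiskerRight_comp θ.trans F.functor H.functor)
  whisker_assoc F _ _ θ H := Hom₂.ext (whisker_assoc F.functor θ.trans H.functor)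
  whisker_exchange θ κ := Hom₂.ext (whisker_exchange θ.trans κ.trans)
  pentagon F H K L := Hom₂.ext (pentagon F.functor H.functor K.functor L.functor)
  triangle F H := Hom₂.ext (triangle F.functor H.functor)

instance : Strict (Orbit G) where
  id_comp _ := rfl
  comp_id _ := rfl
  assoc _ _ _ := rfl
  leftUnitor_eqToIso _ := rfl
  rightUnitor_eqToIso _ := rfl
  associator_eqToIso _ _ _ := rfl

theorem conj_eqToHom {D : Type u} [SmallCategory D] {a b : D} (f : a ⟶ b) :
    f = eqToHom rfl ≫ f ≫ eqToHom rfl := by simp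

variable (G) in
/-- The inclusion of the orbit 2-category into the 2-category of continuous actions. -/
noncomputable def incl : StrictPseudofunctor (Orbit G) (TwoAction G) :=
  StrictPseudofunctor.mk''
    { obj := fun U => coset U.sub
      map := fun F => F.functor
      map₂ := fun θ => θ.trans
      map₂_id := fun _ => rfl
      map₂_comp := fun _ _ => rfl
      map_id := fun _ => rfl
      map_comp := fun _ _ => rfl
      map₂_whisker_left := fun _ _ _ _ => conj_eqToHom _
      map₂_whisker_right := fun _ _ => conj_eqToHom _ }

end Orbit

open Bicategory.Opposite

/-- The 2-functor `Φ` from continuous actions to 2-presheaves on the orbit 2-category, sending `X`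
to the 2-presheaf of equivariant functors `G/U ⥤ X`. -/
noncomputable def Φ (G : TopTwoGroup.{u}) :
    StrictPseudofunctor (TwoAction G) (StrictPseudofunctor (Orbit G)ᵒᵖ Cat.{u, u}) :=
  nerve (Orbit.incl G)

/-- A presentation of a 2-functor `Ψ` from 2-presheaves on the orbit 2-category to continuous
actions as the filtered colimit `Ψ F = colim F (G/U)` over the open sub-2-groups `U` ordered by
inclusion. The inclusion of `V` in `U` corresponds to the functor `G/V ⥤ G/U` induced by `1`. -/
structure ColimitPresentation {G : TopTwoGroup.{u}}
    (Ψ : StrictPseudofunctor (StrictPseudofunctor (Orbit G)ᵒᵖ Cat.{u, u}) (TwoAction G)) where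
  /-- the colimit cocone; we write `[U, X]` for the image of `X` -/
  ι (F : StrictPseudofunctor (Orbit G)ᵒᵖ Cat.{u, u}) (U : Orbit G) :
    F.obj (op U) ⥤ (Ψ.obj F).carrier
  /-- compatibility of the cocone with restriction along inclusions -/
  restrict (F : StrictPseudofunctor (Orbit G)ᵒᵖ Cat.{u, u}) {V U : Orbit G} (a : V ⟶ U)
    (ha : Induces 1 a.functor) : (F.map a.op).toFunctor ⋙ ι F V = ι F U
  /-- every object is of the form `[U, X]` -/
  exists_obj (F : StrictPseudofunctor (Orbit G)ᵒᵖ Cat.{u, u}) (x : (Ψ.obj F).carrier) :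
    ∃ (U : Orbit G) (X : F.obj (op U)), (ι F U).obj X = x
  /-- every arrow is of the form `[U, m]` -/
  exists_map (F : StrictPseudofunctor (Orbit G)ᵒᵖ Cat.{u, u}) {x y : (Ψ.obj F).carrier}
    (f : x ⟶ y) :
    ∃ (U : Orbit G) (X Y : F.obj (op U)) (m : X ⟶ Y), Arrow.mk ((ι F U).map m) = Arrow.mk f
  /-- `[U, X] = [V, Y]` iff `X` and `Y` have the same restriction to some `W ⊆ U ∩ V` -/
  obj_eq_iff (F : StrictPseudofunctor (Orbit G)ᵒᵖ Cat.{u, u}) {U V : Orbit G}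
    (X : F.obj (op U)) (Y : F.obj (op V)) :
    (ι F U).obj X = (ι F V).obj Y ↔
      ∃ (W : Orbit G) (a : W ⟶ U) (b : W ⟶ V), Induces 1 a.functor ∧ Induces 1 b.functor ∧
        (F.map a.op).toFunctor.obj X = (F.map b.op).toFunctor.obj Y
  /-- `[U, m] = [V, n]` iff `m` and `n` have the same restriction to some `W ⊆ U ∩ V` -/
  map_eq_iff (F : StrictPseudofunctor (Orbit G)ᵒᵖ Cat.{u, u}) {U V : Orbit G}
    {X X' : F.obj (op U)} (m : X ⟶ X') {Y Y' : F.obj (op V)} (n : Y ⟶ Y') :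
    Arrow.mk ((ι F U).map m) = Arrow.mk ((ι F V).map n) ↔
      ∃ (W : Orbit G) (a : W ⟶ U) (b : W ⟶ V), Induces 1 a.functor ∧ Induces 1 b.functor ∧
        Arrow.mk ((F.map a.op).toFunctor.map m) = Arrow.mk ((F.map b.op).toFunctor.map n)
  /-- the action on objects: `[U, X] · A = [O, F(A)(X)]` for `A : G/O ⟶ G/U` -/
  act_obj (F : StrictPseudofunctor (Orbit G)ᵒᵖ Cat.{u, u}) {O U : Orbit G} (a : O ⟶ U)
    (A : G.G₀) (ha : Induces A a.functor) (X : F.obj (op U)) :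
    (Ψ.obj F).act.obj ((ι F U).obj X, A) = (ι F O).obj ((F.map a.op).toFunctor.obj X)
  /-- the action on arrows: `[U, m] · g = [O, F(A)(m) ≫ F(g)_Y]` for `m : X ⟶ Y` in `F (G/U)` and
  a 2-cell `g : A ⟶ B` between morphisms `G/O ⟶ G/U` -/
  act_map (F : StrictPseudofunctor (Orbit G)ᵒᵖ Cat.{u, u}) {O U : Orbit G} {a b : O ⟶ U}
    (γ : a ⟶ b) (g : G.G₁) (hγ : Induces₂ g γ.trans) {X Y : F.obj (op U)} (m : X ⟶ Y) :
    Arrow.mk ((Ψ.obj F).act.map ((ι F U).map m ×ₘ TopTwoGroup.toHom g)) =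
      Arrow.mk ((ι F O).map ((F.map a.op).toFunctor.map m ≫
        (F.map₂ (op2 γ)).toNatTrans.app Y))
  /-- `Ψ θ` sends `[U, X]` to `[U, θ_U X]` and `[U, m]` to `[U, θ_U m]` -/
  map {F F' : StrictPseudofunctor (Orbit G)ᵒᵖ Cat.{u, u}} (θ : F ⟶ F') (U : Orbit G) :
    ι F U ⋙ (Ψ.map θ).functor = (θ.app (op U)).toFunctor ⋙ ι F' U
  /-- the component of `Ψ m` at `[U, X]` is `[U, m_{U, X}]` -/
  map₂ {F F' : StrictPseudofunctor (Orbit G)ᵒᵖ Cat.{u, u}} {θ κ : F ⟶ F'} (m : θ ⟶ κ)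
    (U : Orbit G) (X : F.obj (op U)) :
    Arrow.mk ((Ψ.map₂ m).natTrans.app ((ι F U).obj X)) =
      Arrow.mk ((ι F' U).map ((Modification.app m (op U)).toNatTrans.app X))

end TwoElmendorf

open TwoElmendorf

/-!
The 2-category of continuous actions is recovered from the orbits `G/U` because an action is the
union of its orbits: an equivariant functor `G/U ⥤ X` is the same as an object of `X` whose
identity arrow is fixed by `U₁` (`pointFunctor`, `coset_ext`), a 2-cell between two of them is the
same as an arrow of `X` fixed by `U₀` (`exists_coset_nat`, `coset_ext₂`), and continuity for the
discrete topology makes stabilizers open (`isOpen_arrowStab`), so that every object and every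
arrow of `X` arises from some `G/U`.

*`Φ X` is a 2-sheaf* (`isTwoSheaf_phi`). Let a sieve on `G/V` be generated by `f : G/U ⟶ G/V`,
induced by `A`. A 2-natural transformation from the sieve to `Φ X` is determined by its value `K :
G/U ⥤ X` at the generator, and it extends to `G/V` exactly if the value of `K` at the coset of
`A⁻¹`, which `f` sends to the base point of `G/V`, has an identity arrow fixed by `V₁`. It is: for
`v ∈ V₁` the arrow `A⁻¹ v A` of `G` induces, on a small enough `G/W`, a 2-cell of morphisms into
`G/U` that becomes an identity after composition with `f` (`exists_fixing_cell`), hence acts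
trivially on the generator (`isPoint_of_sieve`). Modifications are treated in the same way
(`fixed_of_sieve`).

*`Ψ`* is the filtered colimit, built by hand from germs. The action is well defined because every
arrow of `G` induces a 2-cell between morphisms `G/W ⟶ G/V` for small `W` (`Orbit.exists_cell`),
and it is continuous because `U` fixes the classes `[U, X]` and `[U, m]`.

*`1 ≅ Ψ Φ`.* Evaluation at base points defines `eps : Ψ Φ X ⟶ X`. It is injective because
equivariant functors and 2-cells out of `G/U` are determined at the base point, and surjective
because stabilizers are open (`isIso_eps`).

*`Φ Ψ ≅ 1`.* The map `eta : F ⟶ Φ Ψ F` sends `X` in `F (G/U)` to the equivariant functor with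
value `[U, X]` at the base point. If `F` is a 2-sheaf, then restriction along any morphism is an
embedding (`IsTwoSheaf.isEmb_res`), so `F (G/U)` embeds into the colimit and `eta` is an
embedding. An arrow of `(Φ Ψ F) (G/U)` has at the base point a component `[W, m]` with `W ⊆ U`, so
its restriction along `G/W ⟶ G/U` comes from `F`. As both sides are 2-sheaves for the sieve
generated by `G/W ⟶ G/U`, the arrow itself comes from `F` (`isIso_of_locally_surjective`).

Endpoints of arrows often agree only propositionally. Equations between such arrows are stated in
`Arrow D`, as `Arrow.mk f = Arrow.mk g`.
-/

namespace TwoElmendorf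

open Bicategory.Opposite

/-! ### Arrows up to equality of endpoints -/

section Arrows

variable {D : Type u₁} [Category.{v₁} D] {E : Type u₂} [Category.{v₂} E]

theorem arrow_comp {a b c a' b' c' : D} {f : a ⟶ b} {g : b ⟶ c} {f' : a' ⟶ b'} {g' : b' ⟶ c'}
    (hf : Arrow.mk f = Arrow.mk f') (hg : Arrow.mk g = Arrow.mk g') :
    Arrow.mk (f ≫ g) = Arrow.mk (f' ≫ g') := by
  cases hf; cases hg; rfl

theorem arrow_map (K : D ⥤ E) {a b a' b' : D} {f : a ⟶ b} {f' : a' ⟶ b'}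
    (h : Arrow.mk f = Arrow.mk f') : Arrow.mk (K.map f) = Arrow.mk (K.map f') := by
  cases h; rfl

theorem arrow_functor {K L : D ⥤ E} (h : K = L) {a b : D} (f : a ⟶ b) :
    Arrow.mk (K.map f) = Arrow.mk (L.map f) := by
  subst h; rfl

theorem arrow_app {K L : D ⥤ E} (α : K ⟶ L) {a b : D} (h : a = b) :
    Arrow.mk (α.app a) = Arrow.mk (α.app b) := by
  subst h; rfl

theorem arrow_id {a b : D} (h : a = b) : Arrow.mk (𝟙 a) = Arrow.mk (𝟙 b) := by
  subst h; rfl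

theorem arrow_of_heq {a b a' b' : D} {f : a ⟶ b} {f' : a' ⟶ b'} (ha : a = a') (hb : b = b')
    (h : HEq f f') : Arrow.mk f = Arrow.mk f' := by
  subst ha; subst hb; rw [eq_of_heq h]

theorem heq_of_arrow {a b a' b' : D} {f : a ⟶ b} {f' : a' ⟶ b'}
    (h : Arrow.mk f = Arrow.mk f') : HEq f f' := by
  cases h; rfl

theorem arrow_eq {a b : D} {f g : a ⟶ b} (h : Arrow.mk f = Arrow.mk g) : f = g :=
  (Arrow.mk_inj _ _).1 h

theorem arrow_left {a b a' b' : D} {f : a ⟶ b} {f' : a' ⟶ b'} (h : Arrow.mk f = Arrow.mk f') :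
    a = a' := congrArg (fun p => p.left) h

theorem arrow_right {a b a' b' : D} {f : a ⟶ b} {f' : a' ⟶ b'} (h : Arrow.mk f = Arrow.mk f') :
    b = b' := congrArg (fun p => p.right) h

theorem functor_ext_arrow {K L : D ⥤ E}
    (h : ∀ {a b : D} (f : a ⟶ b), Arrow.mk (K.map f) = Arrow.mk (L.map f)) : K = L :=
  Arrow.functor_ext fun _ _ f => h f

/-- An arrow with prescribed endpoints that underlies a given element of `Arrow D`. -/
def arrowHom (p : Arrow D) {a b : D} (ha : p.left = a) (hb : p.right = b) : a ⟶ b :=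
  eqToHom ha.symm ≫ p.hom ≫ eqToHom hb

@[simp] theorem mk_arrowHom (p : Arrow D) {a b : D} (ha : p.left = a) (hb : p.right = b) :
    Arrow.mk (arrowHom p ha hb) = p := by
  subst ha; subst hb; simp [arrowHom]

/-- The functor determined by its effect on objects and on arrows, where the latter takes values
in `Arrow E`, so that the endpoints need only agree propositionally. -/
def functorOfArrows (obj : D → E) (arr : ∀ {a b : D}, (a ⟶ b) → Arrow E)
    (left : ∀ {a b : D} (f : a ⟶ b), (arr f).left = obj a)
    (right : ∀ {a b : D} (f : a ⟶ b), (arr f).right = obj b)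
    (id : ∀ a : D, arr (𝟙 a) = Arrow.mk (𝟙 (obj a)))
    (comp : ∀ {a b c : D} (f : a ⟶ b) (g : b ⟶ c) {x y z : E} (p : x ⟶ y) (q : y ⟶ z),
      Arrow.mk p = arr f → Arrow.mk q = arr g → Arrow.mk (p ≫ q) = arr (f ≫ g)) : D ⥤ E where
  obj := obj
  map f := arrowHom (arr f) (left f) (right f)
  map_id a := arrow_eq (by rw [mk_arrowHom, id])
  map_comp f g := arrow_eq (by
    rw [mk_arrowHom]
    exact (comp f g _ _ (mk_arrowHom _ _ _) (mk_arrowHom _ _ _)).symm)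

theorem mk_functorOfArrows_map {obj : D → E} {arr : ∀ {a b : D}, (a ⟶ b) → Arrow E}
    {left right id comp} {a b : D} (f : a ⟶ b) :
    Arrow.mk ((functorOfArrows obj arr left right id comp).map f) = arr f :=
  mk_arrowHom (arr f) (left f) (right f)

/-- A functor is an embedding if it is injective on arrows, hence also on objects. -/
structure IsEmb (ι : D ⥤ E) : Prop where
  arrow {a b a' b' : D} (f : a ⟶ b) (f' : a' ⟶ b') :
    Arrow.mk (ι.map f) = Arrow.mk (ι.map f') → Arrow.mk f = Arrow.mk f'

/-- An arrow lies in the image of a functor. -/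
def InIm (ι : D ⥤ E) {x y : E} (p : x ⟶ y) : Prop :=
  ∃ (a b : D) (f : a ⟶ b), Arrow.mk (ι.map f) = Arrow.mk p

theorem IsEmb.obj {ι : D ⥤ E} (h : IsEmb ι) {a b : D} (w : ι.obj a = ι.obj b) : a = b :=
  arrow_left (h.arrow (𝟙 a) (𝟙 b) (by rw [ι.map_id, ι.map_id, arrow_id w]))

theorem IsEmb.of_injective_faithful {ι : D ⥤ E} (h : Function.Injective ι.obj)
    (h' : ι.Faithful) : IsEmb ι := by
  refine ⟨fun f f' w => ?_⟩
  obtain rfl := h (arrow_left w)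
  obtain rfl := h (arrow_right w)
  rw [ι.map_injective (arrow_eq w)]

theorem InIm.comp {ι : D ⥤ E} (h : IsEmb ι) {x y z : E} {p : x ⟶ y} {q : y ⟶ z}
    (hp : InIm ι p) (hq : InIm ι q) : InIm ι (p ≫ q) := by
  obtain ⟨a, b, f, hf⟩ := hp
  obtain ⟨b', c, g, hg⟩ := hq
  obtain rfl : b = b' := h.obj ((arrow_right hf).trans (arrow_left hg).symm)
  exact ⟨a, c, f ≫ g, by rw [ι.map_comp]; exact arrow_comp hf hg⟩

theorem IsEmb.cancel {S : Type*} [Category S] {ι : D ⥤ E} (h : IsEmb ι) {K L : S ⥤ D}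
    (w : K ⋙ ι = L ⋙ ι) : K = L :=
  functor_ext_arrow fun f => h.arrow _ _ (arrow_functor w f)

/-- A functor whose arrows lie in the image of an embedding factors through the embedding. -/
theorem IsEmb.exists_lift {S : Type*} [Category S] {ι : D ⥤ E} (h : IsEmb ι) (T : S ⥤ E)
    (w : ∀ {a b : S} (f : a ⟶ b), InIm ι (T.map f)) : ∃ L : S ⥤ D, L ⋙ ι = T := by
  have w' : ∀ {a b : S} (f : a ⟶ b), ∃ p : Arrow D, Arrow.mk (ι.map p.hom) = Arrow.mk (T.map f) :=
    fun f => by obtain ⟨a, b, g, hg⟩ := w f; exact ⟨Arrow.mk g, hg⟩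
  choose q hq using @w'
  have hl {a b : S} (f : a ⟶ b) : (q f).left = (q (𝟙 a)).left :=
    h.obj ((arrow_left (hq f)).trans (arrow_left (hq (𝟙 a))).symm)
  have hr {a b : S} (f : a ⟶ b) : (q f).right = (q (𝟙 b)).left :=
    h.obj ((arrow_right (hq f)).trans (arrow_left (hq (𝟙 b))).symm)
  refine ⟨functorOfArrows (fun a => (q (𝟙 a)).left) (fun f => q f) hl hr ?_ ?_, ?_⟩
  · intro a
    refine h.arrow (q (𝟙 a)).hom (𝟙 (q (𝟙 a)).left) ?_
    rw [hq, T.map_id, ι.map_id, arrow_id (arrow_left (hq (𝟙 a)))]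
  · intro a b c f g x y z p p' hp hp'
    refine h.arrow (p ≫ p') (q (f ≫ g)).hom ?_
    rw [hq, ι.map_comp, T.map_comp]
    exact arrow_comp ((arrow_map ι hp).trans (hq f)) ((arrow_map ι hp').trans (hq g))
  · refine functor_ext_arrow fun {a b} f => (arrow_map ι ?_).trans (hq f)
    exact mk_functorOfArrows_map f

/-- An embedding that is surjective on arrows is an isomorphism of categories. -/
theorem IsEmb.exists_inverse {ι : D ⥤ E} (h : IsEmb ι)
    (w : ∀ {a b : E} (f : a ⟶ b), InIm ι f) : ∃ L : E ⥤ D, ι ⋙ L = 𝟭 D ∧ L ⋙ ι = 𝟭 E := by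
  obtain ⟨L, hL⟩ := h.exists_lift (𝟭 E) w
  refine ⟨L, h.cancel ?_, hL⟩
  rw [Functor.assoc, hL]; rfl

end Arrows

/-! ### 2-presheaves in terms of restriction functors -/

section Presheaves

variable {C : Type u₁} [Bicategory.{w₁, v₁} C] [Bicategory.Strict C]

section Res

variable (F : StrictPseudofunctor Cᵒᵖ Cat.{v₂, u₂})

/-- Restriction along `f : a ⟶ b` for a 2-presheaf. -/
def res {a b : C} (f : a ⟶ b) : F.obj (op b) ⥤ F.obj (op a) := (F.map f.op).toFunctor

/-- Restriction along a 2-cell for a 2-presheaf. -/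
def res₂ {a b : C} {f g : a ⟶ b} (α : f ⟶ g) : res F f ⟶ res F g :=
  (F.map₂ (op2 α)).toNatTrans

theorem res_id (a : C) : res F (𝟙 a) = 𝟭 _ :=
  congrArg Cat.Hom.toFunctor (F.map_id (op a))

theorem res_comp {a b c : C} (f : a ⟶ b) (g : b ⟶ c) : res F (f ≫ g) = res F g ⋙ res F f :=
  congrArg Cat.Hom.toFunctor (F.map_comp g.op f.op)

theorem res_comp_obj {a b c : C} (f : a ⟶ b) (g : b ⟶ c) (X : F.obj (op c)) :
    (res F (f ≫ g)).obj X = (res F f).obj ((res F g).obj X) := by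
  rw [res_comp]; rfl

theorem res_comp_map {a b c : C} (f : a ⟶ b) (g : b ⟶ c) {X Y : F.obj (op c)} (m : X ⟶ Y) :
    Arrow.mk ((res F (f ≫ g)).map m) = Arrow.mk ((res F f).map ((res F g).map m)) :=
  arrow_functor (res_comp F f g) m

theorem res_id_obj {a : C} (X : F.obj (op a)) : (res F (𝟙 a)).obj X = X := by
  rw [res_id]; rfl

theorem res_id_map {a : C} {X Y : F.obj (op a)} (m : X ⟶ Y) :
    Arrow.mk ((res F (𝟙 a)).map m) = Arrow.mk m :=
  arrow_functor (res_id F a) m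

@[simp] theorem res₂_id {a b : C} (f : a ⟶ b) : res₂ F (𝟙 f) = 𝟙 _ :=
  congrArg Cat.Hom₂.toNatTrans (F.map₂_id f.op)

@[simp] theorem res₂_comp {a b : C} {f g h : a ⟶ b} (α : f ⟶ g) (β : g ⟶ h) :
    res₂ F (α ≫ β) = res₂ F α ≫ res₂ F β :=
  congrArg Cat.Hom₂.toNatTrans (F.map₂_comp (op2 α) (op2 β))

theorem arrow_cat_app {A A' : Cat.{v₂, u₂}} {K L K' L' : A ⟶ A'} (hK : K = K') (hL : L = L')
    {α : K ⟶ L} {β : K' ⟶ L'} (h : HEq α β) (x : A) :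
    Arrow.mk (α.toNatTrans.app x) = Arrow.mk (β.toNatTrans.app x) := by
  subst hK; subst hL; rw [eq_of_heq h]

theorem arrow_cat_app_of_square {A A' : Cat.{v₂, u₂}} {K L K' L' : A ⟶ A'} {hK : K = K'}
    {hL : L = L'} {α : K ⟶ L} {β : K' ⟶ L'} (h : α ≫ eqToHom hL = eqToHom hK ≫ β) (x : A) :
    Arrow.mk (α.toNatTrans.app x) = Arrow.mk (β.toNatTrans.app x) := by
  subst hK; subst hL; simp at h; rw [h]

theorem res₂_whiskerLeft {a' a b : C} (h : a' ⟶ a) {f g : a ⟶ b} (α : f ⟶ g)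
    (X : F.obj (op b)) :
    Arrow.mk ((res₂ F (h ◁ α)).app X) = Arrow.mk ((res F h).map ((res₂ F α).app X)) :=
  arrow_cat_app (F.map_comp f.op h.op) (F.map_comp g.op h.op)
    (heq_map₂_whiskerRight F (op2 α) h.op) X

theorem res₂_whiskerRight {a b c : C} {f g : a ⟶ b} (α : f ⟶ g) (k : b ⟶ c)
    (X : F.obj (op c)) :
    Arrow.mk ((res₂ F (α ▷ k)).app X) = Arrow.mk ((res₂ F α).app ((res F k).obj X)) :=
  arrow_cat_app (F.map_comp k.op f.op) (F.map_comp k.op g.op)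
    (heq_map₂_whiskerLeft F k.op (op2 α)) X

end Res

section Nat

variable {F F' F'' : StrictPseudofunctor Cᵒᵖ Cat.{v₂, u₂}}

/-- The component of a 2-natural transformation between 2-presheaves, as a functor. -/
def comp₁ (θ : F ⟶ F') (a : C) : F.obj (op a) ⥤ F'.obj (op a) :=
  (θ.app (op a)).toFunctor

theorem comp₁_res (θ : F ⟶ F') {a b : C} (f : a ⟶ b) :
    res F f ⋙ comp₁ θ a = comp₁ θ b ⋙ res F' f :=
  congrArg Cat.Hom.toFunctor (θ.naturality f.op)

theorem comp₁_res_obj (θ : F ⟶ F') {a b : C} (f : a ⟶ b) (X : F.obj (op b)) :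
    (comp₁ θ a).obj ((res F f).obj X) = (res F' f).obj ((comp₁ θ b).obj X) :=
  Functor.congr_obj (comp₁_res θ f) X

theorem comp₁_res_map (θ : F ⟶ F') {a b : C} (f : a ⟶ b) {X Y : F.obj (op b)} (m : X ⟶ Y) :
    Arrow.mk ((comp₁ θ a).map ((res F f).map m)) =
      Arrow.mk ((res F' f).map ((comp₁ θ b).map m)) :=
  arrow_functor (comp₁_res θ f) m

theorem comp₁_res₂ (θ : F ⟶ F') {a b : C} {f g : a ⟶ b} (α : f ⟶ g) (X : F.obj (op b)) :
    Arrow.mk ((comp₁ θ a).map ((res₂ F α).app X)) =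
      Arrow.mk ((res₂ F' α).app ((comp₁ θ b).obj X)) :=
  arrow_cat_app_of_square (θ.naturality₂ (op2 α)) X

theorem nat_ext {θ κ : F ⟶ F'} (h : ∀ a, comp₁ θ a = comp₁ κ a) : θ = κ :=
  TwoNatTrans.ext (funext fun a => Cat.Hom.ext (h a.unop))

/-- A 2-natural transformation between 2-presheaves from its component functors. -/
def natOf (θ : ∀ a : C, F.obj (op a) ⥤ F'.obj (op a))
    (h : ∀ {a b : C} (f : a ⟶ b), res F f ⋙ θ a = θ b ⋙ res F' f)
    (h' : ∀ {a b : C} {f g : a ⟶ b} (α : f ⟶ g) (X : F.obj (op b)),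
      Arrow.mk ((θ a).map ((res₂ F α).app X)) = Arrow.mk ((res₂ F' α).app ((θ b).obj X))) :
    F ⟶ F' :=
  TwoNatTrans.mk (fun a => (θ a.unop).toCatHom) (fun f => Cat.Hom.ext (h f.unop))
    (fun α => cat_square _ _ _ _ fun x => heq_of_arrow (h' α.unop2 x))

/-- The component of a modification between 2-presheaves, as a natural transformation. -/
def comp₂ {θ κ : F ⟶ F'} (m : θ ⟶ κ) (a : C) : comp₁ θ a ⟶ comp₁ κ a :=
  (Modification.app m (op a)).toNatTrans

theorem comp₂_res {θ κ : F ⟶ F'} (m : θ ⟶ κ) {a b : C} (f : a ⟶ b) (X : F.obj (op b)) :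
    Arrow.mk ((comp₂ m a).app ((res F f).obj X)) =
      Arrow.mk ((res F' f).map ((comp₂ m b).app X)) :=
  arrow_cat_app_of_square (Modification.naturality m f.op) X

theorem modification_ext {θ κ : F ⟶ F'} {m n : θ ⟶ κ}
    (h : ∀ a X, (comp₂ m a).app X = (comp₂ n a).app X) : m = n :=
  mod_ext fun a => Cat.Hom₂.ext (NatTrans.ext (funext (h a.unop)))

/-- A modification between 2-natural transformations of 2-presheaves from its components. -/
def modOf {θ κ : F ⟶ F'} (m : ∀ a : C, comp₁ θ a ⟶ comp₁ κ a)
    (h : ∀ {a b : C} (f : a ⟶ b) (X : F.obj (op b)),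
      Arrow.mk ((m a).app ((res F f).obj X)) = Arrow.mk ((res F' f).map ((m b).app X))) :
    θ ⟶ κ :=
  Modification.mk (θ := θ) (γ := κ) (fun a => (m a.unop).toCatHom₂)
    (fun f => cat_square _ _ _ _ fun x => heq_of_arrow (h f.unop x))

end Nat

end Presheaves

/-! ### Inverses of 2-natural isomorphisms -/

section Inverse

variable {B : Type u₁} [Bicategory.{w₁, v₁} B] [Bicategory.Strict B]
  {C : Type u₂} [Bicategory.{w₂, v₂} C] [Bicategory.Strict C]
  {F G : StrictPseudofunctor B C}

theorem arrow_whisker_of_naturality (θ : TwoNatTrans F G) {a b : B} {f g : a ⟶ b} (α : f ⟶ g) :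
    Arrow.mk (F.map₂ α ▷ θ.app b) = Arrow.mk (θ.app a ◁ G.map₂ α) := by
  have h := congrArg Arrow.mk (θ.naturality₂ α)
  rwa [Arrow.arrow_mk_comp_eqToHom, Arrow.arrow_mk_eqToHom_comp] at h

theorem square_of_arrow {a b : C} {f g f' g' : a ⟶ b} {α : f ⟶ g} {β : f' ⟶ g'} (hf : f = f')
    (hg : g = g') (h : Arrow.mk α = Arrow.mk β) : α ≫ eqToHom hg = eqToHom hf ≫ β := by
  subst hf; subst hg; simpa using arrow_eq h

/-- The inverse of a 2-natural transformation with invertible components. -/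
noncomputable def TwoNatIso.inv (θ : TwoNatIso F G) : TwoNatTrans G F :=
  have (a : B) : IsIso (θ.hom.app a) := θ.isIso_app a
  have nat {a b : B} (f : a ⟶ b) :
      G.map f ≫ CategoryTheory.inv (θ.hom.app b) = CategoryTheory.inv (θ.hom.app a) ≫ F.map f := by
    rw [IsIso.comp_inv_eq]
    exact (by
      rw [Strict.assoc, θ.hom.naturality, ← Strict.assoc]
      exact ((congrArg (· ≫ G.map f) (IsIso.inv_hom_id (θ.hom.app a))).trans
        (Strict.id_comp _)).symm)
  { app := fun a => CategoryTheory.inv (θ.hom.app a)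
    naturality := nat
    naturality₂ := fun {a b f g} α => by
      refine square_of_arrow (nat f) (nat g) ?_
      -- Whisker `G.map₂ α` with `p' ≫ p = 𝟙` and move `p` past it by 2-naturality.
      have hb := IsIso.hom_inv_id (θ.hom.app b)
      have ha := IsIso.inv_hom_id (θ.hom.app a)
      set p := θ.hom.app a
      set q := θ.hom.app b
      set p' := CategoryTheory.inv p
      set q' := CategoryTheory.inv q
      have e₁ : Arrow.mk (G.map₂ α ▷ q') = Arrow.mk (((p' ≫ p) ◁ G.map₂ α) ▷ q') :=
        arrow_map (postcomp _ q') (by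
          rw [show p' ≫ p = 𝟙 _ from ha]
          exact (arrow_of_heq (Strict.id_comp _) (Strict.id_comp _)
            (heq_id_whiskerLeft _)).symm)
      have e₂ : Arrow.mk (((p' ≫ p) ◁ G.map₂ α) ▷ q') =
          Arrow.mk ((p' ◁ (p ◁ G.map₂ α)) ▷ q') :=
        arrow_map (postcomp _ q') (arrow_of_heq (Strict.assoc _ _ _) (Strict.assoc _ _ _)
            (heq_comp_whiskerLeft _ _ _))
      have e₃ : Arrow.mk ((p' ◁ (p ◁ G.map₂ α)) ▷ q') =
          Arrow.mk ((p' ◁ (F.map₂ α ▷ q)) ▷ q') :=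
        arrow_map (precomp _ p' ⋙ postcomp _ q')
          (arrow_whisker_of_naturality θ.hom α).symm
      have e₄ : Arrow.mk ((p' ◁ (F.map₂ α ▷ q)) ▷ q') =
          Arrow.mk (p' ◁ ((F.map₂ α ▷ q) ▷ q')) :=
        arrow_of_heq (Strict.assoc _ _ _) (Strict.assoc _ _ _) (heq_whisker_assoc _ _ _)
      have e₅ : Arrow.mk (p' ◁ ((F.map₂ α ▷ q) ▷ q')) =
          Arrow.mk (p' ◁ (F.map₂ α ▷ (q ≫ q'))) :=
        arrow_map (precomp _ p') (arrow_of_heq (Strict.assoc _ _ _).symm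
          (Strict.assoc _ _ _).symm (heq_whiskerRight_comp _ _ _)).symm
      have e₆ : Arrow.mk (p' ◁ (F.map₂ α ▷ (q ≫ q'))) = Arrow.mk (p' ◁ F.map₂ α) :=
        arrow_map (precomp _ p') (by
          rw [show q ≫ q' = 𝟙 _ from hb]
          exact arrow_of_heq (Strict.comp_id _) (Strict.comp_id _) (heq_whiskerRight_id _))
      exact e₁.trans <| e₂.trans <| e₃.trans <| e₄.trans <| e₅.trans e₆ }

/-- The inverse of a 2-natural isomorphism. -/
noncomputable def TwoNatIso.symm (θ : TwoNatIso F G) : TwoNatIso G F where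
  hom := θ.inv
  isIso_app a :=
    have := θ.isIso_app a
    inferInstanceAs (IsIso (CategoryTheory.inv (θ.hom.app a)))

theorem TwoNatIso.hom_inv (θ : TwoNatIso F G) : θ.hom.comp θ.inv = TwoNatTrans.id F :=
  TwoNatTrans.ext <| funext fun a =>
    have := θ.isIso_app a
    IsIso.hom_inv_id (θ.hom.app a)

theorem TwoNatIso.inv_hom (θ : TwoNatIso F G) : θ.inv.comp θ.hom = TwoNatTrans.id G :=
  TwoNatTrans.ext <| funext fun a =>
    have := θ.isIso_app a
    IsIso.inv_hom_id (θ.hom.app a)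

/-- A 2-natural transformation of 2-presheaves whose components are embeddings that are surjective
on arrows is an isomorphism. -/
theorem isIso_of_isEmb {F F' : StrictPseudofunctor Bᵒᵖ Cat.{v₂, u₂}} (θ : F ⟶ F')
    (h : ∀ a, IsEmb (comp₁ θ a)) (h' : ∀ a {x y : F'.obj (op a)} (f : x ⟶ y),
      InIm (comp₁ θ a) f) : IsIso θ := by
  have hi (a : Bᵒᵖ) : IsIso (θ.app a) := by
    obtain ⟨L, h₁, h₂⟩ := (h a.unop).exists_inverse (h' a.unop)
    exact ⟨L.toCatHom, Cat.Hom.ext h₁, Cat.Hom.ext h₂⟩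
  let e : TwoNatIso F F' := ⟨θ, hi⟩
  exact ⟨e.inv, e.hom_inv, e.inv_hom⟩

end Inverse

/-! ### Actions in terms of elements -/

open scoped CategoryTheory.Prod

section Action

variable {G : TopTwoGroup.{u}}

section

variable {X Y : TwoAction G}

/-- The object `x · A`. -/
def aobj (x : X.carrier) (A : G.G₀) : X.carrier := X.act.obj (x, A)

/-- The arrow `f · g`. -/
def amap {x y : X.carrier} (f : x ⟶ y) (g : G.G₁) : aobj x (G.dom g) ⟶ aobj y (G.cod g) :=
  X.act.map (f ×ₘ TopTwoGroup.toHom g)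

theorem act_map_eq {x y : X.carrier} (f : x ⟶ y) {A B : G.G₀} (φ : A ⟶ B) :
    Arrow.mk (X.act.map (f ×ₘ φ)) = Arrow.mk (amap f φ.1) := by
  obtain ⟨g, rfl, rfl⟩ := φ; rfl

theorem act_map_eq' {p q : X.carrier × G.G₀} (f : p ⟶ q) :
    Arrow.mk (X.act.map f) = Arrow.mk (amap f.1 f.2.1) :=
  act_map_eq f.1 f.2

theorem amap_congr {x y x' y' : X.carrier} {f : x ⟶ y} {f' : x' ⟶ y'} {g g' : G.G₁}
    (hf : Arrow.mk f = Arrow.mk f') (hg : g = g') :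
    Arrow.mk (amap f g) = Arrow.mk (amap f' g') := by
  cases hf; cases hg; rfl

theorem aobj_one (x : X.carrier) : aobj x (1 : G.G₀) = x := Functor.congr_obj X.act_one x

theorem aobj_mul (x : X.carrier) (A B : G.G₀) : aobj (aobj x A) B = aobj x (A * B) :=
  Functor.congr_obj X.act_mul ((x, A), B)

theorem amap_one {x y : X.carrier} (f : x ⟶ y) : Arrow.mk (amap f (1 : G.G₁)) = Arrow.mk f := by
  refine Eq.trans ?_ (arrow_functor X.act_one f)
  refine Eq.trans ?_ (act_map_eq f (𝟙 (1 : G.G₀))).symm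
  exact amap_congr rfl (map_one G.one).symm

theorem amap_mul {x y : X.carrier} (f : x ⟶ y) (g h : G.G₁) :
    Arrow.mk (amap (amap f g) h) = Arrow.mk (amap f (g * h)) :=
  (arrow_functor X.act_mul ((f ×ₘ TopTwoGroup.toHom g) ×ₘ TopTwoGroup.toHom h)).trans
    (act_map_eq' _)

theorem amap_id (x : X.carrier) (A : G.G₀) :
    Arrow.mk (amap (𝟙 x) (G.one A)) = Arrow.mk (𝟙 (aobj x A)) := by
  refine (act_map_eq (𝟙 x) (𝟙 A)).symm.trans ?_
  exact congrArg Arrow.mk (X.act.map_id (x, A))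

theorem amap_comp {x y z : X.carrier} (f : x ⟶ y) (f' : y ⟶ z) {g g' : G.G₁}
    (w : G.cod g = G.dom g') {a b c : X.carrier} (p : a ⟶ b) (q : b ⟶ c)
    (hp : Arrow.mk p = Arrow.mk (amap f g)) (hq : Arrow.mk q = Arrow.mk (amap f' g')) :
    Arrow.mk (p ≫ q) = Arrow.mk (amap (f ≫ f') (G.comp' g g' w)) := by
  let φ : G.dom g ⟶ G.cod g := TopTwoGroup.toHom g
  let ψ : G.cod g ⟶ G.cod g' := ⟨g', w.symm, rfl⟩
  have h : Arrow.mk (X.act.map (f ×ₘ φ) ≫ X.act.map (f' ×ₘ ψ)) =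
      Arrow.mk (amap (f ≫ f') (φ ≫ ψ).1) := by
    rw [← X.act.map_comp]
    exact act_map_eq' _
  exact (arrow_comp (hp.trans (act_map_eq f φ).symm) (hq.trans (act_map_eq f' ψ).symm)).trans h

theorem EquivFunctor_obj (H : X ⟶ Y) (x : X.carrier) (A : G.G₀) :
    H.functor.obj (aobj x A) = aobj (H.functor.obj x) A :=
  TwoAction.EquivFunctor.obj_eq H x A

theorem EquivFunctor_map (H : X ⟶ Y) {x y : X.carrier} (f : x ⟶ y) (g : G.G₁) :
    Arrow.mk (H.functor.map (amap f g)) = Arrow.mk (amap (H.functor.map f) g) :=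
  arrow_functor H.equivariant (f ×ₘ TopTwoGroup.toHom g)

theorem EquivNatTrans_app {H K : X ⟶ Y} (θ : H ⟶ K) (x : X.carrier) (A : G.G₀) :
    Arrow.mk (θ.natTrans.app (aobj x A)) = Arrow.mk (amap (θ.natTrans.app x) (G.one A)) :=
  (arrow_of_heq (EquivFunctor_obj H x A) (EquivFunctor_obj K x A) (θ.compat x A)).trans
    (act_map_eq _ _)

/-- An equivariant functor from a functor that preserves the products `f · g` of arrows. -/
def equivOf (H : X.carrier ⥤ Y.carrier)
    (h : ∀ {x y : X.carrier} (f : x ⟶ y) (g : G.G₁),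
      Arrow.mk (H.map (amap f g)) = Arrow.mk (amap (H.map f) g)) : X ⟶ Y :=
  TwoAction.EquivFunctor.mk H <| functor_ext_arrow fun f =>
    ((arrow_map H (act_map_eq' f)).trans (h f.1 f.2.1)).trans
      (act_map_eq' ((H.prod (𝟭 G.G₀)).map f)).symm

/-- A 2-cell between equivariant functors from a natural transformation. -/
def equivNatOf {H K : X ⟶ Y} (θ : H.functor ⟶ K.functor)
    (h : ∀ (x : X.carrier) (A : G.G₀),
      Arrow.mk (θ.app (aobj x A)) = Arrow.mk (amap (θ.app x) (G.one A))) : H ⟶ K :=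
  TwoAction.EquivNatTrans.mk (H := H) (K := K) θ fun x A =>
    heq_of_arrow ((h x A).trans (act_map_eq (θ.app x) (𝟙 A)).symm)

theorem equiv_ext {H K : X ⟶ Y} (h : H.functor = K.functor) : H = K :=
  TwoAction.EquivFunctor.ext h

/-- An equivariant functor that is an isomorphism of categories is an isomorphism. -/
theorem isIso_of_equiv (H : X ⟶ Y) (h : IsEmb H.functor)
    (h' : ∀ {x y : Y.carrier} (f : x ⟶ y), InIm H.functor f) : IsIso H := by
  obtain ⟨L, h₁, h₂⟩ := h.exists_inverse h'
  refine ⟨equivOf L fun {x y} f g => h.arrow _ _ ?_, equiv_ext h₁, equiv_ext h₂⟩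
  refine (arrow_functor h₂ (amap f g)).trans ?_
  refine Eq.trans ?_ (EquivFunctor_map H (L.map f) g).symm
  exact amap_congr (arrow_functor h₂ f).symm rfl

end

/-! ### Equivariant functors out of coset categories -/

section Points

variable {X Y : TwoAction G} {U V W : OpenSub G}

/-- The base point of a coset category: the coset of `1`. -/
def base (U : OpenSub G) : (OpenSub.coset U).carrier := OpenSub.Coset.mk U 1

/-- The coset `U₁ g`, as an arrow of the coset category. -/
def carr (U : OpenSub G) (g : G.G₁) : (show (OpenSub.coset U).carrier from
    OpenSub.Coset.mk U (G.dom g)) ⟶ (show (OpenSub.coset U).carrier from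
    OpenSub.Coset.mk U (G.cod g)) :=
  ⟨OpenSub.CosetArr.mk U g, rfl, rfl⟩

theorem arr_inj {a b a' b' : (OpenSub.coset U).carrier} {p : a ⟶ b} {q : a' ⟶ b'}
    (h : arr p = arr q) : Arrow.mk p = Arrow.mk q := by
  obtain ⟨p, rfl, rfl⟩ := p
  obtain ⟨q, rfl, rfl⟩ := q
  obtain rfl : p = q := h
  rfl

theorem arr_of_mk {a b a' b' : (OpenSub.coset U).carrier} {p : a ⟶ b} {q : a' ⟶ b'}
    (h : Arrow.mk p = Arrow.mk q) : arr p = arr q := by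
  cases h; rfl

theorem arr_eq_mk_iff {a b : (OpenSub.coset U).carrier} {p : a ⟶ b} {g : G.G₁} :
    arr p = OpenSub.CosetArr.mk U g ↔ Arrow.mk p = Arrow.mk (carr U g) :=
  ⟨fun h => arr_inj (q := carr U g) h, fun h => arr_of_mk h⟩

theorem exists_carr {a b : (OpenSub.coset U).carrier} (p : a ⟶ b) :
    ∃ g, Arrow.mk p = Arrow.mk (carr U g) := by
  obtain ⟨g, hg⟩ := (arr p).exists_rep
  exact ⟨g, arr_eq_mk_iff.1 hg.symm⟩

theorem arr_amap {a b : (OpenSub.coset U).carrier} {p : a ⟶ b} {g : G.G₁}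
    (h : arr p = OpenSub.CosetArr.mk U g) (k : G.G₁) :
    arr (amap p k) = OpenSub.CosetArr.mk U (g * k) :=
  congrArg (fun q => OpenSub.CosetArr.mul q k) h

theorem carr_eq (g : G.G₁) : Arrow.mk (carr U g) = Arrow.mk (amap (𝟙 (base U)) g) :=
  (arr_eq_mk_iff.1 ((arr_amap (arr_id rfl) g).trans (by rw [map_one, one_mul]))).symm

theorem mk_eq_aobj (A : G.G₀) : OpenSub.Coset.mk U A = aobj (base U) A :=
  (congrArg (OpenSub.Coset.mk U) (one_mul A)).symm

theorem functor_carr (H : OpenSub.coset U ⟶ X) (g : G.G₁) :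
    Arrow.mk (H.functor.map (carr U g)) = Arrow.mk (amap (𝟙 (H.functor.obj (base U))) g) := by
  refine ((arrow_map H.functor (carr_eq g)).trans (EquivFunctor_map H _ g)).trans ?_
  rw [H.functor.map_id]

/-- An equivariant functor out of a coset category is determined by its value at the base point. -/
theorem coset_ext {H K : OpenSub.coset U ⟶ X}
    (h : H.functor.obj (base U) = K.functor.obj (base U)) : H = K :=
  equiv_ext <| functor_ext_arrow fun p => by
    obtain ⟨g, hg⟩ := exists_carr p
    refine (arrow_map _ hg).trans (Eq.trans ?_ (arrow_map _ hg).symm)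
    rw [functor_carr, functor_carr]
    exact amap_congr (arrow_id h) rfl

theorem coset_ext_at {H K : OpenSub.coset U ⟶ X} (A : G.G₀)
    (h : H.functor.obj (OpenSub.Coset.mk U A) = K.functor.obj (OpenSub.Coset.mk U A)) : H = K := by
  refine coset_ext ?_
  have e : base U = aobj (show (OpenSub.coset U).carrier from OpenSub.Coset.mk U A) A⁻¹ :=
    congrArg (OpenSub.Coset.mk U) (mul_inv_cancel A).symm
  rw [e, EquivFunctor_obj, EquivFunctor_obj, h]

/-- A 2-cell between equivariant functors out of a coset category is determined by its component
at any one coset. -/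
theorem coset_ext₂ {H K H' K' : OpenSub.coset U ⟶ X} {θ : H ⟶ K} {κ : H' ⟶ K'} (A : G.G₀)
    (h : Arrow.mk (θ.natTrans.app (OpenSub.Coset.mk U A)) =
      Arrow.mk (κ.natTrans.app (OpenSub.Coset.mk U A))) : Arrow.mk θ = Arrow.mk κ := by
  obtain rfl : H = H' := coset_ext_at A (arrow_left h)
  obtain rfl : K = K' := coset_ext_at A (arrow_right h)
  refine congrArg Arrow.mk (TwoAction.hom₂_ext fun x => ?_)
  obtain ⟨B, rfl⟩ := OpenSub.Coset.exists_rep x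
  have e : OpenSub.Coset.mk U B =
      aobj (show (OpenSub.coset U).carrier from OpenSub.Coset.mk U A) (A⁻¹ * B) :=
    congrArg (OpenSub.Coset.mk U) (mul_inv_cancel_left A B).symm
  refine arrow_eq ((arrow_app θ.natTrans e).trans (Eq.trans ?_ (arrow_app κ.natTrans e).symm))
  rw [EquivNatTrans_app, EquivNatTrans_app]
  exact amap_congr h rfl

/-- The objects `x` whose identity arrow is fixed by `U₁`. They correspond to the equivariant
functors out of the coset category of `U`. -/
def IsPoint (U : OpenSub G) (x : X.carrier) : Prop :=
  ∀ g ∈ U.U₁, Arrow.mk (amap (𝟙 x) g) = Arrow.mk (𝟙 x)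

theorem IsPoint.aobj {x : X.carrier} (h : IsPoint U x) {A : G.G₀} (hA : A ∈ U.U₀) :
    aobj x A = x := by
  simpa using arrow_left ((amap_id x A).symm.trans (h _ (U.one_mem hA)))

theorem IsPoint.aobj_mul {x : X.carrier} (h : IsPoint U x) {A B : G.G₀} (w : B * A⁻¹ ∈ U.U₀) :
    TwoElmendorf.aobj x A = TwoElmendorf.aobj x B := by
  have e := TwoElmendorf.aobj_mul x (B * A⁻¹) A
  rwa [h.aobj w, inv_mul_cancel_right] at e

theorem IsPoint.amap_mul {x : X.carrier} (h : IsPoint U x) {g k : G.G₁} (w : k * g⁻¹ ∈ U.U₁) :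
    Arrow.mk (amap (𝟙 x) g) = Arrow.mk (amap (𝟙 x) k) := by
  have e := TwoElmendorf.amap_mul (𝟙 x) (k * g⁻¹) g
  rw [inv_mul_cancel_right] at e
  exact (amap_congr (h _ w).symm rfl).trans e

/-- The equivariant functor `G/U ⥤ X` with given value at the base point. -/
noncomputable def pointFunctor {x : X.carrier} (h : IsPoint U x) : OpenSub.coset U ⟶ X :=
  let obj : U.Coset → X.carrier := Quotient.lift (fun A => aobj x A) fun _ _ w =>
    h.aobj_mul (QuotientGroup.rightRel_apply.1 w)
  let arr : U.CosetArr → Arrow X.carrier := Quotient.lift (fun g => Arrow.mk (amap (𝟙 x) g))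
    fun _ _ w => h.amap_mul (QuotientGroup.rightRel_apply.1 w)
  let F := functorOfArrows (D := (OpenSub.coset U).carrier) obj (fun p => arr (TwoElmendorf.arr p))
    (fun {a b} p => by
      obtain ⟨p, rfl, rfl⟩ := p
      obtain ⟨g, rfl⟩ := p.exists_rep
      rfl)
    (fun {a b} p => by
      obtain ⟨p, rfl, rfl⟩ := p
      obtain ⟨g, rfl⟩ := p.exists_rep
      rfl)
    (fun a => by
      obtain ⟨A, rfl⟩ := OpenSub.Coset.exists_rep a
      exact amap_id x A)
    (fun {a b c} p q {y z t} p' q' hp hq => by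
      obtain ⟨p, rfl, hp₂⟩ := p
      obtain ⟨q, hq₁, rfl⟩ := q
      obtain ⟨g, k, w, rfl, rfl⟩ := OpenSub.CosetArr.exists_comp p q (hp₂.trans hq₁.symm)
      refine (amap_comp (𝟙 x) (𝟙 x) w p' q' hp hq).trans ?_
      rw [Category.comp_id]
      exact congrArg arr (OpenSub.CosetArr.comp_eq w rfl rfl rfl).symm)
  have hF {a b : (OpenSub.coset U).carrier} (p : a ⟶ b) :
      Arrow.mk (F.map p) = arr (TwoElmendorf.arr p) := mk_functorOfArrows_map p
  equivOf F fun {a b} p k => by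
    obtain ⟨g, hg⟩ := (TwoElmendorf.arr p).exists_rep
    refine (hF _).trans ?_
    refine (congrArg arr (arr_amap hg.symm k)).trans ?_
    refine (amap_mul (𝟙 x) g k).symm.trans (amap_congr ?_ rfl)
    exact (congrArg arr hg).trans (hF p).symm

theorem pointFunctor_base {x : X.carrier} (h : IsPoint U x) :
    (pointFunctor h).functor.obj (base U) = x :=
  aobj_one x

/-- The 2-cell between equivariant functors out of `G/U` with given component at the base point. -/
theorem exists_coset_nat (H K : OpenSub.coset U ⟶ X)
    (m : H.functor.obj (base U) ⟶ K.functor.obj (base U))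
    (hm : ∀ A ∈ U.U₀, Arrow.mk (amap m (G.one A)) = Arrow.mk m) :
    ∃ θ : H ⟶ K, θ.natTrans.app (base U) = m := by
  let arr : U.Coset → Arrow X.carrier :=
    Quotient.lift (fun A => Arrow.mk (amap m (G.one A))) fun A B w => by
      have w' : B * A⁻¹ ∈ U.U₀ := QuotientGroup.rightRel_apply.1 w
      have e := amap_mul m (G.one (B * A⁻¹)) (G.one A)
      rw [← map_mul, inv_mul_cancel_right] at e
      exact (amap_congr (hm _ w').symm rfl).trans e
  have obj (H : OpenSub.coset U ⟶ X) (A : G.G₀) :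
      aobj (H.functor.obj (base U)) A = H.functor.obj (OpenSub.Coset.mk U A) :=
    (EquivFunctor_obj H _ A).symm.trans (congrArg H.functor.obj (mk_eq_aobj A).symm)
  have left (a : (OpenSub.coset U).carrier) : (arr a).left = H.functor.obj a := by
    obtain ⟨A, rfl⟩ := OpenSub.Coset.exists_rep a
    refine Eq.trans ?_ (obj H A)
    change aobj _ (G.dom (G.one A)) = _
    rw [G.dom_one]
  have right (a : (OpenSub.coset U).carrier) : (arr a).right = K.functor.obj a := by
    obtain ⟨A, rfl⟩ := OpenSub.Coset.exists_rep a
    refine Eq.trans ?_ (obj K A)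
    change aobj _ (G.cod (G.one A)) = _
    rw [G.cod_one]
  let θ : H.functor ⟶ K.functor :=
    { app := fun a => arrowHom (arr a) (left a) (right a)
      naturality := fun {a b} p => by
        obtain ⟨g, hg⟩ := exists_carr p
        obtain rfl : a = _ := arrow_left hg
        obtain rfl : b = _ := arrow_right hg
        refine arrow_eq ?_
        refine (amap_comp (𝟙 _) m (g := g) (g' := G.one (G.cod g)) (G.dom_one _).symm _ _
          ((arrow_map _ hg).trans (functor_carr H g)) (mk_arrowHom _ _ _)).trans ?_
        refine Eq.trans ?_ (amap_comp m (𝟙 _) (g := G.one (G.dom g)) (g' := g) (G.cod_one _) _ _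
          (mk_arrowHom _ _ _) ((arrow_map _ hg).trans (functor_carr K g))).symm
        rw [Category.id_comp, Category.comp_id]
        exact amap_congr rfl (by rw [G.comp'_one, G.one_comp']) }
  have hθ (a : (OpenSub.coset U).carrier) : Arrow.mk (θ.app a) = arr a :=
    mk_arrowHom (arr a) (left a) (right a)
  refine ⟨equivNatOf θ fun a A => ?_, arrow_eq ?_⟩
  · refine (hθ _).trans ?_
    refine Eq.trans ?_ (amap_congr (hθ a).symm rfl)
    obtain ⟨B, rfl⟩ := OpenSub.Coset.exists_rep a
    refine Eq.trans ?_ (amap_mul m (G.one B) (G.one A)).symm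
    exact amap_congr rfl (map_mul G.one B A)
  · refine (hθ _).trans ?_
    exact (amap_congr rfl (map_one G.one)).trans (amap_one m)

end Points

end Action

/-! ### Cells of the orbit 2-category -/

section OrbitCells

variable {G : TopTwoGroup.{u}}

section

variable {U V : OpenSub G}

theorem Induces.base {A : G.G₀} {F : OpenSub.coset U ⟶ OpenSub.coset V} (h : Induces A F) :
    F.functor.obj (base U) = OpenSub.Coset.mk V A :=
  (h.obj 1).trans (by rw [mul_one])

theorem Induces.ext {A : G.G₀} {F H : OpenSub.coset U ⟶ OpenSub.coset V} (hF : Induces A F)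
    (hH : Induces A H) : F = H :=
  coset_ext (hF.base.trans hH.base.symm)

theorem Induces₂.arrow_base {g : G.G₁} {F H : OpenSub.coset U ⟶ OpenSub.coset V} {θ : F ⟶ H}
    (h : Induces₂ g θ) : Arrow.mk (θ.natTrans.app (TwoElmendorf.base U)) = Arrow.mk (carr V g) :=
  arr_eq_mk_iff.1 ((h.app 1).trans (by rw [map_one, mul_one]))

theorem Induces₂.mul_left {g k : G.G₁} (hk : k ∈ V.U₁) {F H : OpenSub.coset U ⟶ OpenSub.coset V}
    {θ : F ⟶ H} (h : Induces₂ g θ) : Induces₂ (k * g) θ :=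
  .mk_of_app (by rw [map_mul]; exact h.dom.mul_left (V.dom_mem hk))
    (by rw [map_mul]; exact h.cod.mul_left (V.cod_mem hk))
    fun X => (h.app X).trans (by rw [mul_assoc, mk_mul_left₁ hk])

theorem Induces₂.comp_of_eq {g k : G.G₁} (w : G.cod g = G.dom k)
    {F H K : OpenSub.coset U ⟶ OpenSub.coset V} {θ : F ⟶ H} {κ : H ⟶ K} (hθ : Induces₂ g θ)
    (hκ : Induces₂ k κ) : Induces₂ (G.comp' g k w) (θ ≫ κ) :=
  .mk_of_app (by rw [G.dom_comp']; exact hθ.dom) (by rw [G.cod_comp']; exact hκ.cod) fun X => by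
    have w' : G.cod (g * G.one X) = G.dom (k * G.one X) := by
      rw [map_mul, map_mul, w, G.cod_one, G.dom_one]
    refine (arr_comp w' (hθ.app X) (hκ.app X)).trans ?_
    rw [G.comp'_mul g k (G.one X) (G.one X) w (by rw [G.cod_one, G.dom_one]), G.comp'_one]

end

namespace OpenSub

/-- The intersection of two open sub-2-groups. -/
def inf (U V : OpenSub G) : OpenSub G where
  U₀ := U.U₀ ⊓ V.U₀
  U₁ := U.U₁ ⊓ V.U₁
  isOpen₀ := U.isOpen₀.inter V.isOpen₀
  isOpen₁ := U.isOpen₁.inter V.isOpen₁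
  dom_mem h := ⟨U.dom_mem h.1, V.dom_mem h.2⟩
  cod_mem h := ⟨U.cod_mem h.1, V.cod_mem h.2⟩
  one_mem h := ⟨U.one_mem h.1, V.one_mem h.2⟩
  comp_mem w h k := ⟨U.comp_mem w h.1 k.1, V.comp_mem w h.2 k.2⟩

/-- The full sub-2-group of `U` on an open subgroup of objects. -/
def restrict (U : OpenSub G) (O : Subgroup G.G₀) (hO : IsOpen (O : Set G.G₀)) : OpenSub G where
  U₀ := U.U₀ ⊓ O
  U₁ := U.U₁ ⊓ (O.comap G.dom.toMonoidHom ⊓ O.comap G.cod.toMonoidHom)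
  isOpen₀ := U.isOpen₀.inter hO
  isOpen₁ := U.isOpen₁.inter
    ((hO.preimage G.dom.continuous_toFun).inter (hO.preimage G.cod.continuous_toFun))
  dom_mem h := ⟨U.dom_mem h.1, h.2.1⟩
  cod_mem h := ⟨U.cod_mem h.1, h.2.2⟩
  one_mem {a} h := ⟨U.one_mem h.1, show G.dom (G.one a) ∈ O by rw [G.dom_one]; exact h.2,
    show G.cod (G.one a) ∈ O by rw [G.cod_one]; exact h.2⟩
  comp_mem w h k := ⟨U.comp_mem w h.1 k.1,
    show G.dom _ ∈ O by rw [G.dom_comp']; exact h.2.1,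
    show G.cod _ ∈ O by rw [G.cod_comp']; exact k.2.2⟩

/-- The conjugate `A⁻¹ U A` of an open sub-2-group. -/
def conj (U : OpenSub G) (A : G.G₀) : OpenSub G where
  U₀ := U.U₀.comap (MulAut.conj A).toMonoidHom
  U₁ := U.U₁.comap (MulAut.conj (G.one A)).toMonoidHom
  isOpen₀ := U.isOpen₀.preimage (f := fun x => A * x * A⁻¹) (by fun_prop)
  isOpen₁ := U.isOpen₁.preimage (f := fun x => G.one A * x * (G.one A)⁻¹) (by fun_prop)
  dom_mem {g} h := by
    have : G.dom (G.one A * g * (G.one A)⁻¹) ∈ U.U₀ := U.dom_mem h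
    simpa [G.dom_one] using this
  cod_mem {g} h := by
    have : G.cod (G.one A * g * (G.one A)⁻¹) ∈ U.U₀ := U.cod_mem h
    simpa [G.cod_one] using this
  one_mem {a} h := by
    have : G.one (A * a * A⁻¹) ∈ U.U₁ := U.one_mem h
    simpa using this
  comp_mem {g h} w hg hh := by
    have w' : G.cod (G.one A * g * (G.one A)⁻¹) = G.dom (G.one A * h * (G.one A)⁻¹) := by
      simp [G.cod_one, G.dom_one, w]
    have := U.comp_mem w' hg hh
    have e : G.comp' (G.one A * g * (G.one A)⁻¹) (G.one A * h * (G.one A)⁻¹) w' =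
        G.one A * G.comp' g h w * (G.one A)⁻¹ := by
      have w₁ : G.cod (G.one A) = G.dom (G.one A) := by rw [G.cod_one, G.dom_one]
      have w₂ : G.cod (G.one A)⁻¹ = G.dom (G.one A)⁻¹ := by rw [map_inv, map_inv, w₁]
      have w₃ : G.cod (G.one A * g) = G.dom (G.one A * h) := by rw [map_mul, map_mul, w₁, w]
      rw [G.comp'_mul _ _ _ _ w₃ w₂, G.comp'_mul _ _ _ _ w₁ w, G.comp'_one]
      congr 1
      refine (G.comp'_congr w₂ (map_inv _ _).symm (map_inv _ _).symm).trans ?_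
      rw [G.comp'_one, map_inv]
    rwa [e] at this

end OpenSub

namespace Orbit

variable {U V W : Orbit G}

theorem hom_ext_of_induces {A : G.G₀} {a b : U ⟶ V} (ha : Induces A a.functor)
    (hb : Induces A b.functor) : a = b :=
  Orbit.Hom.ext (ha.ext hb)

theorem arrow_ext {a b a' b' : U ⟶ V} {γ : a ⟶ b} {δ : a' ⟶ b'}
    (h : Arrow.mk γ.trans = Arrow.mk δ.trans) : Arrow.mk γ = Arrow.mk δ := by
  obtain rfl : a = a' := Orbit.Hom.ext (arrow_left h)
  obtain rfl : b = b' := Orbit.Hom.ext (arrow_right h)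
  exact congrArg Arrow.mk (Hom₂.ext (arrow_eq h))

theorem arrow_ext_of_induces₂ {g : G.G₁} {a b a' b' : U ⟶ V} {γ : a ⟶ b} {δ : a' ⟶ b'}
    (hγ : Induces₂ g γ.trans) (hδ : Induces₂ g δ.trans) : Arrow.mk γ = Arrow.mk δ := by
  refine arrow_ext (coset_ext₂ 1 ?_)
  exact hγ.arrow_base.trans hδ.arrow_base.symm

theorem exists_hom (A : G.G₀)
    (h : ∀ g ∈ U.sub.U₁, G.one A * g * (G.one A)⁻¹ ∈ V.sub.U₁) :
    ∃ a : U ⟶ V, Induces A a.functor := by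
  let x : (OpenSub.coset V.sub).carrier := OpenSub.Coset.mk V.sub A
  have hx : IsPoint U.sub x := fun g hg => by
    refine arr_inj ((arr_amap (arr_id rfl) g).trans (Eq.trans ?_ (arr_id rfl).symm))
    refine OpenSub.CosetArr.mk_eq.2 ?_
    have := V.sub.U₁.inv_mem (h g hg)
    simpa [mul_assoc] using this
  have : Induces A (pointFunctor hx) :=
    { mem₀ := fun X hX => by
        have := V.sub.dom_mem (h _ (U.sub.one_mem hX))
        simpa [G.dom_one] using this
      mem₁ := h
      obj := fun X => rfl
      map := fun p g hg => by
        have e := arrow_map (pointFunctor hx).functor (arr_eq_mk_iff.1 hg)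
        have e' := functor_carr (pointFunctor hx) g
        rw [pointFunctor_base] at e'
        exact (arr_of_mk (e.trans e')).trans (arr_amap (arr_id rfl) g) }
  exact ⟨⟨pointFunctor hx, A, this⟩, this⟩

theorem exists_hom₂ {a b : U ⟶ V} (g : G.G₁) (ha : Induces (G.dom g) a.functor)
    (hb : Induces (G.cod g) b.functor) (h : ∀ X ∈ U.sub.U₀, g * G.one X * g⁻¹ ∈ V.sub.U₁) :
    ∃ γ : a ⟶ b, Induces₂ g γ.trans := by
  let m : a.functor.functor.obj (base U.sub) ⟶ b.functor.functor.obj (base U.sub) :=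
    arrowHom (Arrow.mk (carr V.sub g)) ha.base.symm hb.base.symm
  have hm : Arrow.mk m = Arrow.mk (carr V.sub g) := mk_arrowHom _ _ _
  obtain ⟨θ, hθ⟩ := exists_coset_nat a.functor b.functor m fun A hA => by
    refine (amap_congr hm rfl).trans (Eq.trans ?_ hm.symm)
    refine arr_inj ((arr_amap rfl _).trans ?_)
    refine OpenSub.CosetArr.mk_eq.2 ?_
    have := V.sub.U₁.inv_mem (h A hA)
    simpa [mul_assoc] using this
  have : Induces₂ g θ := .mk_of_app ha hb fun X => by
    refine (arr_of_mk ((arrow_app _ (mk_eq_aobj X)).trans (EquivNatTrans_app θ _ X))).trans ?_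
    refine (arr_amap (g := g) ?_ (G.one X))
    rw [hθ]
    exact arr_of_mk hm
  exact ⟨⟨θ, g, this⟩, this⟩

/-- The morphism `G/U ⟶ G/V` is the one induced by `1`; this requires `U ⊆ V`. -/
def Inc (i : U ⟶ V) : Prop := Induces 1 i.functor

theorem Inc.id (U : Orbit G) : Inc (𝟙 U) := Induces.id U.sub

theorem Inc.comp {i : U ⟶ V} {j : V ⟶ W} (hi : Inc i) (hj : Inc j) : Inc (i ≫ j) := by
  have := Induces.comp hi hj
  rwa [mul_one] at this

theorem Inc.eq {i j : U ⟶ V} (hi : Inc i) (hj : Inc j) : i = j := hom_ext_of_induces hi hj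

theorem Inc.comp_induces {A : G.G₀} {i : U ⟶ V} {a : V ⟶ W} (hi : Inc i)
    (ha : Induces A a.functor) : Induces A (i ≫ a).functor := by
  have := Induces.comp hi ha
  rwa [mul_one] at this

theorem Inc.induces_comp {A : G.G₀} {a : U ⟶ V} {i : V ⟶ W} (ha : Induces A a.functor)
    (hi : Inc i) : Induces A (a ≫ i).functor := by
  have := Induces.comp ha hi
  rwa [one_mul] at this

theorem Inc.whiskerLeft {g : G.G₁} {i : U ⟶ V} {a b : V ⟶ W} {γ : a ⟶ b} (hi : Inc i)
    (hγ : Induces₂ g γ.trans) : Induces₂ g (i ◁ γ).trans := by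
  have := Induces₂.whiskerLeft hi hγ
  rwa [map_one, mul_one] at this

theorem Inc.whiskerRight {g : G.G₁} {a b : U ⟶ V} {γ : a ⟶ b} {i : V ⟶ W}
    (hγ : Induces₂ g γ.trans) (hi : Inc i) : Induces₂ g (γ ▷ i).trans := by
  have := Induces₂.whiskerRight hγ hi
  rwa [map_one, one_mul] at this

theorem exists_inc (h : ∀ g ∈ U.sub.U₁, g ∈ V.sub.U₁) : ∃ i : U ⟶ V, Inc i :=
  exists_hom 1 fun g hg => by simpa using h g hg

theorem exists_inf (U V : Orbit G) : ∃ (W : Orbit G) (i : W ⟶ U) (j : W ⟶ V), Inc i ∧ Inc j := by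
  obtain ⟨i, hi⟩ := exists_inc (U := ⟨U.sub.inf V.sub⟩) (V := U) fun g hg => hg.1
  obtain ⟨j, hj⟩ := exists_inc (U := ⟨U.sub.inf V.sub⟩) (V := V) fun g hg => hg.2
  exact ⟨_, i, j, hi, hj⟩

/-- Every arrow of `G` induces a 2-cell between morphisms `G/W ⟶ G/V` for small enough `W`. -/
theorem exists_cell (g : G.G₁) (U V : Orbit G) :
    ∃ (W : Orbit G) (i : W ⟶ U) (a b : W ⟶ V) (γ : a ⟶ b), Inc i ∧ Induces₂ g γ.trans := by
  -- The objects `X` with `g 1_X g⁻¹ ∈ V₁`.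
  let O : Subgroup G.G₀ := (V.sub.U₁.comap (MulAut.conj g).toMonoidHom).comap G.one.toMonoidHom
  have hO : IsOpen (O : Set G.G₀) :=
    V.sub.isOpen₁.preimage (f := fun x => g * G.one x * g⁻¹)
      ((continuous_const.mul G.one.continuous_toFun).mul continuous_const)
  let W : Orbit G := ⟨((U.sub.inf ((V.sub.conj (G.dom g)).inf (V.sub.conj (G.cod g)))).restrict
    O hO)⟩
  obtain ⟨i, hi⟩ := exists_inc (U := W) (V := U) fun g hg => hg.1.1
  obtain ⟨a, ha⟩ := exists_hom (U := W) (V := V) (G.dom g) fun g hg => hg.1.2.1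
  obtain ⟨b, hb⟩ := exists_hom (U := W) (V := V) (G.cod g) fun g hg => hg.1.2.2
  obtain ⟨γ, hγ⟩ := exists_hom₂ g ha hb fun X hX => hX.2
  exact ⟨W, i, a, b, γ, hi, hγ⟩

theorem exists_induces (A : G.G₀) (U V : Orbit G) :
    ∃ (W : Orbit G) (i : W ⟶ U) (a : W ⟶ V), Inc i ∧ Induces A a.functor := by
  obtain ⟨W, i, a, b, γ, hi, hγ⟩ := exists_cell (G.one A) U V
  exact ⟨W, i, a, hi, by simpa [G.dom_one] using hγ.dom⟩

end Orbit

end OrbitCells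

/-! ### Filtered colimits of 2-presheaves on the orbit 2-category -/

noncomputable section Germs

variable {G : TopTwoGroup.{u}}

open Orbit

/-- The relation whose quotient is the filtered colimit of the sets `T U` over the open
sub-2-groups: two elements are related if they have the same restriction to some smaller
sub-2-group. -/
def germSetoid (T : Orbit G → Type u) (t : ∀ {U V : Orbit G}, (U ⟶ V) → T V → T U)
    (ht : ∀ {U V W : Orbit G} (f : U ⟶ V) (g : V ⟶ W) (x : T W), t (f ≫ g) x = t f (t g x)) :
    Setoid (Σ U, T U) where
  r p q := ∃ (W : Orbit G) (a : W ⟶ p.1) (b : W ⟶ q.1), Inc a ∧ Inc b ∧ t a p.2 = t b q.2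
  iseqv :=
    { refl := fun p => ⟨p.1, 𝟙 _, 𝟙 _, Inc.id _, Inc.id _, rfl⟩
      symm := fun ⟨W, a, b, ha, hb, h⟩ => ⟨W, b, a, hb, ha, h.symm⟩
      trans := fun ⟨W, a, b, ha, hb, h⟩ ⟨W', b', c, hb', hc, h'⟩ => by
        obtain ⟨Z, i, j, hi, hj⟩ := exists_inf W W'
        refine ⟨Z, i ≫ a, j ≫ c, hi.comp ha, hj.comp hc, ?_⟩
        rw [ht, ht, h, ← h', ← ht, ← ht, (hi.comp hb).eq (hj.comp hb')] }

variable (F : StrictPseudofunctor (Orbit G)ᵒᵖ Cat.{u, u})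

/-- The equality of germs of objects of a 2-presheaf. -/
def objSetoid : Setoid (Σ U : Orbit G, F.obj (op U)) :=
  germSetoid (fun U => F.obj (op U)) (fun a => (res F a).obj) fun f g x => res_comp_obj F f g x

/-- The equality of germs of arrows of a 2-presheaf. -/
def arrSetoid : Setoid (Σ U : Orbit G, Arrow (F.obj (op U))) :=
  germSetoid (fun U => Arrow (F.obj (op U))) (fun a => (res F a).mapArrow.obj)
    fun f g x => res_comp_map F f g x.hom

/-- The objects of the filtered colimit of a 2-presheaf over the open sub-2-groups. -/
def Colim : Type u := Quotient (objSetoid F)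

/-- The arrows of the filtered colimit of a 2-presheaf over the open sub-2-groups. -/
def ColimArr : Type u := Quotient (arrSetoid F)

variable {F}

/-- The class of an object. -/
def Colim.mk (U : Orbit G) (X : F.obj (op U)) : Colim F := Quotient.mk (objSetoid F) ⟨U, X⟩

/-- The class of an arrow. -/
def ColimArr.mk {U : Orbit G} {X Y : F.obj (op U)} (m : X ⟶ Y) : ColimArr F :=
  Quotient.mk (arrSetoid F) ⟨U, Arrow.mk m⟩

theorem Colim.mk_eq {U V : Orbit G} {X : F.obj (op U)} {Y : F.obj (op V)} :
    Colim.mk U X = Colim.mk V Y ↔ ∃ (W : Orbit G) (a : W ⟶ U) (b : W ⟶ V), Inc a ∧ Inc b ∧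
      (res F a).obj X = (res F b).obj Y :=
  Quotient.eq (r := objSetoid F)

theorem ColimArr.mk_eq {U V : Orbit G} {X X' : F.obj (op U)} {Y Y' : F.obj (op V)} {m : X ⟶ X'}
    {n : Y ⟶ Y'} : ColimArr.mk m = ColimArr.mk n ↔
      ∃ (W : Orbit G) (a : W ⟶ U) (b : W ⟶ V), Inc a ∧ Inc b ∧
        Arrow.mk ((res F a).map m) = Arrow.mk ((res F b).map n) :=
  Quotient.eq (r := arrSetoid F)

theorem ColimArr.mk_res {U V : Orbit G} {a : V ⟶ U} (ha : Inc a) {X Y : F.obj (op U)}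
    (m : X ⟶ Y) : ColimArr.mk ((res F a).map m) = ColimArr.mk m :=
  ColimArr.mk_eq.2 ⟨V, 𝟙 V, a, Inc.id V, ha, res_id_map F _⟩

theorem ColimArr.mk_congr {U : Orbit G} {X Y X' Y' : F.obj (op U)} {m : X ⟶ Y} {n : X' ⟶ Y'}
    (h : Arrow.mk m = Arrow.mk n) : ColimArr.mk m = ColimArr.mk n := by
  cases h; rfl

/-- The source of a germ of arrows. -/
def ColimArr.dom : ColimArr F → Colim F :=
  Quotient.lift (fun p => Colim.mk p.1 p.2.left) fun _ _ ⟨W, a, b, ha, hb, h⟩ =>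
    Colim.mk_eq.2 ⟨W, a, b, ha, hb, arrow_left h⟩

/-- The target of a germ of arrows. -/
def ColimArr.cod : ColimArr F → Colim F :=
  Quotient.lift (fun p => Colim.mk p.1 p.2.right) fun _ _ ⟨W, a, b, ha, hb, h⟩ =>
    Colim.mk_eq.2 ⟨W, a, b, ha, hb, arrow_right h⟩

/-- The germ of an identity arrow. -/
def Colim.one : Colim F → ColimArr F :=
  Quotient.lift (fun p => ColimArr.mk (𝟙 p.2)) fun _ _ ⟨W, a, b, ha, hb, h⟩ =>
    ColimArr.mk_eq.2 ⟨W, a, b, ha, hb, by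
      rw [CategoryTheory.Functor.map_id, CategoryTheory.Functor.map_id]; exact arrow_id h⟩

theorem Colim.exists_rep (x : Colim F) : ∃ (U : Orbit G) (X : F.obj (op U)), Colim.mk U X = x := by
  obtain ⟨⟨U, X⟩, rfl⟩ := Quotient.exists_rep x
  exact ⟨U, X, rfl⟩

theorem ColimArr.exists_rep (p : ColimArr F) :
    ∃ (U : Orbit G) (X Y : F.obj (op U)) (m : X ⟶ Y), ColimArr.mk m = p := by
  obtain ⟨⟨U, m⟩, rfl⟩ := Quotient.exists_rep p
  exact ⟨U, _, _, m.hom, rfl⟩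

theorem ColimArr.exists_comp_right {U : Orbit G} {X Y : F.obj (op U)} (m : X ⟶ Y)
    (q : ColimArr F) (w : (ColimArr.mk m).cod = q.dom) :
    ∃ (W : Orbit G) (i : W ⟶ U) (Z : F.obj (op W)) (n : (res F i).obj Y ⟶ Z),
      Inc i ∧ ColimArr.mk n = q := by
  obtain ⟨V, Y', Z', n, rfl⟩ := q.exists_rep
  obtain ⟨W, i, j, hi, hj, h⟩ := Colim.mk_eq.1 w
  refine ⟨W, i, _, eqToHom h ≫ (res F j).map n, hi, ?_⟩
  rw [← mk_res hj n]
  exact mk_congr (Arrow.arrow_mk_eqToHom_comp _ _)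

theorem ColimArr.exists_comp (p q : ColimArr F) (w : p.cod = q.dom) :
    ∃ (U : Orbit G) (X Y Z : F.obj (op U)) (m : X ⟶ Y) (n : Y ⟶ Z),
      ColimArr.mk m = p ∧ ColimArr.mk n = q := by
  obtain ⟨U, X, Y, m, rfl⟩ := p.exists_rep
  obtain ⟨W, i, Z, n, hi, hn⟩ := exists_comp_right m q w
  exact ⟨W, _, _, _, (res F i).map m, n, mk_res hi m, hn⟩

theorem ColimArr.mk_comp_eq {U V : Orbit G} {X Y Z : F.obj (op U)} {X' Y' Z' : F.obj (op V)}
    {m : X ⟶ Y} {n : Y ⟶ Z} {m' : X' ⟶ Y'} {n' : Y' ⟶ Z'} (hm : ColimArr.mk m = ColimArr.mk m')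
    (hn : ColimArr.mk n = ColimArr.mk n') : ColimArr.mk (m ≫ n) = ColimArr.mk (m' ≫ n') := by
  obtain ⟨W, a, b, ha, hb, h⟩ := ColimArr.mk_eq.1 hm
  obtain ⟨W', a', b', ha', hb', h'⟩ := ColimArr.mk_eq.1 hn
  obtain ⟨Z, i, j, hi, hj⟩ := exists_inf W W'
  have ea := (hi.comp ha).eq (hj.comp ha')
  have eb := (hi.comp hb).eq (hj.comp hb')
  refine ColimArr.mk_eq.2 ⟨Z, i ≫ a, i ≫ b, hi.comp ha, hi.comp hb, ?_⟩
  rw [Functor.map_comp, Functor.map_comp]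
  refine arrow_comp ?_ ?_
  · exact (res_comp_map F i a m).trans ((arrow_map _ h).trans (res_comp_map F i b m').symm)
  · rw [ea, eb]
    exact (res_comp_map F j a' n).trans ((arrow_map _ h').trans (res_comp_map F j b' n').symm)

/-- The composite of two germs of arrows, computed on arbitrary composable representatives. -/
def ColimArr.comp (p q : ColimArr F) (w : p.cod = q.dom) : ColimArr F :=
  ColimArr.mk ((exists_comp p q w).choose_spec.choose_spec.choose_spec.choose_spec.choose ≫
    (exists_comp p q w).choose_spec.choose_spec.choose_spec.choose_spec.choose_spec.choose)

theorem ColimArr.comp_eq {U : Orbit G} {X Y Z : F.obj (op U)} (m : X ⟶ Y) (n : Y ⟶ Z)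
    {p q : ColimArr F} (w : p.cod = q.dom) (hm : ColimArr.mk m = p) (hn : ColimArr.mk n = q) :
    ColimArr.comp p q w = ColimArr.mk (m ≫ n) :=
  have key :=
    (exists_comp p q w).choose_spec.choose_spec.choose_spec.choose_spec.choose_spec.choose_spec
  mk_comp_eq (key.1.trans hm.symm) (key.2.trans hn.symm)

attribute [irreducible] ColimArr.comp

theorem ColimArr.comp_assoc (p q r : ColimArr F) (w : p.cod = q.dom) (w' : q.cod = r.dom)
    (w₁ : (p.comp q w).cod = r.dom) (w₂ : p.cod = (q.comp r w').dom) :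
    (p.comp q w).comp r w₁ = p.comp (q.comp r w') w₂ := by
  obtain ⟨U, X, Y, Z, m, n, rfl, rfl⟩ := ColimArr.exists_comp p q w
  obtain ⟨W, i, T, k, hi, rfl⟩ := ColimArr.exists_comp_right n r w'
  have hm := ColimArr.mk_res hi m
  have hn := ColimArr.mk_res hi n
  have h₁ := ColimArr.comp_eq _ _ w hm hn
  have h₂ := ColimArr.comp_eq _ _ w' hn rfl
  refine (ColimArr.comp_eq _ k _ h₁.symm rfl).trans ?_
  refine Eq.trans ?_ (ColimArr.comp_eq _ _ _ hm h₂.symm).symm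
  exact congrArg ColimArr.mk (Category.assoc _ _ _)

/-- The filtered colimit of a 2-presheaf over the open sub-2-groups. -/
instance : SmallCategory (Colim F) where
  Hom a b := {p : ColimArr F // p.dom = a ∧ p.cod = b}
  id a := ⟨a.one, by obtain ⟨U, X, rfl⟩ := a.exists_rep; exact ⟨rfl, rfl⟩⟩
  comp p q := ⟨ColimArr.comp p.1 q.1 (p.2.2.trans q.2.1.symm), by
    obtain ⟨p, rfl, hp⟩ := p
    obtain ⟨q, hq, rfl⟩ := q
    obtain ⟨U, X, Y, Z, m, n, rfl, rfl⟩ := ColimArr.exists_comp p q (hp.trans hq.symm)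
    rw [ColimArr.comp_eq m n _ rfl rfl]
    exact ⟨rfl, rfl⟩⟩
  id_comp p := by
    obtain ⟨p, rfl, hp⟩ := p
    obtain ⟨U, X, Y, m, rfl⟩ := p.exists_rep
    refine Subtype.ext ((ColimArr.comp_eq (𝟙 X) m rfl rfl rfl).trans ?_)
    exact congrArg ColimArr.mk (Category.id_comp m)
  comp_id p := by
    obtain ⟨p, hp, rfl⟩ := p
    obtain ⟨U, X, Y, m, rfl⟩ := p.exists_rep
    refine Subtype.ext ((ColimArr.comp_eq m (𝟙 Y) rfl rfl rfl).trans ?_)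
    exact congrArg ColimArr.mk (Category.comp_id m)
  assoc p q r := Subtype.ext (ColimArr.comp_assoc p.1 q.1 r.1 _ _ _ _)

variable (F) in
/-- The functor `X ↦ [U, X]` into the colimit. -/
def colimι (U : Orbit G) : F.obj (op U) ⥤ Colim F where
  obj X := Colim.mk U X
  map m := ⟨ColimArr.mk m, rfl, rfl⟩
  map_id _ := rfl
  map_comp m n := Subtype.ext (ColimArr.comp_eq m n _ rfl rfl).symm

theorem colim_arrow_eq {x y x' y' : Colim F} {p : x ⟶ y} {q : x' ⟶ y'} :
    Arrow.mk p = Arrow.mk q ↔ p.1 = q.1 := by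
  constructor
  · intro h; cases h; rfl
  · intro h
    obtain ⟨p, rfl, rfl⟩ := p
    obtain ⟨q, rfl, rfl⟩ := q
    obtain rfl : p = q := h
    rfl

theorem colimι_obj_eq_iff {U V : Orbit G} {X : F.obj (op U)} {Y : F.obj (op V)} :
    (colimι F U).obj X = (colimι F V).obj Y ↔
      ∃ (W : Orbit G) (a : W ⟶ U) (b : W ⟶ V), Inc a ∧ Inc b ∧
        (res F a).obj X = (res F b).obj Y :=
  Colim.mk_eq

theorem colimι_map_eq_iff {U V : Orbit G} {X X' : F.obj (op U)} {Y Y' : F.obj (op V)}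
    {m : X ⟶ X'} {n : Y ⟶ Y'} :
    Arrow.mk ((colimι F U).map m) = Arrow.mk ((colimι F V).map n) ↔
      ∃ (W : Orbit G) (a : W ⟶ U) (b : W ⟶ V), Inc a ∧ Inc b ∧
        Arrow.mk ((res F a).map m) = Arrow.mk ((res F b).map n) :=
  colim_arrow_eq.trans ColimArr.mk_eq

theorem colimι_res {U V : Orbit G} {a : V ⟶ U} (ha : Inc a) :
    res F a ⋙ colimι F V = colimι F U :=
  functor_ext_arrow fun m => colim_arrow_eq.2 (ColimArr.mk_res ha m)

theorem colimι_res_obj {U V : Orbit G} {a : V ⟶ U} (ha : Inc a) (X : F.obj (op U)) :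
    (colimι F V).obj ((res F a).obj X) = (colimι F U).obj X :=
  Functor.congr_obj (colimι_res ha) X

theorem colimι_res_map {U V : Orbit G} {a : V ⟶ U} (ha : Inc a) {X Y : F.obj (op U)}
    (m : X ⟶ Y) : Arrow.mk ((colimι F V).map ((res F a).map m)) =
      Arrow.mk ((colimι F U).map m) :=
  arrow_functor (colimι_res ha) m

theorem colim_exists_obj (x : Colim F) :
    ∃ (U : Orbit G) (X : F.obj (op U)), (colimι F U).obj X = x := x.exists_rep

theorem colim_exists_map {x y : Colim F} (f : x ⟶ y) :
    ∃ (U : Orbit G) (X Y : F.obj (op U)) (m : X ⟶ Y),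
      Arrow.mk ((colimι F U).map m) = Arrow.mk f := by
  obtain ⟨U, X, Y, m, hm⟩ := f.1.exists_rep
  exact ⟨U, X, Y, m, colim_arrow_eq.2 hm⟩

theorem colim_exists_comp {x y z : Colim F} (f : x ⟶ y) (g : y ⟶ z) :
    ∃ (U : Orbit G) (X Y Z : F.obj (op U)) (m : X ⟶ Y) (n : Y ⟶ Z),
      Arrow.mk ((colimι F U).map m) = Arrow.mk f ∧
        Arrow.mk ((colimι F U).map n) = Arrow.mk g := by
  obtain ⟨U, X, Y, Z, m, n, hm, hn⟩ := ColimArr.exists_comp f.1 g.1 (f.2.2.trans g.2.1.symm)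
  exact ⟨U, X, Y, Z, m, n, colim_arrow_eq.2 hm, colim_arrow_eq.2 hn⟩

section Universal

variable {D : Type u} [SmallCategory D]

theorem colim_functor_ext {K L : Colim F ⥤ D} (h : ∀ U, colimι F U ⋙ K = colimι F U ⋙ L) :
    K = L :=
  functor_ext_arrow fun f => by
    obtain ⟨U, X, Y, m, hm⟩ := colim_exists_map f
    exact (arrow_map K hm).symm.trans ((arrow_functor (h U) m).trans (arrow_map L hm))

/-- A compatible family of functors on the categories of sections factors through the colimit. -/
theorem colim_exists_desc (K : ∀ U : Orbit G, F.obj (op U) ⥤ D)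
    (hK : ∀ {V U : Orbit G} {i : V ⟶ U}, Inc i → res F i ⋙ K V = K U) :
    ∃ L : Colim F ⥤ D, ∀ U, colimι F U ⋙ L = K U := by
  have key {U V : Orbit G} {X X' : F.obj (op U)} {Y Y' : F.obj (op V)} {m : X ⟶ X'}
      {n : Y ⟶ Y'} (h : Arrow.mk ((colimι F U).map m) = Arrow.mk ((colimι F V).map n)) :
      Arrow.mk ((K U).map m) = Arrow.mk ((K V).map n) := by
    obtain ⟨W, a, b, ha, hb, h⟩ := colimι_map_eq_iff.1 h
    rw [← arrow_functor (hK ha) m, ← arrow_functor (hK hb) n]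
    exact arrow_map (K W) h
  choose U₀ X₀ h₀ using colim_exists_obj (F := F)
  choose U X Y m hm using @colim_exists_map G F
  let arr {x y : Colim F} (f : x ⟶ y) : Arrow D := Arrow.mk ((K (U f)).map (m f))
  have arr_eq {x y : Colim F} (f : x ⟶ y) {V : Orbit G} {Z Z' : F.obj (op V)} (n : Z ⟶ Z')
      (h : Arrow.mk ((colimι F V).map n) = Arrow.mk f) : arr f = Arrow.mk ((K V).map n) :=
    key ((hm f).trans h.symm)
  let obj (x : Colim F) : D := (K (U₀ x)).obj (X₀ x)
  have obj_eq (x : Colim F) {V : Orbit G} (Z : F.obj (op V))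
      (h : (colimι F V).obj Z = x) : obj x = (K V).obj Z := by
    have := key (m := 𝟙 (X₀ x)) (n := 𝟙 Z) (by
      rw [CategoryTheory.Functor.map_id, CategoryTheory.Functor.map_id]
      exact arrow_id ((h₀ x).trans h.symm))
    exact arrow_left this
  have hid (x : Colim F) : arr (𝟙 x) = Arrow.mk (𝟙 (obj x)) := by
    rw [arr_eq (𝟙 x) (𝟙 (X₀ x)) (by
      rw [CategoryTheory.Functor.map_id]; exact arrow_id (h₀ x)), CategoryTheory.Functor.map_id]
  have hcomp {x y z : Colim F} (f : x ⟶ y) (g : y ⟶ z) {a b c : D} (p : a ⟶ b) (q : b ⟶ c)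
      (hp : Arrow.mk p = arr f) (hq : Arrow.mk q = arr g) : Arrow.mk (p ≫ q) = arr (f ≫ g) := by
    obtain ⟨V, X₁, X₂, X₃, n, n', hn, hn'⟩ := colim_exists_comp f g
    rw [arr_eq (f ≫ g) (n ≫ n') (by rw [Functor.map_comp]; exact arrow_comp hn hn'),
      Functor.map_comp]
    exact arrow_comp (hp.trans (arr_eq f n hn)) (hq.trans (arr_eq g n' hn'))
  let L : Colim F ⥤ D := functorOfArrows obj arr
    (fun {x y} f => (obj_eq x (X f) (arrow_left (hm f))).symm)
    (fun {x y} f => (obj_eq y (Y f) (arrow_right (hm f))).symm) hid hcomp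
  have hL {x y : Colim F} (f : x ⟶ y) : Arrow.mk (L.map f) = arr f :=
    mk_functorOfArrows_map (arr := arr) f
  exact ⟨L, fun V => functor_ext_arrow fun n => (hL _).trans (arr_eq _ n rfl)⟩

/-- A compatible family of natural transformations on the categories of sections comes from a
natural transformation between functors out of the colimit. -/
theorem colim_exists_nat {K L : Colim F ⥤ D} {K' L' : ∀ U : Orbit G, F.obj (op U) ⥤ D}
    (hK : ∀ U, colimι F U ⋙ K = K' U) (hL : ∀ U, colimι F U ⋙ L = L' U)
    (α : ∀ U : Orbit G, K' U ⟶ L' U)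
    (hα : ∀ {V U : Orbit G} {i : V ⟶ U}, Inc i → ∀ X : F.obj (op U),
      Arrow.mk ((α V).app ((res F i).obj X)) = Arrow.mk ((α U).app X)) :
    ∃ β : K ⟶ L, ∀ U X, Arrow.mk (β.app ((colimι F U).obj X)) = Arrow.mk ((α U).app X) := by
  obtain rfl : (fun U => colimι F U ⋙ K) = K' := funext hK
  obtain rfl : (fun U => colimι F U ⋙ L) = L' := funext hL
  have key {U V : Orbit G} {X : F.obj (op U)} {Y : F.obj (op V)}
      (h : (colimι F U).obj X = (colimι F V).obj Y) :
      Arrow.mk ((α U).app X) = Arrow.mk ((α V).app Y) := by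
    obtain ⟨W, a, b, ha, hb, h⟩ := colimι_obj_eq_iff.1 h
    rw [← hα ha, ← hα hb, h]
  choose U X hX using colim_exists_obj (F := F)
  let app (x : Colim F) : K.obj x ⟶ L.obj x :=
    arrowHom (Arrow.mk ((α (U x)).app (X x))) (congrArg K.obj (hX x)) (congrArg L.obj (hX x))
  have happ {V : Orbit G} (Y : F.obj (op V)) :
      app ((colimι F V).obj Y) = (α V).app Y :=
    arrow_eq ((mk_arrowHom _ _ _).trans (key (hX _)))
  have hnat {x y : Colim F} (f : x ⟶ y) : K.map f ≫ app y = app x ≫ L.map f := by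
    obtain ⟨V, X, Y, m, hm⟩ := colim_exists_map f
    obtain rfl := arrow_left hm
    obtain rfl := arrow_right hm
    rw [← arrow_eq hm, happ, happ]
    exact (α V).naturality m
  exact ⟨⟨app, fun _ _ f => hnat f⟩, fun V Y => congrArg Arrow.mk (happ Y)⟩

end Universal

end Germs

/-! ### The action on the filtered colimit -/

section ResMap

variable {C : Type u₁} [Bicategory.{w₁, v₁} C] [Bicategory.Strict C]
  (F : StrictPseudofunctor Cᵒᵖ Cat.{v₂, u₂})

/-- The restriction of an arrow along a 2-cell: the diagonal of the naturality square. -/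
def resMap {a b : C} {f g : a ⟶ b} (α : f ⟶ g) {X Y : F.obj (op b)} (m : X ⟶ Y) :
    (res F f).obj X ⟶ (res F g).obj Y :=
  (res F f).map m ≫ (res₂ F α).app Y

theorem resMap_congr {a b : C} {f g f' g' : a ⟶ b} {α : f ⟶ g} {β : f' ⟶ g'}
    (h : Arrow.mk α = Arrow.mk β) {X Y X' Y' : F.obj (op b)} {m : X ⟶ Y} {n : X' ⟶ Y'}
    (h' : Arrow.mk m = Arrow.mk n) : Arrow.mk (resMap F α m) = Arrow.mk (resMap F β n) := by
  cases h; cases h'; rfl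

theorem resMap_id_id {a b : C} (f : a ⟶ b) (X : F.obj (op b)) :
    resMap F (𝟙 f) (𝟙 X) = 𝟙 _ := by
  simp [resMap]

theorem resMap_id_left {a b : C} (f : a ⟶ b) {X Y : F.obj (op b)} (m : X ⟶ Y) :
    resMap F (𝟙 f) m = (res F f).map m := by
  simp [resMap]

theorem resMap_id_right {a b : C} {f g : a ⟶ b} (α : f ⟶ g) (X : F.obj (op b)) :
    resMap F α (𝟙 X) = (res₂ F α).app X := by
  simp [resMap]

theorem resMap_comp {a b : C} {f g h : a ⟶ b} (α : f ⟶ g) (β : g ⟶ h) {X Y Z : F.obj (op b)}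
    (m : X ⟶ Y) (n : Y ⟶ Z) : resMap F (α ≫ β) (m ≫ n) = resMap F α m ≫ resMap F β n := by
  simp [resMap]

theorem resMap_whiskerLeft {a' a b : C} (h : a' ⟶ a) {f g : a ⟶ b} (α : f ⟶ g)
    {X Y : F.obj (op b)} (m : X ⟶ Y) :
    Arrow.mk (resMap F (h ◁ α) m) = Arrow.mk ((res F h).map (resMap F α m)) := by
  simp only [resMap, Functor.map_comp]
  exact arrow_comp (res_comp_map F h f m) (res₂_whiskerLeft F h α Y)

theorem resMap_whiskerRight {a b c : C} {f g : a ⟶ b} (α : f ⟶ g) (k : b ⟶ c)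
    {X Y : F.obj (op c)} (m : X ⟶ Y) :
    Arrow.mk (resMap F (α ▷ k) m) = Arrow.mk (resMap F α ((res F k).map m)) := by
  simp only [resMap]
  exact arrow_comp (res_comp_map F f k m) (res₂_whiskerRight F α k Y)

theorem resMap_resMap {a b c : C} {f g : a ⟶ b} {h k : b ⟶ c} (α : f ⟶ g) (β : h ⟶ k)
    {X Y : F.obj (op c)} (m : X ⟶ Y) :
    Arrow.mk (resMap F α (resMap F β m)) = Arrow.mk (resMap F (f ◁ β ≫ α ▷ k) m) := by
  rw [← Category.comp_id m, resMap_comp F (f ◁ β), Category.comp_id, resMap_id_right]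
  refine arrow_comp ?_ ?_
  · exact (resMap_whiskerLeft F f β m).symm
  · exact (res₂_whiskerRight F α k Y).symm

end ResMap

noncomputable section ColimAction

variable {G : TopTwoGroup.{u}} {F : StrictPseudofunctor (Orbit G)ᵒᵖ Cat.{u, u}}

open Orbit

/-- The object `[O, F(A)(X)]` depends only on `[U, X]` and `A`. -/
theorem colim_act_obj_eq {U U' O O' : Orbit G} {A : G.G₀} {a : O ⟶ U} {a' : O' ⟶ U'}
    (ha : Induces A a.functor) (ha' : Induces A a'.functor) {X : F.obj (op U)}
    {X' : F.obj (op U')} (h : (colimι F U).obj X = (colimι F U').obj X') :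
    (colimι F O).obj ((res F a).obj X) = (colimι F O').obj ((res F a').obj X') := by
  obtain ⟨V, i, i', hi, hi', h⟩ := colimι_obj_eq_iff.1 h
  obtain ⟨O₁, k, k', hk, hk'⟩ := exists_inf O O'
  obtain ⟨W, j, c, hj, hc⟩ := exists_induces A O₁ V
  rw [← colimι_res_obj (hj.comp hk), ← colimι_res_obj (hj.comp hk'), ← res_comp_obj,
    ← res_comp_obj, hom_ext_of_induces ((hj.comp hk).comp_induces ha) (Inc.induces_comp hc hi),
    hom_ext_of_induces ((hj.comp hk').comp_induces ha') (Inc.induces_comp hc hi'),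
    res_comp_obj, res_comp_obj, h]

/-- The arrow `[O, F(A)(m) ≫ F(g)_Y]` depends only on `[U, m]` and `g`. On a small enough `W` the
two 2-cells induced by `g` both restrict to one whose target is a common refinement `V` of `U` and
`U'`. -/
theorem colim_act_map_eq {U U' O O' : Orbit G} {g : G.G₁} {a b : O ⟶ U} {a' b' : O' ⟶ U'}
    {γ : a ⟶ b} {γ' : a' ⟶ b'} (hγ : Induces₂ g γ.trans) (hγ' : Induces₂ g γ'.trans)
    {X Y : F.obj (op U)} {X' Y' : F.obj (op U')} {m : X ⟶ Y} {m' : X' ⟶ Y'}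
    (h : Arrow.mk ((colimι F U).map m) = Arrow.mk ((colimι F U').map m')) :
    Arrow.mk ((colimι F O).map (resMap F γ m)) =
      Arrow.mk ((colimι F O').map (resMap F γ' m')) := by
  obtain ⟨V, i, i', hi, hi', h⟩ := colimι_map_eq_iff.1 h
  obtain ⟨O₁, k, k', hk, hk'⟩ := exists_inf O O'
  obtain ⟨W, j, c, d, δ, hj, hδ⟩ := exists_cell g O₁ V
  have e := arrow_ext_of_induces₂ ((hj.comp hk).whiskerLeft hγ) (Inc.whiskerRight hδ hi)
  have e' := arrow_ext_of_induces₂ ((hj.comp hk').whiskerLeft hγ') (Inc.whiskerRight hδ hi')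
  refine (colimι_res_map (hj.comp hk) _).symm.trans
    (Eq.trans ?_ (colimι_res_map (hj.comp hk') _))
  refine arrow_map _ ?_
  refine (resMap_whiskerLeft F _ γ m).symm.trans ?_
  refine Eq.trans ?_ (resMap_whiskerLeft F _ γ' m')
  refine (resMap_congr F e rfl).trans (Eq.trans ?_ (resMap_congr F e' rfl).symm)
  refine (resMap_whiskerRight F δ i m).trans (Eq.trans ?_ (resMap_whiskerRight F δ i' m').symm)
  exact resMap_congr F rfl h

theorem colim_act_obj_exists (x : Colim F) (A : G.G₀) : ∃ y : Colim F, ∀ {O U : Orbit G}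
    (a : O ⟶ U), Induces A a.functor → ∀ X : F.obj (op U), (colimι F U).obj X = x →
      y = (colimι F O).obj ((res F a).obj X) := by
  obtain ⟨U, X, rfl⟩ := colim_exists_obj x
  obtain ⟨O, i, a, -, ha⟩ := exists_induces A U U
  exact ⟨(colimι F O).obj ((res F a).obj X), fun b hb Y hY => colim_act_obj_eq ha hb hY.symm⟩

theorem colim_act_map_exists {x y : Colim F} (f : x ⟶ y) (g : G.G₁) :
    ∃ p : Arrow (Colim F), ∀ {O U : Orbit G} {a b : O ⟶ U} (γ : a ⟶ b), Induces₂ g γ.trans →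
      ∀ {X Y : F.obj (op U)} (m : X ⟶ Y), Arrow.mk ((colimι F U).map m) = Arrow.mk f →
        p = Arrow.mk ((colimι F O).map (resMap F γ m)) := by
  obtain ⟨U, X, Y, m, hm⟩ := colim_exists_map f
  obtain ⟨O, i, a, b, γ, -, hγ⟩ := exists_cell g U U
  exact ⟨Arrow.mk ((colimι F O).map (resMap F γ m)),
    fun {_ _ _ _} _ hδ {_ _} _ hn => colim_act_map_eq hγ hδ (hm.trans hn.symm)⟩

/-- The action of an object of `G` on an object of the colimit. -/
def colimActObj (x : Colim F) (A : G.G₀) : Colim F := (colim_act_obj_exists x A).choose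

/-- The action of an arrow of `G` on an arrow of the colimit. It takes values in `Arrow (Colim F)`
because its endpoints, chosen with a representative, agree with those given by `colimActObj` only
propositionally. -/
def colimActMap {x y : Colim F} (f : x ⟶ y) (g : G.G₁) : Arrow (Colim F) :=
  (colim_act_map_exists f g).choose

theorem colimActObj_eq {x : Colim F} {A : G.G₀} {O U : Orbit G} {a : O ⟶ U}
    (ha : Induces A a.functor) {X : F.obj (op U)} (h : (colimι F U).obj X = x) :
    colimActObj x A = (colimι F O).obj ((res F a).obj X) :=
  (colim_act_obj_exists x A).choose_spec a ha X h

theorem colimActMap_eq {x y : Colim F} {f : x ⟶ y} {g : G.G₁} {O U : Orbit G} {a b : O ⟶ U}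
    {γ : a ⟶ b} (hγ : Induces₂ g γ.trans) {X Y : F.obj (op U)} {m : X ⟶ Y}
    (h : Arrow.mk ((colimι F U).map m) = Arrow.mk f) :
    colimActMap f g = Arrow.mk ((colimι F O).map (resMap F γ m)) :=
  (colim_act_map_exists f g).choose_spec γ hγ m h

theorem colimActMap_congr {x y x' y' : Colim F} {f : x ⟶ y} {f' : x' ⟶ y'}
    (h : Arrow.mk f = Arrow.mk f') (g : G.G₁) : colimActMap f g = colimActMap f' g := by
  cases h; rfl

theorem colimActMap_left {x y : Colim F} (f : x ⟶ y) (g : G.G₁) :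
    (colimActMap f g).left = colimActObj x (G.dom g) := by
  obtain ⟨U, X, Y, m, hm⟩ := colim_exists_map f
  obtain ⟨O, i, a, b, γ, -, hγ⟩ := exists_cell g U U
  rw [colimActMap_eq hγ hm, colimActObj_eq hγ.dom (arrow_left hm)]; rfl

theorem colimActMap_right {x y : Colim F} (f : x ⟶ y) (g : G.G₁) :
    (colimActMap f g).right = colimActObj y (G.cod g) := by
  obtain ⟨U, X, Y, m, hm⟩ := colim_exists_map f
  obtain ⟨O, i, a, b, γ, -, hγ⟩ := exists_cell g U U
  rw [colimActMap_eq hγ hm, colimActObj_eq hγ.cod (arrow_right hm)]; rfl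

theorem colimActMap_id (x : Colim F) (A : G.G₀) :
    colimActMap (𝟙 x) (G.one A) = Arrow.mk (𝟙 (colimActObj x A)) := by
  obtain ⟨U, X, rfl⟩ := colim_exists_obj x
  obtain ⟨O, i, a, -, ha⟩ := exists_induces A U U
  have e : Induces₂ (G.one A) (Hom₂.trans (𝟙 a)) := Induces₂.id ha
  rw [colimActMap_eq e (m := 𝟙 X)
    (by rw [CategoryTheory.Functor.map_id]), resMap_id_id, CategoryTheory.Functor.map_id]
  exact arrow_id (colimActObj_eq ha rfl).symm

/-- Composable arrows of `G` induce composable 2-cells on small enough sub-2-groups. -/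
theorem exists_cell_comp {g g' : G.G₁} (w : G.cod g = G.dom g') (V U : Orbit G) :
    ∃ (W : Orbit G) (i : W ⟶ V) (a b c : W ⟶ U) (γ : a ⟶ b) (δ : b ⟶ c), Inc i ∧
      Induces₂ g γ.trans ∧ Induces₂ g' δ.trans := by
  obtain ⟨W, i, a, b, γ, hi, hγ⟩ := exists_cell g V U
  obtain ⟨W', j, b', c, δ, hj, hδ⟩ := exists_cell g' W U
  obtain rfl : j ≫ b = b' :=
    hom_ext_of_induces (hj.comp_induces hγ.cod) (by rw [w]; exact hδ.dom)
  exact ⟨W', j ≫ i, j ≫ a, j ≫ b, c, j ◁ γ, δ, hj.comp hi, hj.whiskerLeft hγ, hδ⟩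

theorem colimActMap_comp {x y z : Colim F} (f : x ⟶ y) (f' : y ⟶ z) {g g' : G.G₁}
    (w : G.cod g = G.dom g') {a b c : Colim F} (p : a ⟶ b) (q : b ⟶ c)
    (hp : Arrow.mk p = colimActMap f g) (hq : Arrow.mk q = colimActMap f' g') :
    Arrow.mk (p ≫ q) = colimActMap (f ≫ f') (G.comp' g g' w) := by
  obtain ⟨U, X, Y, Z, m, n, hm, hn⟩ := colim_exists_comp f f'
  obtain ⟨O, i, a, b, c, γ, δ, -, hγ, hδ⟩ := exists_cell_comp w U U
  have e : Induces₂ (G.comp' g g' w) (Hom₂.trans (γ ≫ δ)) := Induces₂.comp_of_eq w hγ hδ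
  rw [colimActMap_eq e (m := m ≫ n) (by rw [Functor.map_comp]; exact arrow_comp hm hn), resMap_comp,
    Functor.map_comp]
  exact arrow_comp (hp.trans (colimActMap_eq hγ hm)) (hq.trans (colimActMap_eq hδ hn))

variable (F) in
/-- The action functor on the colimit. -/
def colimAct : Colim F × G.G₀ ⥤ Colim F :=
  functorOfArrows (fun p => colimActObj p.1 p.2) (fun f => colimActMap f.1 f.2.1)
    (fun {p q} f => by rw [colimActMap_left, f.2.2.1]) (fun {p q} f => by
      rw [colimActMap_right, f.2.2.2])
    (fun p => colimActMap_id p.1 p.2)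
    (fun {a b c} f f' {x y z} p q hp hq =>
      colimActMap_comp f.1 f'.1 (f.2.2.2.trans f'.2.2.1.symm) p q hp hq)

theorem mk_colimAct_map {p q : Colim F × G.G₀} (f : p ⟶ q) :
    Arrow.mk ((colimAct F).map f) = colimActMap f.1 f.2.1 :=
  mk_functorOfArrows_map (arr := fun {p q : Colim F × G.G₀} (f : p ⟶ q) =>
    colimActMap f.1 f.2.1) f

theorem colimActMap_one {x y : Colim F} (f : x ⟶ y) : colimActMap f (1 : G.G₁) = Arrow.mk f := by
  obtain ⟨U, X, Y, m, hm⟩ := colim_exists_map f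
  have h : Induces₂ (1 : G.G₁) (Hom₂.trans (𝟙 (𝟙 U))) := by
    have := Induces₂.id (Induces.id U.sub)
    rwa [map_one] at this
  rw [colimActMap_eq h hm, resMap_id_left]
  exact (arrow_map _ (res_id_map F m)).trans hm

theorem colimActMap_mul {x y x' y' : Colim F} (f : x ⟶ y) (g h : G.G₁) (f' : x' ⟶ y')
    (hf' : Arrow.mk f' = colimActMap f g) : colimActMap f' h = colimActMap f (g * h) := by
  obtain ⟨U, X, Y, m, hm⟩ := colim_exists_map f
  obtain ⟨O, i, a, b, γ, -, hγ⟩ := exists_cell g U U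
  obtain ⟨N, j, c, d, δ, -, hδ⟩ := exists_cell h O O
  have hf := hf'.trans (colimActMap_eq hγ hm)
  rw [colimActMap_eq hδ hf.symm]
  -- By the interchange law, `g h` is the composite of `g 1` and `1 h`.
  have w : G.cod (g * G.one (G.dom h)) = G.dom (G.one (G.cod g) * h) := by
    rw [map_mul, map_mul, G.cod_one, G.dom_one]
  have e : Induces₂ (g * h) (Hom₂.trans (c ◁ γ ≫ δ ▷ b)) := by
    have := Induces₂.comp_of_eq w (Induces₂.whiskerLeft hδ.dom hγ)
      (Induces₂.whiskerRight hδ hγ.cod)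
    rw [G.comp'_mul _ _ _ _ (by rw [G.dom_one]) (by rw [G.cod_one]), G.comp'_one,
      G.one_comp'] at this
    exact this
  rw [colimActMap_eq e hm]
  exact arrow_map _ (resMap_resMap F δ γ m)

/-- The object `[U, X] · A` depends only on the coset `U₀ A`, which gives continuity. -/
theorem colimActObj_mul_left {U : Orbit G} (X : F.obj (op U)) (A : G.G₀) {u : G.G₀}
    (hu : u ∈ U.sub.U₀) :
    colimActObj ((colimι F U).obj X) (u * A) = colimActObj ((colimι F U).obj X) A := by
  obtain ⟨O, i, a, -, ha⟩ := exists_induces A U U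
  rw [colimActObj_eq ha rfl, colimActObj_eq (ha.mul_left hu) rfl]

/-- The arrow `[U, m] · g` depends only on the coset `U₁ g`, which gives continuity. -/
theorem colimActMap_mul_left {U : Orbit G} {X Y : F.obj (op U)} (m : X ⟶ Y) (g : G.G₁) {u : G.G₁}
    (hu : u ∈ U.sub.U₁) :
    colimActMap ((colimι F U).map m) (u * g) = colimActMap ((colimι F U).map m) g := by
  obtain ⟨O, i, a, b, γ, -, hγ⟩ := exists_cell g U U
  rw [colimActMap_eq hγ rfl, colimActMap_eq (hγ.mul_left hu) rfl]

variable (F) in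
/-- The filtered colimit of a 2-presheaf with its continuous action. -/
def psiObj : TwoAction G where
  carrier := Colim F
  act := colimAct F
  act_one := functor_ext_arrow fun f => by
    refine (mk_colimAct_map _).trans ?_
    exact (congrArg (colimActMap f) (map_one G.one)).trans (colimActMap_one f)
  act_mul := functor_ext_arrow fun f => by
    refine (mk_colimAct_map _).trans (Eq.trans ?_ (mk_colimAct_map _).symm)
    exact colimActMap_mul f.1.1 f.1.2.1 f.2.1 _ (mk_colimAct_map _)
  continuous_obj := by
    let _ : TopologicalSpace (Colim F) := ⊥
    have : DiscreteTopology (Colim F) := ⟨rfl⟩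
    refine continuous_prod_of_discrete_left.2 fun x => ?_
    obtain ⟨U, X, rfl⟩ := colim_exists_obj x
    exact OpenSub.continuous_mk U.sub.U₀ U.sub.isOpen₀ _ fun A u hu =>
      colimActObj_mul_left X A hu
  continuous_map := by
    let _ : TopologicalSpace (Arrow (Colim F)) := ⊥
    have : DiscreteTopology (Arrow (Colim F)) := ⟨rfl⟩
    refine continuous_prod_of_discrete_left.2 fun p => ?_
    obtain ⟨x, y, f⟩ := p
    obtain ⟨U, X, Y, m, hm⟩ := colim_exists_map f
    refine OpenSub.continuous_mk U.sub.U₁ U.sub.isOpen₁ _ fun g u hu => ?_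
    refine (mk_colimAct_map _).trans (Eq.trans ?_ (mk_colimAct_map _).symm)
    refine (colimActMap_congr hm.symm _).trans (Eq.trans ?_ (colimActMap_congr hm _))
    exact colimActMap_mul_left m g hu

variable (F) in
/-- The functor `X ↦ [U, X]` into the underlying category of the action. -/
abbrev psiι (U : Orbit G) : F.obj (op U) ⥤ (psiObj F).carrier := colimι F U

theorem aobj_psiι {O U : Orbit G} {a : O ⟶ U} {A : G.G₀} (ha : Induces A a.functor)
    (X : F.obj (op U)) :
    aobj ((psiι F U).obj X) A = (psiι F O).obj ((res F a).obj X) :=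
  colimActObj_eq ha rfl

theorem amap_psiι {O U : Orbit G} {a b : O ⟶ U} {γ : a ⟶ b} {g : G.G₁} (hγ : Induces₂ g γ.trans)
    {X Y : F.obj (op U)} (m : X ⟶ Y) :
    Arrow.mk (amap ((psiι F U).map m) g) = Arrow.mk ((psiι F O).map (resMap F γ m)) :=
  (mk_colimAct_map _).trans (colimActMap_eq hγ rfl)

end ColimAction

/-! ### The 2-functor `Ψ` -/

theorem comp₁_resMap {C : Type u₁} [Bicategory.{w₁, v₁} C] [Bicategory.Strict C]
    {F F' : StrictPseudofunctor Cᵒᵖ Cat.{v₂, u₂}} (θ : F ⟶ F') {a b : C} {f g : a ⟶ b}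
    (α : f ⟶ g) {X Y : F.obj (op b)} (m : X ⟶ Y) :
    Arrow.mk ((comp₁ θ a).map (resMap F α m)) =
      Arrow.mk (resMap F' α ((comp₁ θ b).map m)) := by
  simp only [resMap, Functor.map_comp]
  exact arrow_comp (comp₁_res_map θ f m) (comp₁_res₂ θ α Y)

noncomputable section Psi

variable {G : TopTwoGroup.{u}} {F F' F'' : StrictPseudofunctor (Orbit G)ᵒᵖ Cat.{u, u}}

open Orbit

theorem psi_functor_exists (θ : F ⟶ F') : ∃ L : Colim F ⥤ Colim F', ∀ U,
    colimι F U ⋙ L = comp₁ θ U ⋙ colimι F' U :=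
  colim_exists_desc (fun U => comp₁ θ U ⋙ colimι F' U) fun {V U i} hi => by
    rw [← Functor.assoc, comp₁_res, Functor.assoc, colimι_res hi]

/-- The functor between colimits induced by a 2-natural transformation. -/
def psiFunctor (θ : F ⟶ F') : (psiObj F).carrier ⥤ (psiObj F').carrier :=
  (psi_functor_exists θ).choose

theorem psiι_psiFunctor (θ : F ⟶ F') (U : Orbit G) :
    psiι F U ⋙ psiFunctor θ = comp₁ θ U ⋙ psiι F' U :=
  (psi_functor_exists θ).choose_spec U

theorem psiFunctor_obj (θ : F ⟶ F') {U : Orbit G} (X : F.obj (op U)) :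
    (psiFunctor θ).obj ((psiι F U).obj X) = (psiι F' U).obj ((comp₁ θ U).obj X) :=
  Functor.congr_obj (psiι_psiFunctor θ U) X

theorem psiFunctor_map (θ : F ⟶ F') {U : Orbit G} {X Y : F.obj (op U)} (m : X ⟶ Y) :
    Arrow.mk ((psiFunctor θ).map ((psiι F U).map m)) =
      Arrow.mk ((psiι F' U).map ((comp₁ θ U).map m)) :=
  arrow_functor (psiι_psiFunctor θ U) m

/-- The equivariant functor between colimits induced by a 2-natural transformation. -/
def psiMap (θ : F ⟶ F') : psiObj F ⟶ psiObj F' :=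
  equivOf (psiFunctor θ) fun {x y} f g => by
    obtain ⟨U, X, Y, m, hm⟩ := colim_exists_map f
    obtain rfl := arrow_left hm
    obtain rfl := arrow_right hm
    obtain rfl := arrow_eq hm
    obtain ⟨O, i, a, b, γ, -, hγ⟩ := exists_cell g U U
    refine (arrow_map _ (amap_psiι hγ m)).trans ?_
    refine (psiFunctor_map θ _).trans ?_
    refine (arrow_map _ (comp₁_resMap θ γ m)).trans ?_
    refine (amap_psiι hγ _).symm.trans ?_
    exact amap_congr (psiFunctor_map θ m).symm rfl

theorem psi_nat_exists {θ κ : F ⟶ F'} (μ : θ ⟶ κ) :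
    ∃ β : psiFunctor θ ⟶ psiFunctor κ, ∀ (U : Orbit G) (X : F.obj (op U)),
      Arrow.mk (β.app ((psiι F U).obj X)) = Arrow.mk ((psiι F' U).map ((comp₂ μ U).app X)) :=
  colim_exists_nat (psiι_psiFunctor θ) (psiι_psiFunctor κ)
    (fun U => Functor.whiskerRight (comp₂ μ U) (colimι F' U)) fun {V U i} hi X => by
      simp only [Functor.whiskerRight_app]
      exact (arrow_map _ (comp₂_res μ i X)).trans (colimι_res_map hi _)

/-- The 2-cell between colimits induced by a modification. -/
def psiMap₂ {θ κ : F ⟶ F'} (μ : θ ⟶ κ) : psiMap θ ⟶ psiMap κ :=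
  equivNatOf (psi_nat_exists μ).choose fun x A => by
    have h := (psi_nat_exists μ).choose_spec
    obtain ⟨U, X, rfl⟩ := colim_exists_obj x
    obtain ⟨O, i, a, -, ha⟩ := exists_induces A U U
    have e : Induces₂ (G.one A) (Hom₂.trans (𝟙 a)) := Induces₂.id ha
    refine (arrow_app _ (aobj_psiι ha X)).trans ((h O _).trans ?_)
    refine (arrow_map _ (comp₂_res μ a X)).trans ?_
    refine Eq.trans ?_ (amap_congr (h U X).symm rfl)
    refine Eq.trans ?_ (amap_psiι e _).symm
    rw [resMap_id_left]

theorem psiMap₂_app {θ κ : F ⟶ F'} (μ : θ ⟶ κ) {U : Orbit G} (X : F.obj (op U)) :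
    Arrow.mk ((psiMap₂ μ).natTrans.app ((psiι F U).obj X)) =
      Arrow.mk ((psiι F' U).map ((comp₂ μ U).app X)) :=
  (psi_nat_exists μ).choose_spec U X

theorem psi_hom_ext {X : TwoAction G} {H K : psiObj F ⟶ X}
    (h : ∀ U, psiι F U ⋙ H.functor = psiι F U ⋙ K.functor) : H = K :=
  equiv_ext (colim_functor_ext h)

theorem psi_hom₂_ext {X : TwoAction G} {H K H' K' : psiObj F ⟶ X} {α : H ⟶ K} {β : H' ⟶ K'}
    (hH : H = H') (hK : K = K')
    (h : ∀ (U : Orbit G) (X : F.obj (op U)), Arrow.mk (α.natTrans.app ((psiι F U).obj X)) =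
      Arrow.mk (β.natTrans.app ((psiι F U).obj X))) : Arrow.mk α = Arrow.mk β := by
  subst hH; subst hK
  refine congrArg Arrow.mk (TwoAction.hom₂_ext fun x => ?_)
  obtain ⟨U, X, rfl⟩ := colim_exists_obj x
  exact arrow_eq (h U X)

theorem conj_of_arrow {D : Type u₁} [Category.{v₁} D] {a b a' b' : D} {f : a ⟶ b} {g : a' ⟶ b'}
    (ha : a = a') (hb : b = b') (h : Arrow.mk f = Arrow.mk g) :
    f = eqToHom ha ≫ g ≫ eqToHom hb.symm := by
  subst ha; subst hb; simpa using arrow_eq h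

theorem psiMap_id (F : StrictPseudofunctor (Orbit G)ᵒᵖ Cat.{u, u}) :
    psiMap (𝟙 F) = 𝟙 (psiObj F) :=
  psi_hom_ext fun U => psiι_psiFunctor (𝟙 F) U

theorem psiMap_comp (θ : F ⟶ F') (κ : F' ⟶ F'') : psiMap (θ ≫ κ) = psiMap θ ≫ psiMap κ :=
  psi_hom_ext fun U => (psiι_psiFunctor (θ ≫ κ) U).trans <| by
    refine Eq.trans ?_ (congrArg (· ⋙ psiFunctor κ) (psiι_psiFunctor θ U)).symm
    exact (congrArg (comp₁ θ U ⋙ ·) (psiι_psiFunctor κ U)).symm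

variable (G) in
/-- The 2-functor from 2-presheaves to continuous actions that sends a 2-presheaf to its filtered
colimit over the open sub-2-groups. -/
def psi : StrictPseudofunctor (StrictPseudofunctor (Orbit G)ᵒᵖ Cat.{u, u}) (TwoAction G) :=
  StrictPseudofunctor.mk''
    { obj := fun F => psiObj F
      map := fun θ => psiMap θ
      map₂ := fun μ => psiMap₂ μ
      map₂_id := fun {F F'} θ => arrow_eq <| psi_hom₂_ext rfl rfl fun U X => by
        refine (psiMap₂_app (𝟙 θ) X).trans ?_
        refine (congrArg Arrow.mk ((psiι F' U).map_id _)).trans ?_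
        exact arrow_id (psiFunctor_obj θ X).symm
      map₂_comp := fun {F F' θ κ ι} μ ν => arrow_eq <| psi_hom₂_ext rfl rfl fun U X => by
        refine (psiMap₂_app (μ ≫ ν) X).trans ?_
        refine (congrArg Arrow.mk ((psiι F' U).map_comp _ _)).trans ?_
        exact arrow_comp (psiMap₂_app μ X).symm (psiMap₂_app ν X).symm
      map_id := fun F => psiMap_id F
      map_comp := fun θ κ => psiMap_comp θ κ
      map₂_whisker_left := fun {F F' F''} θ {κ ι} μ =>
        conj_of_arrow (psiMap_comp θ κ) (psiMap_comp θ ι) <|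
          psi_hom₂_ext (psiMap_comp θ κ) (psiMap_comp θ ι) fun U X => by
          refine (psiMap₂_app (θ ◁ μ) X).trans ?_
          refine (psiMap₂_app μ ((comp₁ θ U).obj X)).symm.trans ?_
          exact arrow_app (psiMap₂ μ).natTrans (psiFunctor_obj θ X).symm
      map₂_whisker_right := fun {F F' F'' θ κ} μ ι =>
        conj_of_arrow (psiMap_comp θ ι) (psiMap_comp κ ι) <|
          psi_hom₂_ext (psiMap_comp θ ι) (psiMap_comp κ ι) fun U X => by
          refine (psiMap₂_app (μ ▷ ι) X).trans ?_
          refine (psiFunctor_map ι ((comp₂ μ U).app X)).symm.trans ?_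
          exact arrow_map (psiFunctor ι) (psiMap₂_app μ X).symm }

variable (G) in
/-- The description of `psi` as a filtered colimit. -/
def psiPresentation : ColimitPresentation (psi G) where
  ι F U := psiι F U
  restrict _ _ _ _ ha := colimι_res ha
  exists_obj _ x := colim_exists_obj x
  exists_map _ _ _ f := colim_exists_map f
  obj_eq_iff _ _ _ _ _ := colimι_obj_eq_iff
  map_eq_iff _ _ _ _ _ _ _ _ _ := colimι_map_eq_iff
  act_obj _ _ _ _ _ ha X := aobj_psiι ha X
  act_map _ _ _ _ _ _ _ hγ _ _ m := amap_psiι hγ m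
  map θ U := psiι_psiFunctor θ U
  map₂ m _ X := psiMap₂_app m X

end Psi

/-! ### The Yoneda lemma and generated sieves -/

section Sieves

variable {C : Type u} [Bicategory.{u, u} C] [Bicategory.Strict C]

/-- A 2-presheaf from its categories of sections and its restriction functors. -/
def presheafOf (obj : C → Type u) [∀ a, SmallCategory (obj a)]
    (r : ∀ {a b : C}, (a ⟶ b) → obj b ⥤ obj a)
    (r₂ : ∀ {a b : C} {f g : a ⟶ b}, (f ⟶ g) → (r f ⟶ r g))
    (hid : ∀ a, r (𝟙 a) = 𝟭 (obj a))
    (hcomp : ∀ {a b c : C} (f : a ⟶ b) (g : b ⟶ c), r (f ≫ g) = r g ⋙ r f)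
    (hid₂ : ∀ {a b : C} (f : a ⟶ b), r₂ (𝟙 f) = 𝟙 (r f))
    (hcomp₂ : ∀ {a b : C} {f g h : a ⟶ b} (α : f ⟶ g) (β : g ⟶ h), r₂ (α ≫ β) = r₂ α ≫ r₂ β)
    (hl : ∀ {a b c : C} (h : a ⟶ b) {f g : b ⟶ c} (α : f ⟶ g) (X : obj c),
      Arrow.mk ((r₂ (h ◁ α)).app X) = Arrow.mk ((r h).map ((r₂ α).app X)))
    (hr : ∀ {a b c : C} {f g : a ⟶ b} (α : f ⟶ g) (k : b ⟶ c) (X : obj c),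
      Arrow.mk ((r₂ (α ▷ k)).app X) = Arrow.mk ((r₂ α).app ((r k).obj X))) :
    StrictPseudofunctor Cᵒᵖ Cat.{u, u} :=
  StrictPseudofunctor.mk''
    { obj := fun a => Cat.of (obj a.unop)
      map := fun f => (r f.unop).toCatHom
      map₂ := fun α => (r₂ α.unop2).toCatHom₂
      map₂_id := fun f => congrArg NatTrans.toCatHom₂ (hid₂ f.unop)
      map₂_comp := fun α β => congrArg NatTrans.toCatHom₂ (hcomp₂ α.unop2 β.unop2)
      map_id := fun a => congrArg Functor.toCatHom (hid a.unop)
      map_comp := fun f g => congrArg Functor.toCatHom (hcomp g.unop f.unop)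
      map₂_whisker_left := fun f _ _ α =>
        cat_conj (congrArg Functor.toCatHom (hcomp _ f.unop))
          (congrArg Functor.toCatHom (hcomp _ f.unop)) _ _ fun x =>
          heq_of_arrow (hr α.unop2 f.unop x)
      map₂_whisker_right := fun α f =>
        cat_conj (congrArg Functor.toCatHom (hcomp f.unop _))
          (congrArg Functor.toCatHom (hcomp f.unop _)) _ _ fun x =>
          heq_of_arrow (hl f.unop α.unop2 x) }

section Yoneda

variable {c : C} {F : StrictPseudofunctor Cᵒᵖ Cat.{u, u}}

theorem yo_obj (θ : yo c ⟶ F) {b : C} (h : b ⟶ c) :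
    (comp₁ θ b).obj h = (res F h).obj ((comp₁ θ c).obj (𝟙 c)) :=
  (congrArg (comp₁ θ b).obj (Strict.comp_id h).symm).trans (comp₁_res_obj θ h (𝟙 c))

theorem yo_app {θ κ : yo c ⟶ F} (μ : θ ⟶ κ) {b : C} (h : b ⟶ c) :
    Arrow.mk ((comp₂ μ b).app h) = Arrow.mk ((res F h).map ((comp₂ μ c).app (𝟙 c))) :=
  (arrow_app (comp₂ μ b) (Strict.comp_id h).symm).trans (comp₂_res μ h (𝟙 c))

theorem yo_map (θ : yo c ⟶ F) {b : C} {h k : b ⟶ c} (α : h ⟶ k) :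
    Arrow.mk ((comp₁ θ b).map (X := h) (Y := k) α) =
      Arrow.mk ((res₂ F α).app ((comp₁ θ c).obj (𝟙 c))) := by
  refine Eq.trans ?_ (comp₁_res₂ θ α (𝟙 c))
  refine arrow_map (comp₁ θ b) (D := b ⟶ c) ?_
  exact (arrow_of_heq (Strict.comp_id h) (Strict.comp_id k) (heq_whiskerRight_id α)).symm

/-- A 2-natural transformation out of a representable 2-presheaf is determined by its value at the
identity. -/
theorem yo_ext {θ κ : yo c ⟶ F} (h : (comp₁ θ c).obj (𝟙 c) = (comp₁ κ c).obj (𝟙 c)) : θ = κ :=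
  nat_ext fun b => functor_ext_arrow (D := b ⟶ c) fun α => by
    rw [yo_map, yo_map, h]

/-- The 2-natural transformation out of a representable 2-presheaf given by a section. -/
def yoMap (X : F.obj (op c)) : yo c ⟶ F :=
  natOf (F := yo c) (fun b =>
    { obj := fun h => (res F (show b ⟶ c from h)).obj X
      map := fun {h k} α => (res₂ F (f := h) (g := k) α).app X
      map_id := fun h => by
        have := res₂_id F (f := h)
        exact congrArg (fun t => t.app X) this
      map_comp := fun {h k l} α β => by
        have := res₂_comp F (f := h) (g := k) (h := l) α β
        exact congrArg (fun t => t.app X) this })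
    (fun {_ b} f => functor_ext_arrow (D := b ⟶ c) fun α => res₂_whiskerLeft F f α X)
    (fun {a b f g} α k => res₂_whiskerRight F α k X)

theorem yoMap_id (X : F.obj (op c)) : (comp₁ (yoMap X) c).obj (𝟙 c) = X := res_id_obj F X

/-- The modification between 2-natural transformations out of a representable 2-presheaf given by
an arrow between sections. -/
def yoMap₂ {X Y : F.obj (op c)} (m : X ⟶ Y) : yoMap X ⟶ yoMap Y :=
  modOf (fun b =>
    { app := fun h => (res F (show b ⟶ c from h)).map m
      naturality := fun h k α => ((res₂ F (f := h) (g := k) α).naturality m).symm })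
    fun {_ b} f h => res_comp_map F f (show b ⟶ c from h) m

theorem yoMap₂_id {X Y : F.obj (op c)} (m : X ⟶ Y) :
    Arrow.mk ((comp₂ (yoMap₂ m) c).app (𝟙 c)) = Arrow.mk m := res_id_map F m

theorem yo_mod_ext {θ κ : yo c ⟶ F} {μ ν : θ ⟶ κ}
    (h : (comp₂ μ c).app (𝟙 c) = (comp₂ ν c).app (𝟙 c)) : μ = ν :=
  modification_ext fun b k => arrow_eq <| by
    have e : k = (res (yo c) (show b ⟶ c from k)).obj (𝟙 c) :=
      (Strict.comp_id (show b ⟶ c from k)).symm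
    refine (arrow_app _ e).trans ((comp₂_res μ _ (𝟙 c)).trans ?_)
    rw [h]
    exact (comp₂_res ν _ (𝟙 c)).symm.trans (arrow_app _ e.symm)

/-- The 2-dimensional Yoneda lemma, on modifications: any arrow between the values at the identity
extends. -/
theorem yo_mod_exists {θ κ : yo c ⟶ F} {X Y : F.obj (op c)} (m : X ⟶ Y)
    (hθ : (comp₁ θ c).obj (𝟙 c) = X) (hκ : (comp₁ κ c).obj (𝟙 c) = Y) :
    ∃ μ : θ ⟶ κ, Arrow.mk ((comp₂ μ c).app (𝟙 c)) = Arrow.mk m := by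
  obtain rfl : θ = yoMap X := yo_ext (hθ.trans (yoMap_id X).symm)
  obtain rfl : κ = yoMap Y := yo_ext (hκ.trans (yoMap_id Y).symm)
  exact ⟨yoMap₂ m, yoMap₂_id m⟩

end Yoneda

/-! ### 2-sheaves -/

section Generated

variable {c d : C} {S : TwoSieve c} {f : d ⟶ c} {F : StrictPseudofunctor Cᵒᵖ Cat.{u, u}}

theorem TwoSieve.isEmb (S : TwoSieve c) (b : C) : IsEmb (comp₁ S.ι b) :=
  .of_injective_faithful (S.injective_obj (op b)) (S.faithful (op b))

namespace TwoSieve.IsGeneratedBy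

theorem exists_gen (hS : S.IsGeneratedBy f) :
    ∃ s₀ : S.dom.obj (op d), (comp₁ S.ι d).obj s₀ = f :=
  (hS.obj_iff d f).2 ⟨𝟙 d, Strict.id_comp f⟩

variable {s₀ : S.dom.obj (op d)}

theorem ι_res (h₀ : (comp₁ S.ι d).obj s₀ = f) {b : C} (k : b ⟶ d) :
    (comp₁ S.ι b).obj ((res S.dom k).obj s₀) = k ≫ f := by
  rw [comp₁_res_obj, h₀]; rfl

theorem ι_res₂ (h₀ : (comp₁ S.ι d).obj s₀ = f) {b : C} {k l : b ⟶ d} (β : k ⟶ l) :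
    Arrow.mk ((comp₁ S.ι b).map ((res₂ S.dom β).app s₀)) =
      Arrow.mk (T := b ⟶ c) (β ▷ f) := by
  rw [comp₁_res₂, h₀]; rfl

/-- Every object of a generated sieve is a restriction of the generating object. -/
theorem exists_res (hS : S.IsGeneratedBy f) (h₀ : (comp₁ S.ι d).obj s₀ = f) {b : C}
    (s : S.dom.obj (op b)) : ∃ k : b ⟶ d, (res S.dom k).obj s₀ = s := by
  obtain ⟨k, hk⟩ := (hS.obj_iff b _).1 ⟨s, rfl⟩
  exact ⟨k, (S.isEmb b).obj ((ι_res h₀ k).trans hk)⟩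

theorem _root_.TwoElmendorf.FactorsThrough.exists_right {b : C} {g h : b ⟶ c} {α : g ⟶ h}
    (hα : FactorsThrough f α) : ∃ k : b ⟶ d, k ≫ f = h := by
  induction hα with
  | whisker β => exact ⟨_, rfl⟩
  | comp _ _ _ h => exact h

/-- The arrows of a sieve generated by `f` are generated under composition by the restrictions of
the generating object along 2-cells. -/
theorem induction_on (hS : S.IsGeneratedBy f) (h₀ : (comp₁ S.ι d).obj s₀ = f) {b : C}
    (P : Arrow (S.dom.obj (op b)) → Prop)
    (h₁ : ∀ {k l : b ⟶ d} (β : k ⟶ l), P (Arrow.mk ((res₂ S.dom β).app s₀)))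
    (h₂ : ∀ {s t r : S.dom.obj (op b)} (φ : s ⟶ t) (ψ : t ⟶ r), P (Arrow.mk φ) →
      P (Arrow.mk ψ) → P (Arrow.mk (φ ≫ ψ))) {s t : S.dom.obj (op b)} (φ : s ⟶ t) :
    P (Arrow.mk φ) := by
  have key {g h : b ⟶ c} {α : g ⟶ h} (hα : FactorsThrough f α) :
      ∀ {s t : S.dom.obj (op b)} (φ : s ⟶ t),
        Arrow.mk ((comp₁ S.ι b).map φ) = Arrow.mk (T := b ⟶ c) α → P (Arrow.mk φ) := by
    induction hα with
    | whisker β =>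
      intro s t φ hφ
      rw [(S.isEmb b).arrow φ _ (hφ.trans (ι_res₂ h₀ β).symm)]
      exact h₁ β
    | @comp g h i α β hα hβ ih₁ ih₂ =>
      intro s t φ hφ
      obtain rfl : (show b ⟶ c from (comp₁ S.ι b).obj s) = g := arrow_left hφ
      obtain rfl : (show b ⟶ c from (comp₁ S.ι b).obj t) = i := arrow_right hφ
      obtain ⟨r, rfl⟩ := (hS.obj_iff b h).2 hα.exists_right
      obtain ⟨φ₁, rfl⟩ := (hS.map_iff b s r α).2 hα
      obtain ⟨φ₂, rfl⟩ := (hS.map_iff b r t β).2 hβ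
      have e : φ = φ₁ ≫ φ₂ := arrow_eq ((S.isEmb b).arrow _ _ (hφ.trans
        (congrArg Arrow.mk ((comp₁ S.ι b).map_comp φ₁ φ₂).symm)))
      rw [e]
      exact h₂ φ₁ φ₂ (ih₁ φ₁ rfl) (ih₂ φ₂ rfl)
  exact key ((hS.map_iff b s t _).1 ⟨φ, rfl⟩) φ rfl

theorem nat_ext (hS : S.IsGeneratedBy f) (h₀ : (comp₁ S.ι d).obj s₀ = f) {τ τ' : S.dom ⟶ F}
    (h : (comp₁ τ d).obj s₀ = (comp₁ τ' d).obj s₀) : τ = τ' :=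
  TwoElmendorf.nat_ext fun b => functor_ext_arrow fun φ => by
    refine hS.induction_on h₀ (fun p => Arrow.mk ((comp₁ τ b).map p.hom) =
      Arrow.mk ((comp₁ τ' b).map p.hom)) (fun β => ?_) (fun φ ψ hφ hψ => ?_) φ
    · refine (comp₁_res₂ τ β s₀).trans (Eq.trans ?_ (comp₁_res₂ τ' β s₀).symm)
      rw [h]
    · change Arrow.mk ((comp₁ τ b).map (φ ≫ ψ)) = Arrow.mk ((comp₁ τ' b).map (φ ≫ ψ))
      rw [Functor.map_comp, Functor.map_comp]
      exact arrow_comp hφ hψ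

theorem mod_ext (hS : S.IsGeneratedBy f) (h₀ : (comp₁ S.ι d).obj s₀ = f) {τ τ' : S.dom ⟶ F}
    {μ ν : τ ⟶ τ'} (h : (comp₂ μ d).app s₀ = (comp₂ ν d).app s₀) : μ = ν :=
  modification_ext fun b s => by
    obtain ⟨k, rfl⟩ := hS.exists_res h₀ s
    refine arrow_eq ((comp₂_res μ k s₀).trans ?_)
    rw [h]
    exact (comp₂_res ν k s₀).symm

end TwoSieve.IsGeneratedBy

/-- A 2-presheaf is a 2-sheaf if composition with each covering sieve is bijective on 2-natural
transformations and on modifications. -/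
theorem isTwoSheaf_of (J : ∀ c : C, Set (TwoSieve c))
    (h₁ : ∀ (c : C), ∀ S ∈ J c, ∀ θ κ : yo c ⟶ F, S.ι ≫ θ = S.ι ≫ κ → θ = κ)
    (h₂ : ∀ (c : C), ∀ S ∈ J c, ∀ (θ κ : yo c ⟶ F) (μ ν : θ ⟶ κ), S.ι ◁ μ = S.ι ◁ ν → μ = ν)
    (h₃ : ∀ (c : C), ∀ S ∈ J c, ∀ τ : S.dom ⟶ F, ∃ θ : yo c ⟶ F, S.ι ≫ θ = τ)
    (h₄ : ∀ (c : C), ∀ S ∈ J c, ∀ (θ κ : yo c ⟶ F) (ν : S.ι ≫ θ ⟶ S.ι ≫ κ),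
      ∃ μ : θ ⟶ κ, S.ι ◁ μ = ν) : IsTwoSheaf J F := by
  intro c S hS
  have hE : IsEmb (precomp F S.ι) :=
    .of_injective_faithful (h₁ c S hS) ⟨fun {θ κ μ ν} h => h₂ c S hS θ κ μ ν h⟩
  refine hE.exists_inverse fun {x y} p => ?_
  obtain ⟨θ, rfl⟩ := h₃ c S hS x
  obtain ⟨κ, rfl⟩ := h₃ c S hS y
  obtain ⟨μ, rfl⟩ := h₄ c S hS θ κ p
  exact ⟨θ, κ, μ, rfl⟩

section OfSheaf

variable {J : ∀ c : C, Set (TwoSieve c)}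

theorem sheaf_hom_ext (hF : IsTwoSheaf J F) (hS : S ∈ J c) {θ κ : yo c ⟶ F}
    (h : S.ι ≫ θ = S.ι ≫ κ) : θ = κ := by
  obtain ⟨K, h₁, -⟩ := hF c S hS
  have e (θ : yo c ⟶ F) : K.obj (S.ι ≫ θ) = θ := Functor.congr_obj h₁ θ
  rw [← e θ, h, e]

theorem sheaf_mod_ext (hF : IsTwoSheaf J F) (hS : S ∈ J c) {θ κ : yo c ⟶ F}
    {μ ν : θ ⟶ κ} (h : S.ι ◁ μ = S.ι ◁ ν) : μ = ν := by
  obtain ⟨K, h₁, -⟩ := hF c S hS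
  have e (μ : θ ⟶ κ) : Arrow.mk (K.map (S.ι ◁ μ)) = Arrow.mk μ := arrow_functor h₁ μ
  exact arrow_eq (by rw [← e μ, h, e])

theorem sheaf_exists_hom (hF : IsTwoSheaf J F) (hS : S ∈ J c) (τ : S.dom ⟶ F) :
    ∃ θ : yo c ⟶ F, S.ι ≫ θ = τ := by
  obtain ⟨K, -, h₂⟩ := hF c S hS
  exact ⟨K.obj τ, Functor.congr_obj h₂ τ⟩

theorem sheaf_exists_mod (hF : IsTwoSheaf J F) (hS : S ∈ J c) {θ κ : yo c ⟶ F}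
    (ν : S.ι ≫ θ ⟶ S.ι ≫ κ) :
    ∃ μ : θ ⟶ κ, S.ι ◁ μ = ν := by
  obtain ⟨K, h₁, h₂⟩ := hF c S hS
  have e (θ : yo c ⟶ F) : K.obj (S.ι ≫ θ) = θ := Functor.congr_obj h₁ θ
  let p := K.map ν
  have hp : Arrow.mk (S.ι ◁ p) = Arrow.mk ν := arrow_functor h₂ ν
  refine ⟨arrowHom (Arrow.mk p) (e θ) (e κ), arrow_eq ?_⟩
  refine Eq.trans ?_ hp
  exact arrow_map (precomp F S.ι) (mk_arrowHom _ _ _)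

end OfSheaf

end Generated

/-! ### The sieve generated by an arrow -/

section GenSieve

variable {c d : C} (f : d ⟶ c)

theorem FactorsThrough.congr {f : d ⟶ c} {b : C} {g h g' h' : b ⟶ c} {α : g ⟶ h} {β : g' ⟶ h'}
    (hα : FactorsThrough f α) (w : Arrow.mk α = Arrow.mk β) : FactorsThrough f β := by
  cases w; exact hα

theorem FactorsThrough.whiskerLeft {f : d ⟶ c} {a b : C} (k : a ⟶ b) {g h : b ⟶ c} {α : g ⟶ h}
    (hα : FactorsThrough f α) : FactorsThrough f (k ◁ α) := by
  induction hα with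
  | whisker β =>
    exact (FactorsThrough.whisker (f := f) (k ◁ β)).congr
      (arrow_of_heq (Strict.assoc _ _ _) (Strict.assoc _ _ _) (heq_whisker_assoc k β f))
  | comp _ _ h₁ h₂ => rw [whiskerLeft_comp]; exact h₁.comp h₂

theorem FactorsThrough.id {f : d ⟶ c} {b : C} {g : b ⟶ c} (h : ∃ k : b ⟶ d, k ≫ f = g) :
    FactorsThrough f (𝟙 g) := by
  obtain ⟨k, rfl⟩ := h
  have := FactorsThrough.whisker (f := f) (𝟙 k)
  rwa [id_whiskerRight] at this

theorem FactorsThrough.whiskerRight {f : d ⟶ c} {a b : C} {k l : a ⟶ b} (β : k ⟶ l) {g : b ⟶ c}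
    (h : ∃ k : b ⟶ d, k ≫ f = g) : FactorsThrough f (β ▷ g) := by
  obtain ⟨p, rfl⟩ := h
  exact (FactorsThrough.whisker (f := f) (β ▷ p)).congr (arrow_of_heq (Strict.assoc _ _ _)
    (Strict.assoc _ _ _) (heq_whiskerRight_comp β p f).symm)

/-- The arrows `b ⟶ c` that factor through `f`. -/
def GenObj (b : C) : Type u := {g : b ⟶ c // ∃ k : b ⟶ d, k ≫ f = g}

/-- The 2-cells between arrows that factor through `f` are the vertical composites of 2-cells `β ▷ f`. -/
instance (b : C) : SmallCategory (GenObj f b) where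
  Hom s t := {α : s.1 ⟶ t.1 // FactorsThrough f α}
  id s := ⟨𝟙 s.1, .id s.2⟩
  comp α β := ⟨α.1 ≫ β.1, α.2.comp β.2⟩
  id_comp α := Subtype.ext (Category.id_comp α.1)
  comp_id α := Subtype.ext (Category.comp_id α.1)
  assoc α β γ := Subtype.ext (Category.assoc α.1 β.1 γ.1)

theorem genObj_arrow {b : C} {s t s' t' : GenObj f b} {α : s ⟶ t} {β : s' ⟶ t'}
    (h : Arrow.mk α.1 = Arrow.mk β.1) : Arrow.mk α = Arrow.mk β := by
  obtain rfl : s = s' := Subtype.ext (arrow_left h)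
  obtain rfl : t = t' := Subtype.ext (arrow_right h)
  exact congrArg Arrow.mk (Subtype.ext (arrow_eq h))

/-- Precomposition with an arrow, on the arrows that factor through `f`. -/
def genRes {a b : C} (h : a ⟶ b) : GenObj f b ⥤ GenObj f a where
  obj g := ⟨h ≫ g.1, by
    obtain ⟨g, k, rfl⟩ := g
    exact ⟨h ≫ k, Strict.assoc _ _ _⟩⟩
  map α := ⟨h ◁ α.1, α.2.whiskerLeft h⟩
  map_id g := Subtype.ext (whiskerLeft_id h g.1)
  map_comp α β := Subtype.ext (whiskerLeft_comp h α.1 β.1)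

/-- Precomposition with a 2-cell, on the arrows that factor through `f`. -/
def genRes₂ {a b : C} {h k : a ⟶ b} (β : h ⟶ k) : genRes f h ⟶ genRes f k where
  app g := ⟨β ▷ g.1, .whiskerRight β g.2⟩
  naturality _ _ α := Subtype.ext (whisker_exchange β α.1)

/-- The sieve generated by an arrow. -/
def genSieve : TwoSieve c where
  dom := presheafOf (GenObj f) (genRes f) (genRes₂ f)
    (fun _ => functor_ext_arrow fun α => genObj_arrow f <|
      arrow_of_heq (Strict.id_comp _) (Strict.id_comp _) (heq_id_whiskerLeft α.1))
    (fun h k => functor_ext_arrow fun α => genObj_arrow f <|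
      arrow_of_heq (Strict.assoc _ _ _) (Strict.assoc _ _ _) (heq_comp_whiskerLeft h k α.1))
    (fun h => NatTrans.ext <| funext fun g => Subtype.ext (id_whiskerRight h g.1))
    (fun α β => NatTrans.ext <| funext fun g => Subtype.ext (comp_whiskerRight α β g.1))
    (fun {_ _ _} h {_ _} α X => genObj_arrow f <|
      arrow_of_heq (Strict.assoc _ _ _) (Strict.assoc _ _ _) (heq_whisker_assoc h α X.1))
    (fun {_ _ _ _ _} α k X => genObj_arrow f <|
      arrow_of_heq (Strict.assoc _ _ _) (Strict.assoc _ _ _) (heq_whiskerRight_comp α k X.1).symm)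
  ι := natOf (F' := yo c)
    (fun _ =>
      { obj := fun g => g.1
        map := fun α => α.1
        map_id := fun _ => rfl
        map_comp := fun _ _ => rfl })
    (fun _ => rfl)
    (fun _ _ => rfl)
  injective_obj _ := Subtype.val_injective
  faithful _ := ⟨fun h => Subtype.ext h⟩

theorem genSieve_isGeneratedBy : (genSieve f).IsGeneratedBy f where
  obj_iff _ g := ⟨fun ⟨s, hs⟩ => hs ▸ s.2, fun h => ⟨⟨g, h⟩, rfl⟩⟩
  map_iff _ _ _ α := ⟨fun ⟨φ, hφ⟩ => hφ ▸ φ.2, fun h => ⟨⟨α, h⟩, rfl⟩⟩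

variable {F : StrictPseudofunctor Cᵒᵖ Cat.{u, u}}

/-- Restriction of a 2-sheaf for the atomic topology along any arrow `f` is an embedding: sections
with equal restrictions along `f` define the same map on the sieve generated by `f`. -/
theorem IsTwoSheaf.isEmb_res (hF : IsTwoSheaf (atomicTopology C) F) : IsEmb (res F f) := by
  have hg := genSieve_isGeneratedBy f
  have hS : genSieve f ∈ atomicTopology C c := ⟨d, f, hg⟩
  obtain ⟨s₀, h₀⟩ := hg.exists_gen
  refine .of_injective_faithful (fun X Y h => ?_) ⟨fun {X Y m n} h => ?_⟩
  · have e : yoMap X = yoMap Y := sheaf_hom_ext hF hS <| hg.nat_ext h₀ <| by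
      change (comp₁ (yoMap X) d).obj ((comp₁ (genSieve f).ι d).obj s₀) =
        (comp₁ (yoMap Y) d).obj ((comp₁ (genSieve f).ι d).obj s₀)
      rw [h₀]; exact h
    rw [← yoMap_id X, e, yoMap_id]
  · have e : yoMap₂ m = yoMap₂ n := sheaf_mod_ext hF hS <| hg.mod_ext h₀ <| by
      change (comp₂ (yoMap₂ m) d).app ((comp₁ (genSieve f).ι d).obj s₀) =
        (comp₂ (yoMap₂ n) d).app ((comp₁ (genSieve f).ι d).obj s₀)
      rw [h₀]; exact h
    exact arrow_eq (by rw [← yoMap₂_id m, e, yoMap₂_id])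

end GenSieve

end Sieves

/-! ### Locally surjective embeddings of 2-sheaves -/

section Local

variable {C : Type u} [Bicategory.{u, u} C] [Bicategory.Strict C]
  {S F F' : StrictPseudofunctor Cᵒᵖ Cat.{u, u}} {η : F ⟶ F'}

/-- Lifts along a levelwise embedding are automatically 2-natural. -/
theorem exists_nat_lift (hη : ∀ a, IsEmb (comp₁ η a)) (τ : S ⟶ F')
    (w : ∀ (a : C) {x y : S.obj (op a)} (f : x ⟶ y), InIm (comp₁ η a) ((comp₁ τ a).map f)) :
    ∃ L : S ⟶ F, L ≫ η = τ := by
  choose L hL using fun a => (hη a).exists_lift (comp₁ τ a) (w a)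
  have hL' (a : C) {x y : S.obj (op a)} (f : x ⟶ y) :
      Arrow.mk ((comp₁ η a).map ((L a).map f)) = Arrow.mk ((comp₁ τ a).map f) :=
    arrow_functor (hL a) f
  refine ⟨natOf L (fun {a b} f => (hη a).cancel ?_) fun {a b f g} α X => (hη a).arrow _ _ ?_,
    nat_ext hL⟩
  · rw [Functor.assoc, Functor.assoc, hL, comp₁_res, comp₁_res, ← hL, Functor.assoc]
  · refine (hL' a _).trans ((comp₁_res₂ τ α X).trans ?_)
    refine Eq.trans ?_ (comp₁_res₂ η α _).symm
    exact arrow_app _ (Functor.congr_obj (hL b) X).symm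

/-- Lifts along a levelwise embedding are automatically compatible with restriction. -/
theorem exists_mod_lift (hη : ∀ a, IsEmb (comp₁ η a)) {θ κ : S ⟶ F} (ν : θ ≫ η ⟶ κ ≫ η)
    (w : ∀ (a : C) (s : S.obj (op a)), InIm (comp₁ η a) ((comp₂ ν a).app s)) :
    ∃ μ : θ ⟶ κ, μ ▷ η = ν := by
  have w' (a : C) (s : S.obj (op a)) : ∃ f : (comp₁ θ a).obj s ⟶ (comp₁ κ a).obj s,
      Arrow.mk ((comp₁ η a).map f) = Arrow.mk ((comp₂ ν a).app s) := by
    obtain ⟨x, y, f, hf⟩ := w a s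
    obtain rfl : x = (comp₁ θ a).obj s := (hη a).obj (arrow_left hf)
    obtain rfl : y = (comp₁ κ a).obj s := (hη a).obj (arrow_right hf)
    exact ⟨f, hf⟩
  choose m hm using w'
  refine ⟨modOf (fun a => { app := m a, naturality := fun s t φ => ?_ }) fun {a b} f X => ?_,
    modification_ext fun a s => arrow_eq (hm a s)⟩
  · refine arrow_eq ((hη a).arrow _ _ ?_)
    rw [Functor.map_comp, Functor.map_comp]
    refine (arrow_comp rfl (hm a t)).trans (Eq.trans ?_ (arrow_comp (hm a s) rfl).symm)
    exact congrArg Arrow.mk ((comp₂ ν a).naturality φ)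
  · refine (hη a).arrow _ _ ((hm a _).trans ((comp₂_res ν f X).trans ?_))
    exact ((arrow_map _ (hm b X)).symm.trans (comp₁_res_map η f _).symm)

variable {c d : C}

/-- An object of a 2-sheaf whose restriction along one arrow comes from a 2-sheaf `F` embedded in it
comes from `F`: the sieve generated by the arrow maps to `F`, and the 2-sheaf condition extends this
map to the representable 2-presheaf. -/
theorem exists_section_lift (hF : IsTwoSheaf (atomicTopology C) F)
    (hF' : IsTwoSheaf (atomicTopology C) F') (hη : ∀ a, IsEmb (comp₁ η a)) {j : d ⟶ c}
    {H : F'.obj (op c)} {X : F.obj (op d)} (h : (comp₁ η d).obj X = (res F' j).obj H) :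
    ∃ Y, (comp₁ η c).obj Y = H := by
  have hg := genSieve_isGeneratedBy j
  have hS : genSieve j ∈ atomicTopology C c := ⟨d, j, hg⟩
  obtain ⟨s₀, h₀⟩ := hg.exists_gen
  let τ : (genSieve j).dom ⟶ F' := (genSieve j).ι ≫ yoMap H
  have hτ : (comp₁ τ d).obj s₀ = (comp₁ η d).obj X := by
    refine Eq.trans ?_ h.symm
    exact congrArg (comp₁ (yoMap H) d).obj h₀
  obtain ⟨L, hL⟩ := exists_nat_lift hη τ fun a {x y} φ => by
    refine hg.induction_on h₀ (fun p => InIm (comp₁ η a) ((comp₁ τ a).map p.hom))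
      (fun β => ?_) (fun φ ψ hφ hψ => ?_) φ
    · refine ⟨_, _, (res₂ F β).app X, (comp₁_res₂ η β X).trans ?_⟩
      exact (arrow_app _ hτ.symm).trans (comp₁_res₂ τ β s₀).symm
    · change InIm (comp₁ η a) ((comp₁ τ a).map (φ ≫ ψ))
      rw [Functor.map_comp]
      exact InIm.comp (hη a) hφ hψ
  obtain ⟨θ, hθ⟩ := sheaf_exists_hom hF hS L
  have e : θ ≫ η = yoMap H := sheaf_hom_ext hF' hS <| by
    rw [← Strict.assoc, hθ, hL]
  refine ⟨(comp₁ θ c).obj (𝟙 c), ?_⟩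
  refine Eq.trans ?_ (yoMap_id H)
  rw [← e]; rfl

/-- The analogue of `exists_section_lift` for arrows between sections. -/
theorem exists_section_lift₂ (hF : IsTwoSheaf (atomicTopology C) F)
    (hF' : IsTwoSheaf (atomicTopology C) F') (hη : ∀ a, IsEmb (comp₁ η a)) {j : d ⟶ c}
    {H K : F'.obj (op c)} {M : H ⟶ K} (h : InIm (comp₁ η d) ((res F' j).map M)) :
    InIm (comp₁ η c) M := by
  obtain ⟨X, X', m, hm⟩ := h
  obtain ⟨A, rfl⟩ := exists_section_lift hF hF' hη (arrow_left hm)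
  obtain ⟨B, rfl⟩ := exists_section_lift hF hF' hη (arrow_right hm)
  have hg := genSieve_isGeneratedBy j
  have hS : genSieve j ∈ atomicTopology C c := ⟨d, j, hg⟩
  obtain ⟨s₀, h₀⟩ := hg.exists_gen
  have e (A : F.obj (op c)) : (comp₁ (yoMap A ≫ η) c).obj (𝟙 c) = (comp₁ η c).obj A :=
    congrArg (comp₁ η c).obj (yoMap_id A)
  obtain ⟨μ, hμ⟩ := yo_mod_exists M (e A) (e B)
  let ν : ((genSieve j).ι ≫ yoMap A) ≫ η ⟶ ((genSieve j).ι ≫ yoMap B) ≫ η := (genSieve j).ι ◁ μ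
  have hν : Arrow.mk ((comp₂ ν d).app s₀) = Arrow.mk ((comp₁ η d).map m) := by
    refine Eq.trans ?_ hm.symm
    refine Eq.trans ?_ (arrow_map _ hμ)
    refine Eq.trans ?_ (comp₂_res μ j (𝟙 c))
    refine arrow_app (comp₂ μ d) ?_
    exact h₀.trans (Strict.comp_id j).symm
  obtain ⟨μ₁, hμ₁⟩ := exists_mod_lift hη ν fun a s => by
    obtain ⟨k, rfl⟩ := hg.exists_res h₀ s
    refine ⟨_, _, (res F k).map m, (comp₁_res_map η k m).trans ?_⟩
    exact (arrow_map _ hν.symm).trans (comp₂_res ν k s₀).symm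
  obtain ⟨μ₂, hμ₂⟩ := sheaf_exists_mod hF hS μ₁
  have e₂ : μ₂ ▷ η = μ := sheaf_mod_ext hF' hS <| by
    refine Eq.trans ?_ hμ₁
    rw [← hμ₂]
    rfl
  refine ⟨_, _, (comp₂ μ₂ c).app (𝟙 c), Eq.trans ?_ hμ⟩
  rw [← e₂]; rfl

/-- A levelwise embedding of 2-sheaves for the atomic topology whose image contains a restriction
of every arrow is an isomorphism. -/
theorem isIso_of_locally_surjective (hF : IsTwoSheaf (atomicTopology C) F)
    (hF' : IsTwoSheaf (atomicTopology C) F') (hη : ∀ a, IsEmb (comp₁ η a))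
    (h : ∀ (c : C) {H K : F'.obj (op c)} (M : H ⟶ K), ∃ (d : C) (j : d ⟶ c),
      InIm (comp₁ η d) ((res F' j).map M)) : IsIso η :=
  isIso_of_isEmb η hη fun a {_ _} f => by
    obtain ⟨d, j, hj⟩ := h a f
    exact exists_section_lift₂ hF hF' hη hj

end Local

/-! ### The 2-presheaf of an action is a 2-sheaf -/

section Representing

variable {G : TopTwoGroup.{u}} {X : TwoAction G} {c d : Orbit G}

open Orbit

/-- The base point of `G/V` lies in the image of every morphism `f : G/U ⟶ G/V`; if `A` induces
`f`, it is the image of the coset of `A⁻¹`. -/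
theorem Induces.obj_inv {U V : OpenSub G} {A : G.G₀} {F : OpenSub.coset U ⟶ OpenSub.coset V}
    (h : Induces A F) : F.functor.obj (OpenSub.Coset.mk U A⁻¹) = TwoElmendorf.base V :=
  (h.obj A⁻¹).trans (by rw [mul_inv_cancel]; rfl)

theorem Induces.comp_ext {U V : OpenSub G} {A : G.G₀} {F : OpenSub.coset U ⟶ OpenSub.coset V}
    (h : Induces A F) {H K : OpenSub.coset V ⟶ X} (w : F ≫ H = F ≫ K) : H = K := by
  refine coset_ext ?_
  have e := congrArg (fun T : OpenSub.coset U ⟶ X =>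
    T.functor.obj (OpenSub.Coset.mk U A⁻¹)) w
  change H.functor.obj (F.functor.obj _) = K.functor.obj (F.functor.obj _) at e
  rwa [h.obj_inv] at e

theorem Induces.comp_ext₂ {U V : OpenSub G} {A : G.G₀} {F : OpenSub.coset U ⟶ OpenSub.coset V}
    (h : Induces A F) {H K : OpenSub.coset V ⟶ X} {θ κ : H ⟶ K} (w : F ◁ θ = F ◁ κ) :
    θ = κ := by
  refine arrow_eq (coset_ext₂ 1 ?_)
  have e := congrArg (fun T : F ≫ H ⟶ F ≫ K =>
    T.natTrans.app (OpenSub.Coset.mk U A⁻¹)) w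
  have e' : Arrow.mk (θ.natTrans.app (F.functor.obj (OpenSub.Coset.mk U A⁻¹))) =
    Arrow.mk (κ.natTrans.app (F.functor.obj (OpenSub.Coset.mk U A⁻¹))) := congrArg Arrow.mk e
  exact (arrow_app _ h.obj_inv.symm).trans (e'.trans (arrow_app _ h.obj_inv))

/-- Arrows `v` of the sub-2-group `V` give, after conjugation with an object `A` that induces
`f : G/U ⟶ G/V`, a 2-cell `γ` of morphisms into `G/U` whose composite with `f` is an identity. -/
theorem exists_fixing_cell {f : d ⟶ c} {A : G.G₀} (hf : Induces A f.functor) {v : G.G₁}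
    (hv : v ∈ c.sub.U₁) : ∃ (W : Orbit G) (i k l : W ⟶ d) (γ : k ⟶ l), Inc i ∧
      Induces₂ ((G.one A)⁻¹ * v * G.one A) γ.trans ∧
      Arrow.mk (γ ▷ f) = Arrow.mk (𝟙 (i ≫ f)) := by
  obtain ⟨W, i, k, l, γ, hi, hγ⟩ := exists_cell ((G.one A)⁻¹ * v * G.one A) d d
  refine ⟨W, i, k, l, γ, hi, hγ, arrow_ext_of_induces₂ (g := v * G.one A) ?_ ?_⟩
  · have := hγ.whiskerRight hf
    rwa [← mul_assoc, mul_inv_cancel_left] at this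
  · exact (Induces₂.id (hi.comp_induces hf)).mul_left hv

theorem functor_carr_at {U : OpenSub G} (H : OpenSub.coset U ⟶ X) (A : G.G₀) (g : G.G₁) :
    Arrow.mk (H.functor.map (carr U (G.one A * g))) =
      Arrow.mk (amap (𝟙 (H.functor.obj (OpenSub.Coset.mk U A))) g) := by
  refine (functor_carr H _).trans ((amap_mul _ _ _).symm.trans (amap_congr ?_ rfl))
  refine (amap_id _ A).trans (arrow_id ?_)
  exact (EquivFunctor_obj H _ A).symm.trans (congrArg H.functor.obj (mk_eq_aobj A).symm)

section

variable {S : TwoSieve c} {f : d ⟶ c} {s₀ : S.dom.obj (op d)} {A : G.G₀}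

/-- A 2-natural transformation from a sieve generated by `f` to `Φ X` takes the generator to an
equivariant functor whose value over the base point is fixed by the sub-2-group. -/
theorem isPoint_of_sieve (h₀ : (comp₁ S.ι d).obj s₀ = f) (hf : Induces A f.functor)
    (τ : S.dom ⟶ (Φ G).obj X) (K : OpenSub.coset d.sub ⟶ X) (hK : (comp₁ τ d).obj s₀ = K) :
    IsPoint c.sub (K.functor.obj (OpenSub.Coset.mk d.sub A⁻¹)) := by
  subst hK
  intro v hv
  obtain ⟨W, i, k, l, γ, hi, hγ, e⟩ := exists_fixing_cell hf hv
  -- `γ ▷ f` is an identity and the sieve is embedded, so `γ` acts trivially on the generator.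
  have e₁ : Arrow.mk ((res₂ S.dom γ).app s₀) = Arrow.mk (𝟙 ((res S.dom i).obj s₀)) := by
    refine (S.isEmb W).arrow _ _ ?_
    refine (TwoSieve.IsGeneratedBy.ι_res₂ h₀ γ).trans (e.trans ?_)
    rw [CategoryTheory.Functor.map_id]
    exact (arrow_id (TwoSieve.IsGeneratedBy.ι_res h₀ i)).symm
  set K : OpenSub.coset d.sub ⟶ X := (comp₁ τ d).obj s₀ with hK
  have e₂ : Arrow.mk (γ.trans ▷ K) = Arrow.mk (𝟙 (i.functor ≫ K)) := by
    refine (comp₁_res₂ τ γ s₀).symm.trans ((arrow_map (comp₁ τ W) e₁).trans ?_)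
    rw [CategoryTheory.Functor.map_id]
    exact arrow_id (comp₁_res_obj τ i s₀)
  have e₃ : Arrow.mk (K.functor.map (γ.trans.natTrans.app (OpenSub.Coset.mk W.sub A⁻¹))) =
      Arrow.mk (𝟙 (K.functor.obj (i.functor.functor.obj (OpenSub.Coset.mk W.sub A⁻¹)))) :=
    congrArg (fun p : Arrow (OpenSub.coset W.sub ⟶ X) =>
      Arrow.mk (p.hom.natTrans.app (OpenSub.Coset.mk W.sub A⁻¹))) e₂
  have e₄ : Arrow.mk (γ.trans.natTrans.app (OpenSub.Coset.mk W.sub A⁻¹)) =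
      Arrow.mk (carr d.sub (G.one A⁻¹ * v)) := by
    refine arr_eq_mk_iff.1 ((hγ.app A⁻¹).trans ?_)
    congr 1
    rw [map_inv]; group
  refine (functor_carr_at K A⁻¹ v).symm.trans ((arrow_map K.functor e₄).symm.trans (e₃.trans ?_))
  refine arrow_id (congrArg K.functor.obj ((hi.obj A⁻¹).trans ?_))
  rw [one_mul]

/-- A modification between 2-natural transformations from a sieve generated by `f` to `Φ X` has at
the generator a component whose value over the base point is fixed by the sub-2-group. -/
theorem fixed_of_sieve (h₀ : (comp₁ S.ι d).obj s₀ = f) (hf : Induces A f.functor)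
    {τ τ' : S.dom ⟶ (Φ G).obj X} (ν : τ ⟶ τ') {K K' : OpenSub.coset d.sub ⟶ X} (m : K ⟶ K')
    (hm : Arrow.mk ((comp₂ ν d).app s₀) = Arrow.mk m) {B : G.G₀} (hB : B ∈ c.sub.U₀) :
    Arrow.mk (amap (m.natTrans.app (OpenSub.Coset.mk d.sub A⁻¹)) (G.one B)) =
      Arrow.mk (m.natTrans.app (OpenSub.Coset.mk d.sub A⁻¹)) := by
  obtain ⟨W, i, k, l, γ, hi, hγ, e⟩ := exists_fixing_cell hf (c.sub.one_mem hB)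
  have e₁ : (res S.dom k).obj s₀ = (res S.dom i).obj s₀ := by
    refine (S.isEmb W).obj ?_
    rw [TwoSieve.IsGeneratedBy.ι_res h₀, TwoSieve.IsGeneratedBy.ι_res h₀]
    exact arrow_left e
  -- The component of `ν` at a restriction of the generator is the restriction of `m`.
  have key {k : W ⟶ d} : Arrow.mk ((comp₂ ν W).app ((res S.dom k).obj s₀)) =
      Arrow.mk (k.functor ◁ m) :=
    (comp₂_res ν k s₀).trans (arrow_map (res ((Φ G).obj X) k) hm)
  have e₂ : Arrow.mk (k.functor ◁ m) = Arrow.mk (i.functor ◁ m) :=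
    key.symm.trans ((arrow_app _ e₁).trans key)
  have e₃ : Arrow.mk (m.natTrans.app (k.functor.functor.obj (OpenSub.Coset.mk W.sub A⁻¹))) =
      Arrow.mk (m.natTrans.app (i.functor.functor.obj (OpenSub.Coset.mk W.sub A⁻¹))) :=
    congrArg (fun p : Arrow (OpenSub.coset W.sub ⟶ X) =>
      Arrow.mk (p.hom.natTrans.app (OpenSub.Coset.mk W.sub A⁻¹))) e₂
  have e₄ : k.functor.functor.obj (OpenSub.Coset.mk W.sub A⁻¹) =
      aobj (show (OpenSub.coset d.sub).carrier from OpenSub.Coset.mk d.sub A⁻¹) B := by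
    refine (hγ.dom.obj A⁻¹).trans (congrArg (OpenSub.Coset.mk d.sub) ?_)
    simp [G.dom_one]
  have e₅ : i.functor.functor.obj (OpenSub.Coset.mk W.sub A⁻¹) = OpenSub.Coset.mk d.sub A⁻¹ :=
    (hi.obj A⁻¹).trans (by rw [one_mul])
  refine (EquivNatTrans_app m _ B).symm.trans ?_
  exact (arrow_app _ e₄.symm).trans (e₃.trans (arrow_app _ e₅))

end

/-- For every action `X`, the 2-presheaf `Φ X` is a 2-sheaf for the atomic topology. -/
theorem isTwoSheaf_phi (X : TwoAction G) :
    IsTwoSheaf (atomicTopology (Orbit G)) ((Φ G).obj X) := by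
  refine isTwoSheaf_of _ ?_ ?_ ?_ ?_
  · rintro c S ⟨d, f, hS⟩ θ κ h
    obtain ⟨A, hf⟩ := f.induced
    obtain ⟨s₀, h₀⟩ := hS.exists_gen
    refine yo_ext (hf.comp_ext (X := X) ?_)
    have e : (comp₁ θ d).obj ((comp₁ S.ι d).obj s₀) = (comp₁ κ d).obj ((comp₁ S.ι d).obj s₀) :=
      congrArg (fun t => (comp₁ t d).obj s₀) h
    rw [h₀] at e
    exact (yo_obj θ f).symm.trans (e.trans (yo_obj κ f))
  · rintro c S ⟨d, f, hS⟩ θ κ μ ν h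
    obtain ⟨A, hf⟩ := f.induced
    obtain ⟨s₀, h₀⟩ := hS.exists_gen
    refine yo_mod_ext (hf.comp_ext₂ (X := X) ?_)
    have e : Arrow.mk ((comp₂ μ d).app ((comp₁ S.ι d).obj s₀)) =
        Arrow.mk ((comp₂ ν d).app ((comp₁ S.ι d).obj s₀)) :=
      congrArg (fun t => Arrow.mk ((comp₂ t d).app s₀)) h
    rw [h₀] at e
    exact arrow_eq ((yo_app μ f).symm.trans (e.trans (yo_app ν f)))
  · rintro c S ⟨d, f, hS⟩ τ
    obtain ⟨A, hf⟩ := f.induced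
    obtain ⟨s₀, h₀⟩ := hS.exists_gen
    let K : OpenSub.coset d.sub ⟶ X := (comp₁ τ d).obj s₀
    have hx := isPoint_of_sieve h₀ hf τ K rfl
    refine ⟨yoMap (F := (Φ G).obj X) (c := c) (pointFunctor hx), hS.nat_ext h₀ ?_⟩
    refine (congrArg
      (comp₁ (yoMap (F := (Φ G).obj X) (c := c) (pointFunctor hx)) d).obj h₀).trans ?_
    change (f.functor ≫ pointFunctor hx : OpenSub.coset d.sub ⟶ X) = K
    refine coset_ext_at A⁻¹ ?_
    refine (congrArg (pointFunctor hx).functor.obj hf.obj_inv).trans ?_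
    exact pointFunctor_base hx
  · rintro c S ⟨d, f, hS⟩ θ κ ν
    obtain ⟨A, hf⟩ := f.induced
    obtain ⟨s₀, h₀⟩ := hS.exists_gen
    let H : OpenSub.coset c.sub ⟶ X := (comp₁ θ c).obj (𝟙 c)
    let H' : OpenSub.coset c.sub ⟶ X := (comp₁ κ c).obj (𝟙 c)
    have e (θ : yo c ⟶ (Φ G).obj X) : (comp₁ θ d).obj ((comp₁ S.ι d).obj s₀) =
        (res ((Φ G).obj X) f).obj ((comp₁ θ c).obj (𝟙 c)) := by rw [h₀, yo_obj]
    let p := arrowHom (Arrow.mk ((comp₂ ν d).app s₀)) (e θ) (e κ)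
    have hp : Arrow.mk p = Arrow.mk ((comp₂ ν d).app s₀) := mk_arrowHom _ _ _
    let m : f.functor ≫ H ⟶ f.functor ≫ H' := p
    have eb (H : OpenSub.coset c.sub ⟶ X) :
        (f.functor ≫ H).functor.obj (OpenSub.Coset.mk d.sub A⁻¹) = H.functor.obj (base c.sub) :=
      congrArg H.functor.obj hf.obj_inv
    -- The value of `m` over the base point, from which the 2-cell `H ⟶ H'` is built.
    let q := arrowHom (Arrow.mk (m.natTrans.app (OpenSub.Coset.mk d.sub A⁻¹))) (eb H) (eb H')
    have hq : Arrow.mk q = Arrow.mk (m.natTrans.app (OpenSub.Coset.mk d.sub A⁻¹)) :=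
      mk_arrowHom _ _ _
    obtain ⟨χ, hχ⟩ := exists_coset_nat H H' q fun B hB =>
      (amap_congr hq rfl).trans ((fixed_of_sieve h₀ hf ν m hp.symm hB).trans hq.symm)
    have hm : Arrow.mk (f.functor ◁ χ) = Arrow.mk m := by
      refine coset_ext₂ A⁻¹ (Eq.trans ?_ hq)
      rw [← hχ]
      exact arrow_app χ.natTrans hf.obj_inv
    obtain ⟨μ, hμ⟩ := yo_mod_exists (F := (Φ G).obj X) (θ := θ) (κ := κ) χ rfl rfl
    refine ⟨μ, hS.mod_ext h₀ (arrow_eq ?_)⟩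
    refine (arrow_app (comp₂ μ d) h₀).trans ((yo_app μ f).trans ?_)
    exact (arrow_map (res ((Φ G).obj X) f) hμ).trans (hm.trans hp)

end Representing

/-! ### The comparison of a 2-presheaf with `Φ Ψ` -/

noncomputable section Eta

variable {G : TopTwoGroup.{u}} {F F' : StrictPseudofunctor (Orbit G)ᵒᵖ Cat.{u, u}}

open Orbit

theorem induces₂_of_mem {U : Orbit G} {g : G.G₁} (hg : g ∈ U.sub.U₁) :
    Induces₂ g (Hom₂.trans (𝟙 (𝟙 U))) := by
  have := (Induces₂.id (Induces.id U.sub)).mul_left hg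
  rwa [map_one, mul_one] at this

/-- An arrow `[U, m]` of the colimit is fixed by the arrows of `U`. -/
theorem psiι_map_fixed {U : Orbit G} {X Y : F.obj (op U)} (m : X ⟶ Y) {g : G.G₁}
    (hg : g ∈ U.sub.U₁) :
    Arrow.mk (amap ((psiι F U).map m) g) = Arrow.mk ((psiι F U).map m) := by
  refine (amap_psiι (induces₂_of_mem hg) m).trans (arrow_map _ ?_)
  rw [resMap_id_left]
  exact res_id_map F m

/-- The class `[U, X]` is fixed by `U`, hence defines an equivariant functor out of `G/U`. -/
theorem isPoint_psiι {U : Orbit G} (X : F.obj (op U)) : IsPoint U.sub ((psiι F U).obj X) := by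
  intro g hg
  have := psiι_map_fixed (𝟙 X) hg
  rwa [CategoryTheory.Functor.map_id] at this

theorem eta_exists_map {U : Orbit G} {X Y : F.obj (op U)} (m : X ⟶ Y) :
    ∃ θ : pointFunctor (isPoint_psiι X) ⟶ pointFunctor (isPoint_psiι Y),
      Arrow.mk (θ.natTrans.app (base U.sub)) = Arrow.mk ((psiι F U).map m) := by
  let p := arrowHom (Arrow.mk ((psiι F U).map m)) (pointFunctor_base (isPoint_psiι X)).symm
    (pointFunctor_base (isPoint_psiι Y)).symm
  have hp : Arrow.mk p = Arrow.mk ((psiι F U).map m) := mk_arrowHom _ _ _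
  obtain ⟨θ, hθ⟩ := exists_coset_nat _ _ p fun A hA =>
    (amap_congr hp rfl).trans ((psiι_map_fixed m (U.sub.one_mem hA)).trans hp.symm)
  exact ⟨θ, by rw [hθ, hp]⟩

theorem eta_map_base {U : Orbit G} {X Y : F.obj (op U)} (m : X ⟶ Y) :
    Arrow.mk ((eta_exists_map m).choose.natTrans.app (base U.sub)) =
      Arrow.mk ((psiι F U).map m) :=
  (eta_exists_map m).choose_spec

variable (F) in
/-- The functor that sends an object `X` of `F (G/U)` to the equivariant functor `G/U ⥤ Ψ F` with
value `[U, X]` at the base point. -/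
def etaFunctor (U : Orbit G) : F.obj (op U) ⥤ (OpenSub.coset U.sub ⟶ psiObj F) where
  obj X := pointFunctor (isPoint_psiι X)
  map m := (eta_exists_map m).choose
  map_id X := arrow_eq <| coset_ext₂ 1 <| (eta_map_base (𝟙 X)).trans <| by
    rw [CategoryTheory.Functor.map_id]
    exact arrow_id (pointFunctor_base (isPoint_psiι X)).symm
  map_comp m n := arrow_eq <| coset_ext₂ 1 <| (eta_map_base (m ≫ n)).trans <| by
    rw [CategoryTheory.Functor.map_comp]
    exact arrow_comp (eta_map_base m).symm (eta_map_base n).symm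

theorem etaFunctor_obj {U : Orbit G} (X : F.obj (op U)) :
    ((etaFunctor F U).obj X).functor.obj (base U.sub) = (psiι F U).obj X :=
  pointFunctor_base (isPoint_psiι X)

theorem etaFunctor_map {U : Orbit G} {X Y : F.obj (op U)} (m : X ⟶ Y) :
    Arrow.mk (((etaFunctor F U).map m).natTrans.app (base U.sub)) =
      Arrow.mk ((psiι F U).map m) :=
  eta_map_base m

variable (F) in
/-- The component at `F` of the 2-natural transformation from the identity to `Φ Ψ`. -/
def eta : F ⟶ (Φ G).obj (psiObj F) :=
  natOf (F' := (Φ G).obj (psiObj F)) (etaFunctor F)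
    (fun {a b} f => functor_ext_arrow (E := OpenSub.coset a.sub ⟶ psiObj F) fun {X Y} m => by
      obtain ⟨A, hA⟩ := f.induced
      have e : Induces₂ (G.one A) (Hom₂.trans (𝟙 f)) := Induces₂.id hA
      refine coset_ext₂ 1 ((etaFunctor_map _).trans ?_)
      change _ = Arrow.mk (((etaFunctor F b).map m).natTrans.app (f.functor.functor.obj (base _)))
      refine Eq.trans ?_ (arrow_app _ (hA.base.trans (mk_eq_aobj A)).symm)
      refine Eq.trans ?_ (EquivNatTrans_app _ _ A).symm
      refine Eq.trans ?_ (amap_congr (etaFunctor_map m) rfl).symm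
      refine Eq.trans ?_ (amap_psiι e m).symm
      rw [resMap_id_left])
    (fun {a b f g} α X => by
      obtain ⟨k, hk⟩ := α.induced
      refine coset_ext₂ (U := a.sub) (X := psiObj F) 1 ((etaFunctor_map _).trans ?_)
      change _ = Arrow.mk (((etaFunctor F b).obj X).functor.map (α.trans.natTrans.app (base a.sub)))
      refine Eq.trans ?_ (arrow_map _ hk.arrow_base).symm
      refine Eq.trans ?_ (functor_carr _ k).symm
      refine Eq.trans ?_ (amap_congr (arrow_id (etaFunctor_obj X)) rfl).symm
      rw [← CategoryTheory.Functor.map_id]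
      refine Eq.trans ?_ (amap_psiι hk (𝟙 X)).symm
      rw [resMap_id_right])

theorem mod_arrow_ext {C : Type u₁} [Bicategory.{w₁, v₁} C] [Bicategory.Strict C]
    {F F' : StrictPseudofunctor Cᵒᵖ Cat.{v₂, u₂}} {θ κ θ' κ' : F ⟶ F'} (hθ : θ = θ')
    (hκ : κ = κ') {m : θ ⟶ κ} {n : θ' ⟶ κ'}
    (h : ∀ a X, Arrow.mk ((comp₂ m a).app X) = Arrow.mk ((comp₂ n a).app X)) :
    Arrow.mk m = Arrow.mk n := by
  subst hθ; subst hκ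
  exact congrArg Arrow.mk (modification_ext fun a X => arrow_eq (h a X))

theorem eta_naturality (θ : F ⟶ F') :
    θ ≫ eta F' = eta F ≫ (Φ G).map (psiMap θ) :=
  nat_ext fun U => functor_ext_arrow fun m => by
    refine coset_ext₂ (U := U.sub) (X := psiObj F') 1 ((etaFunctor_map _).trans ?_)
    exact (psiFunctor_map θ m).symm.trans (arrow_map _ (etaFunctor_map m).symm)

theorem eta_naturality₂ {θ κ : F ⟶ F'} (μ : θ ⟶ κ) :
    Arrow.mk (μ ▷ eta F') = Arrow.mk (eta F ◁ (Φ G).map₂ (psiMap₂ μ)) :=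
  mod_arrow_ext (eta_naturality θ) (eta_naturality κ) fun U X => by
    refine coset_ext₂ (U := U.sub) (X := psiObj F') 1
      ((etaFunctor_map ((comp₂ μ U).app X)).trans ?_)
    refine (psiMap₂_app μ X).symm.trans ?_
    exact arrow_app (psiMap₂ μ).natTrans (etaFunctor_obj X).symm

/-- Restriction maps of 2-sheaves are embeddings, so a 2-sheaf embeds into its colimit. -/
theorem isEmb_eta (hF : IsTwoSheaf (atomicTopology (Orbit G)) F) (U : Orbit G) :
    IsEmb (comp₁ (eta F) U) := by
  refine ⟨fun {X Y X' Y'} m n h => ?_⟩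
  have e : Arrow.mk (((etaFunctor F U).map m).natTrans.app (base U.sub)) =
      Arrow.mk (((etaFunctor F U).map n).natTrans.app (base U.sub)) :=
    congrArg (fun p : Arrow (OpenSub.coset U.sub ⟶ psiObj F) =>
      Arrow.mk (p.hom.natTrans.app (base U.sub))) h
  obtain ⟨W, a, b, ha, hb, e⟩ := colimι_map_eq_iff.1
    ((etaFunctor_map m).symm.trans (e.trans (etaFunctor_map n)))
  obtain rfl := ha.eq hb
  exact (IsTwoSheaf.isEmb_res a hF).arrow _ _ e

/-- For a 2-sheaf `F` the comparison with `Φ Ψ F` is an isomorphism: an arrow of `Φ Ψ F` over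
`G/U` is determined by its component `[V, m]` at the base point, and it is in the image of `F`
after restriction to the coset category of `U ∩ V`. -/
theorem isIso_eta (hF : IsTwoSheaf (atomicTopology (Orbit G)) F) : IsIso (eta F) := by
  refine isIso_of_locally_surjective hF (isTwoSheaf_phi _) (isEmb_eta hF) fun U {H K} M => ?_
  let M' : (show OpenSub.coset U.sub ⟶ psiObj F from H) ⟶
    (show OpenSub.coset U.sub ⟶ psiObj F from K) := M
  obtain ⟨V, X, Y, m, hm⟩ := colim_exists_map (M'.natTrans.app (base U.sub))
  obtain ⟨W, i, j, hi, hj⟩ := exists_inf V U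
  refine ⟨W, j, _, _, (res F i).map m, ?_⟩
  refine coset_ext₂ (U := W.sub) (X := psiObj F) 1 ((etaFunctor_map _).trans ?_)
  refine (colimι_res_map hi m).trans (hm.trans ?_)
  exact arrow_app M'.natTrans hj.base.symm

end Eta

/-! ### Stabilizers -/

section Stabilizers

variable {G : TopTwoGroup.{u}} {X : TwoAction G}

/-- The stabilizer of an arrow of an action. -/
def arrowStab {x y : X.carrier} (m : x ⟶ y) : Subgroup G.G₁ where
  carrier := {g | Arrow.mk (amap m g) = Arrow.mk m}
  one_mem' := amap_one m
  mul_mem' {g h} hg hh := (amap_mul m g h).symm.trans ((amap_congr hg rfl).trans hh)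
  inv_mem' {g} hg := by
    refine (amap_congr (Eq.symm hg) rfl).trans ((amap_mul m g g⁻¹).trans ?_)
    rw [mul_inv_cancel]
    exact amap_one m

/-- Stabilizers are open because the action is continuous for the discrete topology. -/
theorem isOpen_arrowStab {x y : X.carrier} (m : x ⟶ y) : IsOpen (arrowStab m : Set G.G₁) := by
  let _ : TopologicalSpace (Arrow X.carrier) := ⊥
  have : DiscreteTopology (Arrow X.carrier) := ⟨rfl⟩
  have h : Continuous fun g : G.G₁ => Arrow.mk (amap m g) :=
    X.continuous_map.comp (continuous_const.prodMk continuous_id : Continuous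
      fun g : G.G₁ => (Arrow.mk m, g))
  exact (isOpen_discrete {Arrow.mk m}).preimage h

/-- The stabilizer of an object of an action, as an open sub-2-group. Its arrows are those that fix
the identity of the object. Its objects are those `A` whose identity arrow has this property, which
is to say that `A` fixes the object. -/
def stab (x : X.carrier) : OpenSub G where
  U₀ := (arrowStab (𝟙 x)).comap G.one.toMonoidHom
  U₁ := arrowStab (𝟙 x)
  isOpen₀ := (isOpen_arrowStab (𝟙 x)).preimage G.one.continuous_toFun
  isOpen₁ := isOpen_arrowStab (𝟙 x)
  dom_mem {g} hg := (amap_id x _).trans (arrow_id (arrow_left hg))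
  cod_mem {g} hg := (amap_id x _).trans (arrow_id (arrow_right hg))
  one_mem h := h
  comp_mem {g h} w hg hh := by
    have e := amap_comp (𝟙 x) (𝟙 x) w (𝟙 x) (𝟙 x) (Eq.symm hg) (Eq.symm hh)
    rw [Category.comp_id] at e
    exact e.symm

/-- The stabilizer of an arrow `m` of an action, as an open sub-2-group: its arrows fix the
identities of both endpoints of `m`, and the identities of its objects fix `m`. -/
def stab₂ {x y : X.carrier} (m : x ⟶ y) : OpenSub G :=
  ((stab x).inf (stab y)).restrict ((arrowStab m).comap G.one.toMonoidHom)
    ((isOpen_arrowStab m).preimage G.one.continuous_toFun)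

end Stabilizers

/-! ### The comparison of an action with `Ψ Φ` -/

noncomputable section Epsilon

variable {G : TopTwoGroup.{u}} {X Y : TwoAction G}

open Orbit

variable (X) in
/-- Evaluation of equivariant functors at the base point. -/
def evalBase (U : Orbit G) : (OpenSub.coset U.sub ⟶ X) ⥤ X.carrier where
  obj H := H.functor.obj (base U.sub)
  map M := M.natTrans.app (base U.sub)
  map_id _ := rfl
  map_comp _ _ := rfl

variable (X) in
theorem eps_exists : ∃ L : Colim ((Φ G).obj X) ⥤ X.carrier, ∀ U,
    colimι ((Φ G).obj X) U ⋙ L = evalBase X U :=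
  colim_exists_desc (F := (Φ G).obj X) (D := X.carrier) (evalBase X) fun {_ U _} hi =>
    functor_ext_arrow (D := OpenSub.coset U.sub ⟶ X) fun {_ _} M =>
      arrow_app M.natTrans hi.base

variable (X) in
/-- The functor from `Ψ Φ X` to `X` given by evaluation at base points. -/
def epsFunctor : (psiObj ((Φ G).obj X)).carrier ⥤ X.carrier := (eps_exists X).choose

theorem epsFunctor_obj {U : Orbit G} (H : OpenSub.coset U.sub ⟶ X) :
    (epsFunctor X).obj ((psiι ((Φ G).obj X) U).obj H) = H.functor.obj (base U.sub) :=
  Functor.congr_obj ((eps_exists X).choose_spec U) H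

theorem epsFunctor_map {U : Orbit G} {H K : OpenSub.coset U.sub ⟶ X} (M : H ⟶ K) :
    Arrow.mk ((epsFunctor X).map ((psiι ((Φ G).obj X) U).map M)) =
      Arrow.mk (M.natTrans.app (base U.sub)) :=
  arrow_functor ((eps_exists X).choose_spec U) M

variable (X) in
/-- The component at `X` of the 2-natural transformation from `Ψ Φ` to the identity. -/
def eps : psiObj ((Φ G).obj X) ⟶ X :=
  equivOf (epsFunctor X) fun {x y} f g => by
    obtain ⟨U, H, K, M, hM⟩ := colim_exists_map f
    obtain rfl := arrow_left hM
    obtain rfl := arrow_right hM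
    obtain rfl := arrow_eq hM
    obtain ⟨O, i, a, b, γ, -, hγ⟩ := exists_cell g U U
    refine (arrow_map _ (amap_psiι hγ M)).trans ((epsFunctor_map _).trans ?_)
    refine Eq.trans ?_ (amap_congr (epsFunctor_map M) rfl).symm
    -- `M · g` is the composite of `M · 1` and `1 · g`.
    let H' : OpenSub.coset U.sub ⟶ X := H
    let K' : OpenSub.coset U.sub ⟶ X := K
    let M' : H' ⟶ K' := M
    refine (amap_comp (M'.natTrans.app (base U.sub)) (𝟙 _) (G.cod_one (G.dom g))
      (M'.natTrans.app (a.functor.functor.obj (base O.sub)))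
      (K'.functor.map (γ.trans.natTrans.app (base O.sub))) ?_ ?_).trans ?_
    · exact (arrow_app _ (hγ.dom.base.trans (mk_eq_aobj _))).trans (EquivNatTrans_app M' _ _)
    · exact (arrow_map _ hγ.arrow_base).trans (functor_carr K' g)
    · rw [Category.comp_id]
      exact amap_congr rfl (G.one_comp' _ _ _)

theorem eps_naturality (H : X ⟶ Y) : psiMap ((Φ G).map H) ≫ eps Y = eps X ≫ H :=
  psi_hom_ext fun U => functor_ext_arrow (D := OpenSub.coset U.sub ⟶ X) fun {P Q} M => by
    refine (arrow_map (epsFunctor Y) (psiFunctor_map ((Φ G).map H) M)).trans ?_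
    refine (epsFunctor_map (X := Y) _).trans ?_
    exact (arrow_map H.functor (epsFunctor_map M)).symm

variable (G) in
/-- The 2-natural transformation from `Ψ Φ` to the identity. -/
def epsNat : TwoNatTrans ((Φ G).comp (psi G)) (StrictPseudofunctor.id (TwoAction G)) where
  app X := eps X
  naturality H := eps_naturality H
  naturality₂ {X Y H K} α := square_of_arrow (eps_naturality H) (eps_naturality K) <|
    psi_hom₂_ext (eps_naturality H) (eps_naturality K) fun U P => by
      refine (arrow_map (epsFunctor Y) (psiMap₂_app ((Φ G).map₂ α) P)).trans ?_
      refine (epsFunctor_map (X := Y) _).trans ?_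
      exact arrow_app α.natTrans (epsFunctor_obj P).symm

theorem isEmb_eps : IsEmb (eps X).functor := by
  refine ⟨fun f f' h => ?_⟩
  obtain ⟨U, P, Q, M, hM⟩ := colim_exists_map f
  obtain ⟨V, P', Q', N, hN⟩ := colim_exists_map f'
  obtain ⟨W, i, j, hi, hj⟩ := exists_inf U V
  let M' : (show OpenSub.coset U.sub ⟶ X from P) ⟶ (show OpenSub.coset U.sub ⟶ X from Q) := M
  let N' : (show OpenSub.coset V.sub ⟶ X from P') ⟶ (show OpenSub.coset V.sub ⟶ X from Q') := N
  refine hM.symm.trans (Eq.trans ?_ hN)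
  refine colimι_map_eq_iff.2 ⟨W, i, j, hi, hj, ?_⟩
  refine coset_ext₂ (U := W.sub) (X := X) (θ := i.functor ◁ M') (κ := j.functor ◁ N') 1 ?_
  refine (arrow_app M'.natTrans hi.base).trans (Eq.trans ?_ (arrow_app N'.natTrans hj.base).symm)
  refine (epsFunctor_map M').symm.trans (Eq.trans ?_ (epsFunctor_map N'))
  exact (arrow_map (epsFunctor X) hM).trans (h.trans (arrow_map (epsFunctor X) hN).symm)

/-- Evaluation at base points is an isomorphism. An arrow `m` of `X` is the value at the base
point of a 2-cell out of `G/U` for `U` the stabilizer of `m`. -/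
theorem isIso_eps : IsIso (eps X) := by
  refine isIso_of_equiv _ isEmb_eps fun {x y} m => ?_
  have hx : IsPoint (stab₂ m) x := fun g hg => hg.1.1
  have hy : IsPoint (stab₂ m) y := fun g hg => hg.1.2
  let p := arrowHom (Arrow.mk m) (pointFunctor_base hx).symm (pointFunctor_base hy).symm
  have hp : Arrow.mk p = Arrow.mk m := mk_arrowHom _ _ _
  obtain ⟨θ, hθ⟩ := exists_coset_nat (pointFunctor hx) (pointFunctor hy) p fun A hA =>
    (amap_congr hp rfl).trans (Eq.trans hA.2 hp.symm)
  refine ⟨_, _, (psiι ((Φ G).obj X) ⟨stab₂ m⟩).map θ, ?_⟩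
  exact (epsFunctor_map (U := ⟨stab₂ m⟩) θ).trans (by rw [← hp, ← hθ])

end Epsilon

/-! ### The 2-equivalence -/

noncomputable section Equivalence

variable (G : TopTwoGroup.{u})

/-- The 2-natural isomorphism from the identity to `Ψ Φ`. -/
def unitIso : TwoNatIso (StrictPseudofunctor.id (TwoAction G))
    ((Sh.lift (atomicTopology (Orbit G)) (Φ G) isTwoSheaf_phi).comp
      ((Sh.incl (atomicTopology (Orbit G))).comp (psi G))) :=
  let e : TwoNatIso ((Φ G).comp (psi G)) (StrictPseudofunctor.id (TwoAction G)) :=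
    ⟨epsNat G, fun _ => isIso_eps⟩
  { hom :=
      { app := fun X => e.symm.hom.app X
        naturality := fun H => e.symm.hom.naturality H
        naturality₂ := fun α => e.symm.hom.naturality₂ α }
    isIso_app := fun X => e.symm.isIso_app X }

theorem induced_arrow {D : Type u₂} [Bicategory.{w₂, v₂} D] {I : Type u₁} {F : I → D}
    {X Y : InducedBicategory D F} {f g f' g' : X ⟶ Y} {α : f ⟶ g} {β : f' ⟶ g'}
    (h : Arrow.mk α.hom = Arrow.mk β.hom) : Arrow.mk α = Arrow.mk β := by
  obtain rfl : f = f' := InducedBicategory.hom_ext (arrow_left h)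
  obtain rfl : g = g' := InducedBicategory.hom_ext (arrow_right h)
  exact congrArg Arrow.mk (InducedBicategory.hom₂_ext (arrow_eq h))

theorem induced_isIso {D : Type u₂} [Bicategory.{w₂, v₂} D] [Bicategory.Strict D]
    {I : Type u₁} {F : I → D} {X Y : InducedBicategory D F} {f : F X ⟶ F Y} (h : IsIso f) :
    IsIso (InducedBicategory.mkHom f : X ⟶ Y) := by
  obtain ⟨g, h₁, h₂⟩ := h
  exact ⟨InducedBicategory.mkHom g, InducedBicategory.hom_ext h₁, InducedBicategory.hom_ext h₂⟩

/-- The 2-natural transformation from the identity of 2-sheaves to `Φ Ψ`. -/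
def shEta : TwoNatTrans (StrictPseudofunctor.id (Sh (atomicTopology (Orbit G))))
    (((Sh.incl (atomicTopology (Orbit G))).comp (psi G)).comp
      (Sh.lift (atomicTopology (Orbit G)) (Φ G) isTwoSheaf_phi)) where
  app F := InducedBicategory.mkHom (eta F.1)
  naturality θ := InducedBicategory.hom_ext (eta_naturality θ.hom)
  naturality₂ {_ _ θ κ} μ :=
    square_of_arrow (InducedBicategory.hom_ext (eta_naturality θ.hom))
      (InducedBicategory.hom_ext (eta_naturality κ.hom)) (induced_arrow (eta_naturality₂ μ.hom))

/-- The 2-natural isomorphism from `Φ Ψ` to the identity of 2-sheaves. -/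
def counitIso : TwoNatIso (((Sh.incl (atomicTopology (Orbit G))).comp (psi G)).comp
      (Sh.lift (atomicTopology (Orbit G)) (Φ G) isTwoSheaf_phi))
    (StrictPseudofunctor.id (Sh (atomicTopology (Orbit G)))) :=
  TwoNatIso.symm ⟨shEta G, fun F => induced_isIso (isIso_eta F.2)⟩

end Equivalence

end TwoElmendorf

theorem mainTheorem1 (G : TopTwoGroup.{u}) :
    ∃ (hΦ : ∀ X : TwoAction G, IsTwoSheaf (atomicTopology (Orbit G)) ((Φ G).obj X))
      (Ψ : StrictPseudofunctor (StrictPseudofunctor (Orbit G)ᵒᵖ Cat.{u, u}) (TwoAction G)),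
      Nonempty (ColimitPresentation Ψ) ∧
      ∃ E : TwoEquivalence (TwoAction G) (Sh (atomicTopology (Orbit G))),
        E.functor = Sh.lift (atomicTopology (Orbit G)) (Φ G) hΦ ∧
        E.inverse = (Sh.incl (atomicTopology (Orbit G))).comp Ψ :=
  ⟨isTwoSheaf_phi, psi G, ⟨psiPresentation G⟩,
    { functor := Sh.lift (atomicTopology (Orbit G)) (Φ G) isTwoSheaf_phi
      inverse := (Sh.incl (atomicTopology (Orbit G))).comp (psi G)
      unit := unitIso G
      counit := counitIso G }, rfl, rfl⟩
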